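/- Let $\mathbb C_+=\{z\in\mathbb C:\operatorname{Im}z>0\}$. For $p\in[1,\infty]$ let $\mathcal H^p_a(\mathbb C_+)$ be the space of all holomorphic functions $f$ on $\mathbb C_+$ with $\|f\|_{\mathcal H^p_a(\mathbb C_+)}<\infty$, where $$\|f\|_{\mathcal H^p_a(\mathbb C_+)}=\sup_{y>0}\Big(\int_{-\infty}^\infty|f(x+iy)|^p\,dx\Big)^{1/p}\quad(p<\infty),\qquad \|f\|_{\mathcal H^\infty_a(\mathbb C_+)}=\sup_{z\in\mathbb C_+}|f(z)|.$$ The boundary value function $f^*\in L^p(\mathbb R)$ of $f$ is defined by $f^*(x)=\lim_{y\to0^+}f(x+iy)$ for almost every $x\in\mathbb R$. Let $a:(0,\infty)\to[0,\infty)$ be (Lebesgue) measurable and set $$\mathscr S_aF(z)=\int_0^\infty F(tz)\,a(t)\,dt\quad(z\in\mathbb C_+),\qquad S_ag(x)=\int_0^\infty g(tx)\,a(t)\,dt\quad(x\in\mathbb R).$$ The operator $\mathscr S_a$ is called bounded on $\mathcal H^p_a(\mathbb C_+)$ if, for every $F\in\mathcal H^p_a(\mathbb C_+)$, the integral $\mathscr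 S_aF(z)$ converges absolutely for every $z\in\mathbb C_+$ and $\mathscr S_aF\in\mathcal H^p_a(\mathbb C_+)$, and there is a constant $C<\infty$ with $\|\mathscr S_aF\|_{\mathcal H^p_a(\mathbb C_+)}\le C\|F\|_{\mathcal H^p_a(\mathbb C_+)}$ for all $F\in\mathcal H^p_a(\mathbb C_+)$; its operator norm is the least such $C$. **Theorem.** Let $p\in[1,\infty]$ and let $a:(0,\infty)\to[0,\infty)$ be measurable. Then $\mathscr S_a$ is bounded on $\mathcal H^p_a(\mathbb C_+)$ if and only if $$\int_0^\infty t^{-1/p}a(t)\,dt<\infty$$ (with $1/\infty=0$). Moreover, in that case, $$\|\mathscr S_a\|_{\mathcal H^p_a(\mathbb C_+)\to\mathcal H^p_a(\mathbb C_+)}=\int_0^\infty t^{-1/p}a(t)\,dt,$$ and every $f\in\mathcal H^p_a(\mathbb C_+)$ has a boundary value function $f^*\in L^p(\mathbb R)$, the integral $S_a(f^*)(x)$ converges absolutely for almost every $x\in\mathbb R$, and $\mathscr S_af$ has the boundary value function $$(\mathscr S_af)^*=S_a(f^*)\quad\text{almost everywhere on }\mathbb R.$$ -/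

import Mathlib

open Set Filter Topology MeasureTheory
open scoped ENNReal NNReal

namespace HardyHausdorff

noncomputable section

/-- The Hardy norm on the upper half-plane, with values in `[0, ∞]`:
`sup_{y > 0} (∫ |f (x + i y)| ^ p dx) ^ (1 / p)` for `p < ∞`, and `sup_{z ∈ ℂ₊} |f z|` for `p = ∞`.
Only the values of `f` on `ℂ₊` matter. -/
def hardyNorm (p : ℝ≥0∞) (f : ℂ → ℂ) : ℝ≥0∞ :=
  if p = ∞ then ⨆ z ∈ UpperHalfPlane.upperHalfPlaneSet, ‖f z‖ₑ
  else ⨆ (y : ℝ) (_ : 0 < y),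
    (∫⁻ x : ℝ, ‖f ((x : ℂ) + (y : ℂ) * Complex.I)‖ₑ ^ p.toReal) ^ (1 / p.toReal)

/-- Membership in the Hardy space of the upper half-plane. -/
def MemHardy (p : ℝ≥0∞) (f : ℂ → ℂ) : Prop :=
  DifferentiableOn ℂ f UpperHalfPlane.upperHalfPlaneSet ∧ hardyNorm p f < ∞

/-- The operator `F ↦ (z ↦ ∫_0^∞ F (t z) a(t) dt)` on functions on `ℂ₊`. -/
def complexS (a : ℝ → ℝ) (F : ℂ → ℂ) (z : ℂ) : ℂ :=
  ∫ t in Ioi (0 : ℝ), F ((t : ℂ) * z) * (a t : ℂ)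

/-- The operator `f ↦ (x ↦ ∫_0^∞ f (t x) a(t) dt)` on functions on `ℝ`. -/
def realS (a : ℝ → ℝ) (f : ℝ → ℂ) (x : ℝ) : ℂ :=
  ∫ t in Ioi (0 : ℝ), f (t * x) * (a t : ℂ)

/-- The operator `complexS a` is (well defined and) bounded on the Hardy space: for every `F` in the
space the defining Lebesgue integral exists at every point of `ℂ₊`, the resulting function belongs
to the space, and the norm inequality holds with a finite constant. -/
def IsBoundedOnHardy (p : ℝ≥0∞) (a : ℝ → ℝ) : Prop :=
  (∀ F : ℂ → ℂ, MemHardy p F →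
    (∀ z ∈ UpperHalfPlane.upperHalfPlaneSet, IntegrableOn (fun t : ℝ => F ((t : ℂ) * z) * (a t : ℂ)) (Ioi 0)) ∧
      MemHardy p (complexS a F)) ∧
  ∃ C : ℝ≥0, ∀ F : ℂ → ℂ, MemHardy p F → hardyNorm p (complexS a F) ≤ C * hardyNorm p F

/-- The operator norm of an operator on the Hardy space: the least constant in the norm
inequality. -/
def hardyOpNorm (p : ℝ≥0∞) (T : (ℂ → ℂ) → (ℂ → ℂ)) : ℝ≥0∞ :=
  sInf {C : ℝ≥0∞ | ∀ F : ℂ → ℂ, MemHardy p F → hardyNorm p (T F) ≤ C * hardyNorm p F}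

/-- `g` is (a representative of) the boundary value function `f^*` of `f`: it lies in `L^p(ℝ)` and
`g x = lim_{y → 0+} f (x + i y)` for almost every `x`. -/
def IsBoundaryValue (p : ℝ≥0∞) (f : ℂ → ℂ) (g : ℝ → ℂ) : Prop :=
  MemLp g p volume ∧
    ∀ᵐ x : ℝ, Tendsto (fun y : ℝ => f ((x : ℂ) + (y : ℂ) * Complex.I)) (𝓝[>] 0) (𝓝 (g x))

/-- The integral `∫_0^∞ t ^ (-1/p) a(t) dt` in `[0, ∞]` (with `1/∞ = 0`), for `a ≥ 0`. -/
def kernelIntegral (p : ℝ≥0∞) (a : ℝ → ℝ) : ℝ≥0∞ :=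
  ∫⁻ t in Ioi (0 : ℝ), ENNReal.ofReal (t ^ (-(p⁻¹).toReal) * a t)

end

end HardyHausdorff

namespace HardyHausdorff

/-! Write σ = 1/p and let ν be the measure t^(-σ) a(t) dt on (0, ∞), of total mass K. Then S_a F is
the ν-superposition of the dilates t^σ F(t·), and each of these has the same Hardy norm as F. If K
is finite, Jensen's inequality and Tonelli (for p = ∞, the triangle inequality) give norm at most K.

The bound K is sharp because some functions are almost fixed by every dilation. For p = ∞ the
constant 1 is fixed. For p < ∞ take F_s(z) = (z + i)^(-s) with s decreasing to 1/p. For fixed t the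
p-th power of the distance from F_s to its normalised dilate is a vanishing multiple of ‖F_s‖^p plus
a bounded term, while ‖F_s‖ tends to infinity. By dominated convergence in t, S_a F_s - K F_s is
negligible relative to F_s (`kernelIntegral_le_of_bound`).

That argument presupposes K finite. To derive finiteness from boundedness for p < ∞, restrict ν to
[1/N, N] and take s = (1 + d)/p. A rotation makes the integrand of S_a F_s have positive real part
over the first quadrant, so nothing cancels because a ≥ 0. The p-th powers of the norms of F_s and
of S_a F_s are both of order 1/d, d cancels, and ν([1/N, N]) is bounded independently of N
(`kernelMeasure_Icc_rpow_le`).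

Boundary values are built from L² theory. For p < ∞ the function |f|^(p/2) has the sub-mean value
property. A maximum principle for vertical shifts and weak compactness in L² give it a Poisson
majorant P[w] with w in L² (`MemHardy.exists_norm_rpow_le_poisson`). If Re H = P[w], then exp(-H)
and f exp(-H) are bounded. Bounded functions divided by z + i lie in H², hence are Poisson
integrals, and Fatou's theorem gives their vertical limits; f is the quotient. The majorant also
yields convergence to f^* in L^p (`MemHardy.tendsto_lintegral_line_sub`), which passes through the
superposition and identifies (S_a f)^* with S_a(f^*). For p = ∞ the identification is pointwise
dominated convergence. -/

/-- Cauchy's estimate on an open disc. -/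
theorem norm_deriv_le_of_forall_mem_ball {f : ℂ → ℂ} {z : ℂ} {r C : ℝ} (hr : 0 < r)
    (hf : DifferentiableOn ℂ f (Metric.ball z r)) (hC : ∀ w ∈ Metric.ball z r, ‖f w‖ ≤ C) :
    ‖deriv f z‖ ≤ C / r := by
  have key : ∀ s ∈ Ioo 0 r, ‖deriv f z‖ ≤ C / s := fun s hs => by
    refine Complex.norm_deriv_le_of_forall_mem_sphere_norm_le hs.1 ?_ ?_
    · exact (hf.mono (Metric.closure_ball_subset_closedBall.trans
        (Metric.closedBall_subset_ball hs.2))).diffContOnCl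
    · exact fun w hw => hC w (Metric.closedBall_subset_ball hs.2
        (Metric.sphere_subset_closedBall hw))
  have hlim : Tendsto (fun s : ℝ => C / s) (𝓝[<] r) (𝓝 (C / r)) :=
    (tendsto_const_nhds.div tendsto_id hr.ne').mono_left nhdsWithin_le_nhds
  exact ge_of_tendsto hlim (eventually_of_mem (Ioo_mem_nhdsLT hr) key)

/-! ### Holomorphic integrals depending on a parameter -/

/-- An integral of holomorphic functions with a locally uniform integrable bound is holomorphic. -/
theorem differentiableOn_integral_of_dominated {α : Type*} [MeasurableSpace α] {μ : Measure α}
    {f : ℂ → α → ℂ} {U : Set ℂ}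
    (hmeas : ∀ z ∈ U, AEStronglyMeasurable (f z) μ)
    (hd : ∀ᵐ a ∂μ, DifferentiableOn ℂ (fun z => f z a) U)
    (hb : ∀ z ∈ U, ∃ r > 0, ∃ bound : α → ℝ, Metric.ball z r ⊆ U ∧ Integrable bound μ ∧
      ∀ᵐ a ∂μ, ∀ w ∈ Metric.ball z r, ‖f w a‖ ≤ bound a) :
    DifferentiableOn ℂ (fun z => ∫ a, f z a ∂μ) U := by
  intro z hz
  obtain ⟨r, hr, bound, hrU, hbi, hbd⟩ := hb z hz
  have hzr : z ∈ Metric.ball z r := Metric.mem_ball_self hr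
  have hUz : U ∈ 𝓝 z := mem_of_superset (Metric.ball_mem_nhds z hr) hrU
  have hder : ∀ᵐ a ∂μ, HasDerivAt (fun w => f w a) (deriv (fun w => f w a) z) z := by
    filter_upwards [hd] with a ha
    exact (ha.differentiableAt hUz).hasDerivAt
  refine (hasDerivAt_integral_of_dominated_loc_of_lip (F := f)
    (F' := fun a => deriv (fun w => f w a) z) (bound := fun a => bound a / (r / 2))
    (Metric.ball_mem_nhds z (half_pos hr)) ?_ ?_ ?_ ?_ ?_ hder).2.differentiableAt.differentiableWithinAt
  · filter_upwards [hUz] with w hw using hmeas w hw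
  · exact hbi.mono' (hmeas z hz) (hbd.mono fun a ha => ha z hzr)
  -- Measurability of the derivative in the parameter: it is an a.e. limit of difference quotients
  -- along the sequence δ.
  · set δ : ℕ → ℂ := fun n => ((r / 2 / (n + 1) : ℝ) : ℂ) with hδ
    have hδpos : ∀ n : ℕ, 0 < r / 2 / ((n : ℝ) + 1) := fun n => by positivity
    have hδ0 : ∀ n, δ n ≠ 0 := fun n => by
      simp only [hδ]; exact_mod_cast (hδpos n).ne'
    have hδlim : Tendsto δ atTop (𝓝 0) := by
      have h1 : Tendsto (fun n : ℕ => r / 2 / ((n : ℝ) + 1)) atTop (𝓝 0) := by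
        simpa [div_eq_mul_inv] using
          (tendsto_one_div_add_atTop_nhds_zero_nat (𝕜 := ℝ)).const_mul (r / 2)
      simpa only [Complex.ofReal_zero] using! (Complex.continuous_ofReal.tendsto 0).comp h1
    have hmem : ∀ n, z + δ n ∈ U := fun n => by
      apply hrU
      rw [Metric.mem_ball, dist_eq_norm, add_sub_cancel_left]
      simp only [hδ, Complex.norm_real, Real.norm_eq_abs, abs_of_pos (hδpos n)]
      have h1 : (1 : ℝ) ≤ n + 1 := by linarith [Nat.cast_nonneg (α := ℝ) n]
      calc r / 2 / (n + 1) ≤ r / 2 := div_le_self (by positivity) h1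
        _ < r := by linarith
    refine aestronglyMeasurable_of_tendsto_ae (u := atTop)
      (f := fun n a => (δ n)⁻¹ * (f (z + δ n) a - f z a))
      (fun n => ((hmeas _ (hmem n)).sub (hmeas z hz)).const_mul _) ?_
    filter_upwards [hder] with a ha
    have h2 := ha.tendsto_slope_zero
    have h3 : Tendsto δ atTop (𝓝[≠] 0) :=
      tendsto_nhdsWithin_iff.2 ⟨hδlim, Eventually.of_forall hδ0⟩
    simpa using! h2.comp h3
  -- Around each point of the half-radius ball there is still a disc of radius r / 2 on which the
  -- bound holds, so Cauchy's estimate gives the Lipschitz constant.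
  · filter_upwards [hd, hbd] with a ha hb'
    have hnn : 0 ≤ bound a := (norm_nonneg _).trans (hb' z hzr)
    refine LipschitzOnWith.of_dist_le_mul fun x hx y hy => ?_
    have key : ∀ w ∈ Metric.ball z (r / 2), ‖deriv (fun w => f w a) w‖ ≤ bound a / (r / 2) := by
      intro w hw
      have hsub : Metric.ball w (r / 2) ⊆ Metric.ball z r := by
        refine Metric.ball_subset_ball' ?_
        have := Metric.mem_ball.1 hw; linarith
      refine norm_deriv_le_of_forall_mem_ball (half_pos hr) (ha.mono (hsub.trans hrU)) ?_
      intro v hv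
      exact hb' v (hsub hv)
    have h4 := (convex_ball z (r / 2)).norm_image_sub_le_of_norm_deriv_le
      (f := fun w => f w a) (C := bound a / (r / 2)) (fun w hw => ?_) key hy hx
    · rw [Real.coe_nnabs, abs_of_nonneg (by positivity), dist_eq_norm, dist_eq_norm]
      exact h4
    · refine ha.differentiableAt (mem_of_superset (Metric.isOpen_ball.mem_nhds hw) ?_)
      exact (Metric.ball_subset_ball (by linarith)).trans hrU
  · exact hbi.div_const _

/-! ### The mean value property over discs -/

/-- Mean value property on a circle, with angles in (-π, π) to match the range of polar coordinates
in the disc version. -/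
theorem enorm_mul_two_pi_le_lintegral {F : ℂ → ℂ} {z : ℂ} {r : ℝ} (hr : 0 < r)
    (hF : DifferentiableOn ℂ F (Metric.closedBall z r)) :
    ‖F z‖ₑ * ENNReal.ofReal (2 * Real.pi) ≤
      ∫⁻ θ in Ioo (-Real.pi) Real.pi, ‖F (z + r * (Real.cos θ + Real.sin θ * Complex.I))‖ₑ := by
  have h1 : Real.circleAverage F z r = F z := by
    apply DiffContOnCl.circleAverage
    rw [abs_of_pos hr]
    exact (hF.mono (Metric.closure_ball_subset_closedBall)).diffContOnCl
  rw [Real.circleAverage_eq_integral_add (-Real.pi),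
    intervalIntegral.integral_comp_add_right (fun θ => F (circleMap z r θ))] at h1
  have h2 : ((2 * Real.pi : ℝ)) • F z =
      ∫ θ in Ioo (-Real.pi) Real.pi, F (z + r * (Real.cos θ + Real.sin θ * Complex.I)) := by
    rw [← h1, smul_smul, mul_inv_cancel₀ (by positivity), one_smul, zero_add,
      show 2 * Real.pi + -Real.pi = Real.pi by ring,
      intervalIntegral.integral_of_le (by linarith [Real.pi_pos]), integral_Ioc_eq_integral_Ioo]
    simp [circleMap, Complex.exp_mul_I]
  calc ‖F z‖ₑ * ENNReal.ofReal (2 * Real.pi) = ‖((2 * Real.pi : ℝ)) • F z‖ₑ := by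
        rw [enorm_smul, mul_comm, ← Real.enorm_of_nonneg (by positivity)]
    _ ≤ _ := by rw [h2]; exact enorm_integral_le_lintegral_enorm _

/-- Integrate the circle inequality against r dr over (0, ρ). Only the open disc is needed, which
later allows discs tangent to the real line. -/
theorem enorm_mul_le_lintegral_ball {F : ℂ → ℂ} {z : ℂ} {ρ : ℝ} (hρ : 0 < ρ)
    (hF : DifferentiableOn ℂ F (Metric.ball z ρ)) :
    ‖F z‖ₑ * ENNReal.ofReal (Real.pi * ρ ^ 2) ≤ ∫⁻ w in Metric.ball z ρ, ‖F w‖ₑ := by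
  classical
  set φ : ℂ → ℝ≥0∞ := (Metric.ball 0 ρ).indicator fun w => ‖F (z + w)‖ₑ with hφ
  have hcont : ContinuousOn (fun w => ‖F (z + w)‖ₑ) (Metric.ball 0 ρ) := by
    refine continuous_enorm.comp_continuousOn (hF.continuousOn.comp (by fun_prop) ?_)
    intro w hw
    simpa [Metric.mem_ball, dist_eq_norm] using hw
  have hφm : Measurable φ := by
    rw [hφ, ← Set.piecewise_eq_indicator]
    exact hcont.measurable_piecewise continuousOn_const Metric.isOpen_ball.measurableSet
  have h1 : ∫⁻ w in Metric.ball z ρ, ‖F w‖ₑ = ∫⁻ w, φ w := by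
    rw [← lintegral_indicator Metric.isOpen_ball.measurableSet,
      ← lintegral_add_left_eq_self _ z]
    refine lintegral_congr fun w => ?_
    simp only [hφ, indicator, Metric.mem_ball, dist_eq_norm, add_sub_cancel_left, sub_zero]
  have hint : ∫⁻ r in Ioo (0 : ℝ) ρ, ENNReal.ofReal r = ENNReal.ofReal (ρ ^ 2 / 2) := by
    rw [← ofReal_integral_eq_lintegral_ofReal, ← integral_Ioc_eq_integral_Ioo,
      ← intervalIntegral.integral_of_le hρ.le, integral_id]
    · simp
    · exact (continuous_id.integrableOn_Icc (a := 0) (b := ρ)).mono_set Ioo_subset_Icc_self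
    · filter_upwards [ae_restrict_mem measurableSet_Ioo] with x hx using hx.1.le
  rw [h1, ← Complex.lintegral_comp_polarCoord_symm, polarCoord_target, Measure.volume_eq_prod,
    ← Measure.prod_restrict, lintegral_prod _ (Measurable.aemeasurable ?_)]
  · calc ‖F z‖ₑ * ENNReal.ofReal (Real.pi * ρ ^ 2)
        = ∫⁻ r in Ioo (0 : ℝ) ρ, ENNReal.ofReal r * (‖F z‖ₑ * ENNReal.ofReal (2 * Real.pi)) := by
          rw [lintegral_mul_const _ ENNReal.measurable_ofReal, hint, mul_left_comm,
            ← ENNReal.ofReal_mul (by positivity)]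
          congr 2; ring
      _ ≤ ∫⁻ r in Ioo (0 : ℝ) ρ, ∫⁻ θ in Ioo (-Real.pi) Real.pi,
            ENNReal.ofReal r • φ (Complex.polarCoord.symm (r, θ)) := by
          refine setLIntegral_mono' measurableSet_Ioo fun r hr => ?_
          simp only [smul_eq_mul]
          rw [lintegral_const_mul]
          · gcongr
            refine (enorm_mul_two_pi_le_lintegral hr.1 (hF.mono
              (Metric.closedBall_subset_ball hr.2))).trans (le_of_eq ?_)
            refine lintegral_congr fun θ => ?_
            have hmem : Complex.polarCoord.symm (r, θ) ∈ Metric.ball (0 : ℂ) ρ := by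
              rw [Metric.mem_ball, dist_zero_right, Complex.norm_polarCoord_symm, abs_of_pos hr.1]
              exact hr.2
            rw [hφ, indicator_of_mem hmem, Complex.polarCoord_symm_apply]
          · refine hφm.comp ?_
            simp only [Complex.polarCoord_symm_apply]
            fun_prop
      _ ≤ _ := lintegral_mono_set Ioo_subset_Ioi_self
  · refine Measurable.smul (ENNReal.measurable_ofReal.comp measurable_fst) (hφm.comp ?_)
    rw [show (Complex.polarCoord.symm : ℝ × ℝ → ℂ) =
      fun p => p.1 * (Real.cos p.2 + Real.sin p.2 * Complex.I) from
        funext Complex.polarCoord_symm_apply]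
    fun_prop

/-! ### Horizontal lines and the Hardy norm -/

/-- The restriction of a function to the horizontal line at height `y`. -/
def line (f : ℂ → ℂ) (y : ℝ) (x : ℝ) : ℂ := f ((x : ℂ) + (y : ℂ) * Complex.I)

theorem add_mul_I_im (x y : ℝ) : ((x : ℂ) + (y : ℂ) * Complex.I).im = y := by simp

theorem add_mul_I_re (x y : ℝ) : ((x : ℂ) + (y : ℂ) * Complex.I).re = x := by simp

theorem mem_upperHalfPlaneSet {z : ℂ} : z ∈ UpperHalfPlane.upperHalfPlaneSet ↔ 0 < z.im := Iff.rfl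

theorem hardyNorm_top (f : ℂ → ℂ) :
    hardyNorm ∞ f = ⨆ z ∈ UpperHalfPlane.upperHalfPlaneSet, ‖f z‖ₑ := if_pos rfl

theorem hardyNorm_eq_iSup_eLpNorm {p : ℝ≥0∞} (hp0 : p ≠ 0) (hp : p ≠ ∞) (f : ℂ → ℂ) :
    hardyNorm p f = ⨆ (y : ℝ) (_ : 0 < y), eLpNorm (line f y) p volume := by
  rw [hardyNorm, if_neg hp]
  simp_rw [eLpNorm_eq_lintegral_rpow_enorm_toReal hp0 hp]
  rfl

theorem enorm_le_hardyNorm_top {f : ℂ → ℂ} {z : ℂ} (hz : 0 < z.im) : ‖f z‖ₑ ≤ hardyNorm ∞ f := by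
  rw [hardyNorm_top]
  exact le_iSup₂ (f := fun z (_ : z ∈ UpperHalfPlane.upperHalfPlaneSet) => ‖f z‖ₑ) z hz

theorem eLpNorm_line_le_hardyNorm {p : ℝ≥0∞} (hp0 : p ≠ 0) (f : ℂ → ℂ) {y : ℝ} (hy : 0 < y) :
    eLpNorm (line f y) p volume ≤ hardyNorm p f := by
  by_cases hp : p = ∞
  · subst hp
    rw [eLpNorm_exponent_top]
    refine essSup_le_of_ae_le _ (Eventually.of_forall fun x => enorm_le_hardyNorm_top ?_)
    rwa [add_mul_I_im]
  · rw [hardyNorm_eq_iSup_eLpNorm hp0 hp]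
    exact le_iSup₂ (f := fun y (_ : 0 < y) => eLpNorm (line f y) p volume) y hy

theorem hardyNorm_le {p : ℝ≥0∞} (hp0 : p ≠ 0) (hp : p ≠ ∞) {f : ℂ → ℂ} {C : ℝ≥0∞}
    (h : ∀ y : ℝ, 0 < y → eLpNorm (line f y) p volume ≤ C) : hardyNorm p f ≤ C := by
  rw [hardyNorm_eq_iSup_eLpNorm hp0 hp]
  exact iSup₂_le h

theorem hardyNorm_top_le {f : ℂ → ℂ} {C : ℝ≥0∞} (h : ∀ z : ℂ, 0 < z.im → ‖f z‖ₑ ≤ C) :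
    hardyNorm ∞ f ≤ C := by
  rw [hardyNorm_top]
  exact iSup₂_le h

theorem continuous_line {f : ℂ → ℂ} (hf : DifferentiableOn ℂ f UpperHalfPlane.upperHalfPlaneSet)
    {y : ℝ} (hy : 0 < y) : Continuous (line f y) :=
  hf.continuousOn.comp_continuous (by fun_prop) fun x => by
    rw [mem_upperHalfPlaneSet, add_mul_I_im]; exact hy

theorem lintegral_line_rpow_le {p : ℝ≥0∞} (hp0 : p ≠ 0) (hp : p ≠ ∞) (f : ℂ → ℂ) {y : ℝ}
    (hy : 0 < y) : ∫⁻ x, ‖line f y x‖ₑ ^ p.toReal ≤ hardyNorm p f ^ p.toReal := by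
  have hpos := ENNReal.toReal_pos hp0 hp
  have h := eLpNorm_line_le_hardyNorm hp0 f hy
  rw [eLpNorm_eq_lintegral_rpow_enorm_toReal hp0 hp] at h
  have := ENNReal.rpow_le_rpow h hpos.le
  rwa [← ENNReal.rpow_mul, one_div, inv_mul_cancel₀ hpos.ne', ENNReal.rpow_one] at this

/-- The disc lies in a horizontal strip of height 2ρ inside the half-plane; by Tonelli each line of
the strip contributes at most the p-th power of the Hardy norm. -/
theorem lintegral_ball_rpow_le {p : ℝ≥0∞} (hp0 : p ≠ 0) (hp : p ≠ ∞) {f : ℂ → ℂ}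
    (hf : DifferentiableOn ℂ f UpperHalfPlane.upperHalfPlaneSet) {z : ℂ} {ρ : ℝ}
    (hz : ρ ≤ z.im) :
    ∫⁻ w in Metric.ball z ρ, ‖f w‖ₑ ^ p.toReal ≤
      ENNReal.ofReal (2 * ρ) * hardyNorm p f ^ p.toReal := by
  classical
  have hsub : Metric.ball z ρ ⊆ {w : ℂ | w.im ∈ Ioo (z.im - ρ) (z.im + ρ)} := fun w hw => by
    have h1 : |(w - z).im| < ρ :=
      (Complex.abs_im_le_norm _).trans_lt (by simpa [dist_eq_norm] using hw)
    rw [Complex.sub_im, abs_lt] at h1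
    exact ⟨by linarith, by linarith⟩
  have hms : MeasurableSet {w : ℂ | w.im ∈ Ioo (z.im - ρ) (z.im + ρ)} :=
    Complex.measurable_im measurableSet_Ioo
  set φ : ℂ → ℝ≥0∞ := {w : ℂ | w.im ∈ Ioo (z.im - ρ) (z.im + ρ)}.indicator
    fun w => ‖f w‖ₑ ^ p.toReal with hφ
  have hφm : Measurable φ := by
    rw [hφ, ← Set.piecewise_eq_indicator]
    refine ContinuousOn.measurable_piecewise ?_ continuousOn_const hms
    refine ENNReal.continuous_rpow_const.comp_continuousOn
      (continuous_enorm.comp_continuousOn (hf.continuousOn.mono fun w hw => ?_))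
    have h2 : z.im - ρ < w.im := hw.1
    exact mem_upperHalfPlaneSet.2 (by linarith)
  calc ∫⁻ w in Metric.ball z ρ, ‖f w‖ₑ ^ p.toReal ≤ ∫⁻ w, φ w := by
        rw [hφ, lintegral_indicator hms]; exact lintegral_mono_set hsub
    _ = ∫⁻ q : ℝ × ℝ, φ (Complex.measurableEquivRealProd.symm q) :=
        ((Complex.volume_preserving_equiv_real_prod.symm).lintegral_comp hφm).symm
    _ = ∫⁻ y : ℝ, ∫⁻ x : ℝ, φ (Complex.measurableEquivRealProd.symm (x, y)) := by
        rw [Measure.volume_eq_prod, lintegral_prod_symm]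
        exact (hφm.comp (MeasurableEquiv.measurable _)).aemeasurable
    _ ≤ ∫⁻ y : ℝ, (Ioo (z.im - ρ) (z.im + ρ)).indicator (fun _ => hardyNorm p f ^ p.toReal) y := by
        refine lintegral_mono fun y => ?_
        by_cases hy : y ∈ Ioo (z.im - ρ) (z.im + ρ)
        · rw [indicator_of_mem hy]
          refine le_trans (lintegral_mono fun x => ?_)
            (lintegral_line_rpow_le hp0 hp f (y := y) (by linarith [hy.1]))
          refine (indicator_le_self' (fun _ _ => zero_le) _).trans (le_of_eq ?_)
          rw [line, Complex.measurableEquivRealProd_symm_apply, Complex.mk_eq_add_mul_I]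
        · rw [indicator_of_notMem hy]
          refine le_of_eq (lintegral_eq_zero_of_ae_eq_zero (Eventually.of_forall fun x => ?_))
          exact indicator_of_notMem (by simpa using hy) _
    _ = ENNReal.ofReal (2 * ρ) * hardyNorm p f ^ p.toReal := by
        rw [lintegral_indicator measurableSet_Ioo, setLIntegral_const, Real.volume_Ioo, mul_comm]
        congr 2; ring

/-- Functions in the Hardy space grow at most like `(Im z) ^ (-1/p)` at the real line. -/
theorem MemHardy.exists_norm_le {p : ℝ≥0∞} (hp1 : 1 ≤ p) {f : ℂ → ℂ} (hf : MemHardy p f) :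
    ∃ C : ℝ, 0 ≤ C ∧ ∀ z : ℂ, 0 < z.im → ‖f z‖ ≤ C * z.im ^ (-(p⁻¹).toReal) := by
  by_cases hp : p = ∞
  · subst hp
    refine ⟨(hardyNorm ∞ f).toReal, ENNReal.toReal_nonneg, fun z hz => ?_⟩
    have := ENNReal.toReal_mono hf.2.ne (enorm_le_hardyNorm_top (f := f) hz)
    simpa using this
  have hp0 : p ≠ 0 := (zero_lt_one.trans_le hp1).ne'
  have hpos := ENNReal.toReal_pos hp0 hp
  set N : ℝ := (hardyNorm p f).toReal with hN
  have hN0 : 0 ≤ N := ENNReal.toReal_nonneg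
  have hNe : hardyNorm p f = ENNReal.ofReal N := (ENNReal.ofReal_toReal hf.2.ne).symm
  set s : ℝ := (p⁻¹).toReal with hs
  have hs' : s = 1 / p.toReal := by rw [hs, ENNReal.toReal_inv, one_div]
  refine ⟨N * (2 / Real.pi) ^ s, by positivity, fun z hz => ?_⟩
  have h1 := enorm_mul_le_lintegral_ball (F := f) (z := z) hz (hf.1.mono fun w hw => by
    have h1 : |(w - z).im| < z.im :=
      (Complex.abs_im_le_norm _).trans_lt (by simpa [dist_eq_norm] using hw)
    rw [Complex.sub_im, abs_lt] at h1
    exact mem_upperHalfPlaneSet.2 (by linarith))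
  have hcont : ContinuousOn f (Metric.ball z z.im) := (hf.1.mono fun w hw => by
    have h1 : |(w - z).im| < z.im :=
      (Complex.abs_im_le_norm _).trans_lt (by simpa [dist_eq_norm] using hw)
    rw [Complex.sub_im, abs_lt] at h1
    exact mem_upperHalfPlaneSet.2 (by linarith)).continuousOn
  -- Hölder on the disc of radius Im z passes from the area mean of |f| to that of |f|^p, which the
  -- strip estimate controls.
  have h2 := eLpNorm_le_eLpNorm_mul_rpow_measure_univ hp1
    (hcont.aestronglyMeasurable (μ := volume) Metric.isOpen_ball.measurableSet)
  rw [eLpNorm_one_eq_lintegral_enorm, eLpNorm_eq_lintegral_rpow_enorm_toReal hp0 hp,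
    Measure.restrict_apply_univ] at h2
  have hvol : volume (Metric.ball z z.im) = ENNReal.ofReal (Real.pi * z.im ^ 2) := by
    rw [Complex.volume_ball, ENNReal.ofReal_mul Real.pi_pos.le, ENNReal.ofReal_pow hz.le, mul_comm]
    congr 1
    exact (ENNReal.ofReal_coe_nnreal (p := NNReal.pi)).symm
  have hA : 0 < Real.pi * z.im ^ 2 := by positivity
  have h3 := h1.trans (h2.trans (mul_le_mul' (ENNReal.rpow_le_rpow
    (lintegral_ball_rpow_le hp0 hp hf.1 le_rfl) (by positivity)) le_rfl))
  rw [hvol, hNe, ENNReal.ofReal_rpow_of_nonneg hN0 hpos.le, ← ENNReal.ofReal_mul (by positivity),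
    ENNReal.ofReal_rpow_of_nonneg (by positivity) (by positivity),
    ENNReal.ofReal_rpow_of_pos hA, ← ENNReal.ofReal_mul (by positivity), ← ofReal_norm,
    ← ENNReal.ofReal_mul (norm_nonneg _), ENNReal.ofReal_le_ofReal_iff (by positivity)] at h3
  have h4 : (2 * z.im * N ^ p.toReal) ^ (1 / p.toReal) = (2 * z.im) ^ s * N := by
    rw [Real.mul_rpow (by positivity) (by positivity), ← Real.rpow_mul hN0,
      mul_one_div_cancel hpos.ne', Real.rpow_one, hs']
  have h5 : (Real.pi * z.im ^ 2) ^ (1 / (1 : ℝ≥0∞).toReal - 1 / p.toReal) =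
      (Real.pi * z.im ^ 2) * (Real.pi * z.im ^ 2) ^ (-s) := by
    rw [ENNReal.toReal_one, div_one, ← hs', sub_eq_add_neg, Real.rpow_add hA, Real.rpow_one]
  rw [h4, h5] at h3
  have h6 : ‖f z‖ ≤ (2 * z.im) ^ s * N * (Real.pi * z.im ^ 2) ^ (-s) := by
    refine le_of_mul_le_mul_right (h3.trans (le_of_eq ?_)) hA
    ring
  refine h6.trans (le_of_eq ?_)
  have h7 : (2 * z.im) ^ s * (Real.pi * z.im ^ 2) ^ (-s) = (2 / Real.pi) ^ s * z.im ^ (-s) := by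
    rw [Real.rpow_neg hA.le, Real.rpow_neg hz.le, ← Real.inv_rpow hA.le, ← Real.inv_rpow hz.le,
      ← Real.mul_rpow (by positivity) (by positivity),
      ← Real.mul_rpow (by positivity) (by positivity)]
    congr 1; field_simp
  rw [mul_right_comm, h7]; ring

/-! ### Jensen's inequality for superpositions -/

/-- Hölder against the constant 1, that is, Jensen's inequality without normalising ν. -/
theorem lintegral_rpow_le_of_isFinite {α : Type*} [MeasurableSpace α] {ν : Measure α}
    {φ : α → ℝ≥0∞} (hφ : AEMeasurable φ ν) {p : ℝ} (hp : 1 ≤ p) :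
    (∫⁻ t, φ t ∂ν) ^ p ≤ ν univ ^ (p - 1) * ∫⁻ t, φ t ^ p ∂ν := by
  have hp0 : 0 < p := by linarith
  have h := eLpNorm_le_eLpNorm_mul_rpow_measure_univ (p := 1) (q := ENNReal.ofReal p)
    (by simpa using hp) hφ.aestronglyMeasurable
  rw [eLpNorm_one_eq_lintegral_enorm, eLpNorm_eq_lintegral_rpow_enorm_toReal
    (by simpa using hp0) ENNReal.ofReal_ne_top, ENNReal.toReal_ofReal hp0.le] at h
  simp only [enorm_eq_self, ENNReal.toReal_one, div_one] at h
  refine (ENNReal.rpow_le_rpow h hp0.le).trans (le_of_eq ?_)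
  rw [ENNReal.mul_rpow_of_nonneg _ _ hp0.le, ← ENNReal.rpow_mul, ← ENNReal.rpow_mul, mul_comm]
  congr 2
  · field_simp
  · rw [one_div, inv_mul_cancel₀ hp0.ne', ENNReal.rpow_one]

/-- Jensen for each x, then Tonelli. It serves both Poisson averages of translates and averages of
dilates. -/
theorem lintegral_lintegral_rpow_le {α : Type*} [MeasurableSpace α] {ν : Measure α}
    [IsFiniteMeasure ν] {Φ : ℝ → α → ℝ≥0∞}
    (hΦ : AEMeasurable (Function.uncurry Φ) ((volume : Measure ℝ).prod ν)) {p : ℝ} (hp : 1 ≤ p) :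
    ∫⁻ x, (∫⁻ t, Φ x t ∂ν) ^ p ≤ ν univ ^ (p - 1) * ∫⁻ t, (∫⁻ x, Φ x t ^ p) ∂ν := by
  have hfin : ν univ ^ (p - 1) ≠ ∞ :=
    ENNReal.rpow_ne_top_of_nonneg (by linarith) (measure_ne_top ν univ)
  have hae : ∀ᵐ x : ℝ, AEMeasurable (Φ x) ν := by
    have := hΦ.aestronglyMeasurable.prodMk_left
    filter_upwards [this] with x hx using hx.aemeasurable
  calc ∫⁻ x, (∫⁻ t, Φ x t ∂ν) ^ p ≤ ∫⁻ x, ν univ ^ (p - 1) * ∫⁻ t, Φ x t ^ p ∂ν :=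
        lintegral_mono_ae (hae.mono fun x hx => lintegral_rpow_le_of_isFinite hx hp)
    _ = ν univ ^ (p - 1) * ∫⁻ x, ∫⁻ t, Φ x t ^ p ∂ν := lintegral_const_mul' _ _ hfin
    _ = _ := by rw [lintegral_lintegral_swap (hΦ.pow_const p)]

/-! ### The Poisson kernel of the half-plane -/

/-- The Poisson kernel of the upper half-plane. -/
noncomputable def pkernel (z : ℂ) (s : ℝ) : ℝ :=
  Real.pi⁻¹ * (z.im / ((s - z.re) ^ 2 + z.im ^ 2))

/-- The Poisson extension to the upper half-plane of a function on the real line. -/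
noncomputable def poisson {E : Type*} [NormedAddCommGroup E] [NormedSpace ℝ E] (h : ℝ → E)
    (z : ℂ) : E := ∫ s, pkernel z s • h s

/-- The standard Cauchy distribution. -/
noncomputable def cauchyDist : Measure ℝ :=
  volume.withDensity fun s => ENNReal.ofReal (Real.pi⁻¹ * (1 + s ^ 2)⁻¹)

/-- The holomorphic completion of the Poisson extension. -/
noncomputable def schwarz (h : ℝ → ℂ) (z : ℂ) : ℂ :=
  (Real.pi * Complex.I)⁻¹ * ∫ s : ℝ, h s * ((s : ℂ) - z)⁻¹

theorem measurable_cauchyDensity :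
    Measurable fun s : ℝ => ENNReal.ofReal (Real.pi⁻¹ * (1 + s ^ 2)⁻¹) := by fun_prop

instance : IsProbabilityMeasure cauchyDist := by
  constructor
  rw [cauchyDist, withDensity_apply _ MeasurableSet.univ, Measure.restrict_univ,
    ← ofReal_integral_eq_lintegral_ofReal (integrable_inv_one_add_sq.const_mul _)
      (Eventually.of_forall fun s => by positivity), integral_const_mul,
    integral_univ_inv_one_add_sq, inv_mul_cancel₀ Real.pi_ne_zero, ENNReal.ofReal_one]

section
variable {E : Type*} [NormedAddCommGroup E] [NormedSpace ℝ E]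

theorem integral_cauchyDist (g : ℝ → E) :
    ∫ u, g u ∂cauchyDist = ∫ u, (Real.pi⁻¹ * (1 + u ^ 2)⁻¹) • g u := by
  rw [cauchyDist, integral_withDensity_eq_integral_toReal_smul measurable_cauchyDensity
    (Eventually.of_forall fun _ => ENNReal.ofReal_lt_top)]
  refine integral_congr_ae (Eventually.of_forall fun u => ?_)
  simp only
  rw [ENNReal.toReal_ofReal (by positivity)]

/-- The substitution s = x + y u turns the varying kernel into one fixed probability measure, so the
Poisson extension becomes an average of translates of h. -/
theorem poisson_eq_integral_cauchyDist (h : ℝ → E) (x : ℝ) {y : ℝ} (hy : 0 < y) :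
    poisson h ((x : ℂ) + (y : ℂ) * Complex.I) = ∫ u, h (x + y * u) ∂cauchyDist := by
  rw [integral_cauchyDist, poisson]
  simp only [pkernel, add_mul_I_im, add_mul_I_re]
  rw [← integral_add_left_eq_self _ x]
  have := Measure.integral_comp_mul_left
    (fun s : ℝ => (Real.pi⁻¹ * (y / ((x + s - x) ^ 2 + y ^ 2))) • h (x + s)) y
  rw [abs_of_pos (inv_pos.2 hy), eq_inv_smul_iff₀ hy.ne'] at this
  rw [← this, ← integral_smul]
  refine integral_congr_ae (Eventually.of_forall fun u => ?_)
  simp only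
  rw [smul_smul]
  congr 1
  field_simp
  ring

end

/-! ### Square integrability of the Cauchy and Poisson kernels, and the analytic completion. -/

theorem normSq_ofReal_sub (z : ℂ) (s : ℝ) : ‖(s : ℂ) - z‖ ^ 2 = (s - z.re) ^ 2 + z.im ^ 2 := by
  rw [← Complex.normSq_eq_norm_sq, Complex.normSq_apply]
  simp; ring

theorem im_le_norm_ofReal_sub (z : ℂ) (s : ℝ) : z.im ≤ ‖(s : ℂ) - z‖ := by
  have := Complex.abs_im_le_norm ((s : ℂ) - z)
  rw [Complex.sub_im, Complex.ofReal_im, zero_sub, abs_neg] at this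
  exact (le_abs_self _).trans this

theorem ofReal_sub_ne_zero {z : ℂ} (hz : 0 < z.im) (s : ℝ) : (s : ℂ) - z ≠ 0 :=
  norm_pos_iff.1 (hz.trans_le (im_le_norm_ofReal_sub z s))

theorem integrable_inv_sq_add_sq (x : ℝ) {y : ℝ} (hy : 0 < y) :
    Integrable fun s : ℝ => ((s - x) ^ 2 + y ^ 2)⁻¹ := by
  have h1 : Integrable fun u : ℝ => (y ^ 2)⁻¹ * (1 + (y⁻¹ * u) ^ 2)⁻¹ :=
    (integrable_inv_one_add_sq.comp_mul_left' (inv_ne_zero hy.ne')).const_mul _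
  have h2 := h1.comp_sub_right x
  refine h2.congr (Eventually.of_forall fun s => ?_)
  simp only
  field_simp
  ring

theorem memLp_two_inv_ofReal_sub {z : ℂ} (hz : 0 < z.im) :
    MemLp (fun s : ℝ => ((s : ℂ) - z)⁻¹) 2 := by
  have hc : Continuous fun s : ℝ => ((s : ℂ) - z)⁻¹ :=
    Continuous.inv₀ (by fun_prop) (ofReal_sub_ne_zero hz)
  rw [memLp_two_iff_integrable_sq_norm hc.aestronglyMeasurable]
  refine (integrable_inv_sq_add_sq z.re hz).congr (Eventually.of_forall fun s => ?_)
  simp only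
  rw [norm_inv, inv_pow, normSq_ofReal_sub]

/-- This makes Poisson integrals of L² functions converge absolutely and lets the kernel be a test
function for weak L² limits. -/
theorem memLp_two_pkernel {z : ℂ} (hz : 0 < z.im) : MemLp (pkernel z) 2 := by
  have h1 : MemLp (fun s : ℝ => ‖((s : ℂ) - z)⁻¹‖ ) 2 := (memLp_two_inv_ofReal_sub hz).norm
  refine (h1.const_mul Real.pi⁻¹).mono' ?_ (Eventually.of_forall fun s => ?_)
  · refine Continuous.aestronglyMeasurable ?_
    refine continuous_const.mul (continuous_const.div (by fun_prop) fun s => ?_)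
    positivity
  · have hn : 0 < ‖(s : ℂ) - z‖ := norm_pos_iff.2 (ofReal_sub_ne_zero hz s)
    rw [pkernel, ← normSq_ofReal_sub, Real.norm_of_nonneg (by positivity), norm_inv]
    gcongr
    rw [div_le_iff₀ (by positivity), sq, ← mul_assoc, inv_mul_cancel₀ hn.ne', one_mul]
    exact im_le_norm_ofReal_sub z s

theorem integrable_mul_inv_ofReal_sub {h : ℝ → ℂ} (hh : MemLp h 2) {z : ℂ} (hz : 0 < z.im) :
    Integrable fun s : ℝ => h s * ((s : ℂ) - z)⁻¹ :=
  hh.integrable_mul (memLp_two_inv_ofReal_sub hz)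

theorem differentiableOn_schwarz {h : ℝ → ℂ} (hh : MemLp h 2) :
    DifferentiableOn ℂ (schwarz h) UpperHalfPlane.upperHalfPlaneSet := by
  refine DifferentiableOn.const_mul (differentiableOn_integral_of_dominated
    (f := fun z (s : ℝ) => h s * ((s : ℂ) - z)⁻¹) ?_ ?_ ?_) _
  · exact fun z hz => (integrable_mul_inv_ofReal_sub hh hz).aestronglyMeasurable
  · refine Eventually.of_forall fun s z hz => ?_
    refine DifferentiableAt.differentiableWithinAt ?_
    have := ofReal_sub_ne_zero hz s
    fun_prop (disch := assumption)
  · intro z hz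
    have hz' : 0 < z.im := hz
    refine ⟨z.im / 2, by positivity, fun s => 2 * ‖h s * ((s : ℂ) - z)⁻¹‖, fun w hw => ?_,
      -- The factor 2 comes from |s - w| ≥ |s - z| / 2 when |w - z| < Im z / 2, since Im z ≤ |s -
      -- z|.
      (integrable_mul_inv_ofReal_sub hh hz).norm.const_mul 2, Eventually.of_forall fun s w hw => ?_⟩
    · have h1 : |(w - z).im| < z.im / 2 :=
        (Complex.abs_im_le_norm _).trans_lt (by simpa [dist_eq_norm] using hw)
      rw [Complex.sub_im, abs_lt] at h1
      exact mem_upperHalfPlaneSet.2 (by linarith)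
    · have hwz : ‖w - z‖ < z.im / 2 := by simpa [dist_eq_norm] using hw
      have h1 := im_le_norm_ofReal_sub z s
      have h2 : ‖(s : ℂ) - z‖ ≤ ‖(s : ℂ) - w‖ + ‖w - z‖ := by
        simpa using norm_add_le ((s : ℂ) - w) (w - z)
      have h3 : ‖(s : ℂ) - z‖ / 2 ≤ ‖(s : ℂ) - w‖ := by linarith
      simp only [norm_mul, norm_inv]
      rw [mul_left_comm]
      gcongr
      rw [show 2 * ‖(s : ℂ) - z‖⁻¹ = (‖(s : ℂ) - z‖ / 2)⁻¹ by field_simp]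
      exact inv_anti₀ (by linarith) h3

/-- The Poisson kernel is the real part of 1 / (πi (s - z)), and h is real. -/
theorem re_schwarz {h : ℝ → ℝ} (hh : MemLp h 2) {z : ℂ} (hz : 0 < z.im) :
    (schwarz (fun s => (h s : ℂ)) z).re = poisson h z := by
  have hh' : MemLp (fun s => (h s : ℂ)) 2 := hh.ofReal
  rw [schwarz, ← integral_const_mul, poisson]
  refine ((integral_re
    ((integrable_mul_inv_ofReal_sub hh' hz).const_mul _)).symm.trans ?_)
  refine integral_congr_ae (Eventually.of_forall fun s => ?_)
  have hpi := Real.pi_ne_zero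
  have hne := ofReal_sub_ne_zero hz s
  have hn : (s - z.re) ^ 2 + z.im ^ 2 ≠ 0 := by positivity
  simp only [pkernel, smul_eq_mul]
  rw [mul_inv, Complex.inv_I, Complex.inv_def ((s : ℂ) - z), Complex.normSq_eq_norm_sq,
    normSq_ofReal_sub, ← Complex.ofReal_inv]
  generalize (s - z.re) ^ 2 + z.im ^ 2 = d at hn
  simp [-Complex.ofReal_inv]
  field_simp

/-- An average of translates against a probability measure contracts L², by Jensen and translation
invariance. -/
theorem lintegral_poisson_sq_le {h : ℝ → ℝ} (hh : MemLp h 2) {y : ℝ} (hy : 0 < y) :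
    ∫⁻ x : ℝ, ‖poisson h ((x : ℂ) + (y : ℂ) * Complex.I)‖ₑ ^ (2 : ℝ) ≤ ∫⁻ x, ‖h x‖ₑ ^ (2 : ℝ) := by
  -- For fixed u the map in x is a translation, so null sets pull back to null sets and h may be
  -- composed although it is only a.e. measurable.
  have hq : Measure.QuasiMeasurePreserving (fun q : ℝ × ℝ => q.1 + y * q.2)
      ((volume : Measure ℝ).prod cauchyDist) volume := by
    refine ⟨by fun_prop, Measure.AbsolutelyContinuous.mk fun s hs hs0 => ?_⟩
    rw [Measure.map_apply (by fun_prop) hs, Measure.prod_apply_symm (by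
      exact (show Measurable fun q : ℝ × ℝ => q.1 + y * q.2 by fun_prop) hs)]
    refine lintegral_eq_zero_of_ae_eq_zero (Eventually.of_forall fun u => ?_)
    simpa [preimage_preimage] using! hs0
  have hm : AEMeasurable (Function.uncurry fun x u : ℝ => ‖h (x + y * u)‖ₑ)
      ((volume : Measure ℝ).prod cauchyDist) :=
    (hh.1.comp_quasiMeasurePreserving hq).enorm
  calc ∫⁻ x : ℝ, ‖poisson h ((x : ℂ) + (y : ℂ) * Complex.I)‖ₑ ^ (2 : ℝ)
      ≤ ∫⁻ x : ℝ, (∫⁻ u, ‖h (x + y * u)‖ₑ ∂cauchyDist) ^ (2 : ℝ) := by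
        refine lintegral_mono fun x => ENNReal.rpow_le_rpow ?_ (by norm_num)
        rw [poisson_eq_integral_cauchyDist h x hy]
        exact enorm_integral_le_lintegral_enorm _
    _ ≤ _ := lintegral_lintegral_rpow_le hm (by norm_num)
    _ = ∫⁻ x, ‖h x‖ₑ ^ (2 : ℝ) := by
        simp only [measure_univ, ENNReal.one_rpow, one_mul]
        have : ∀ u : ℝ, ∫⁻ x, ‖h (x + y * u)‖ₑ ^ (2 : ℝ) = ∫⁻ x, ‖h x‖ₑ ^ (2 : ℝ) := fun u =>
          lintegral_add_right_eq_self (fun x => ‖h x‖ₑ ^ (2 : ℝ)) (y * u)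
        simp_rw [this]
        simp

/-! ### Fatou's theorem for Poisson extensions -/

theorem lintegral_comp_mul_left {c : ℝ} (hc : 0 < c) (f : ℝ → ℝ≥0∞) :
    ∫⁻ x, f (c * x) = ENNReal.ofReal c⁻¹ * ∫⁻ x, f x := by
  have h1 : Measure.map (c * ·) (volume : Measure ℝ) = ENNReal.ofReal c⁻¹ • volume := by
    rw [Real.map_volume_mul_left hc.ne', abs_of_pos (inv_pos.2 hc)]
  have h2 : ∫⁻ x, f x ∂(Measure.map (c * ·) (volume : Measure ℝ)) = ∫⁻ x, f (c * x) :=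
    lintegral_map_equiv f (Homeomorph.mulLeft₀ c hc.ne').toMeasurableEquiv
  rw [← h2, h1, lintegral_smul_measure, smul_eq_mul]

/-- Keep only the term of the least k with |u| ≤ 2^k. If k ≥ 1 then |u| > 2^(k-1), so (1 + u²)^(-1)
≤ 4^(1-k), which explains the factor 4. -/
theorem cauchyDensity_le_tsum (u : ℝ) :
    ENNReal.ofReal (Real.pi⁻¹ * (1 + u ^ 2)⁻¹) ≤
      ∑' k : ℕ, ENNReal.ofReal (4 * (1 / 4) ^ k) *
        (Metric.closedBall (0 : ℝ) (2 ^ k)).indicator (fun _ => 1) u := by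
  classical
  have hex : ∃ k : ℕ, |u| ≤ 2 ^ k := by
    obtain ⟨k, hk⟩ := pow_unbounded_of_one_lt |u| (one_lt_two (α := ℝ))
    exact ⟨k, hk.le⟩
  refine le_trans ?_ (ENNReal.le_tsum (Nat.find hex))
  have hmem : u ∈ Metric.closedBall (0 : ℝ) (2 ^ Nat.find hex) := by
    simpa using Nat.find_spec hex
  rw [indicator_of_mem hmem, mul_one]
  refine ENNReal.ofReal_le_ofReal ?_
  have hpi : Real.pi⁻¹ ≤ 1 := inv_le_one_of_one_le₀ (by linarith [Real.pi_gt_three])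
  have h1 : (1 + u ^ 2)⁻¹ ≤ 4 * (1 / 4) ^ Nat.find hex := by
    rcases hk : Nat.find hex with _ | j
    · have : (1 + u ^ 2)⁻¹ ≤ 1 := inv_le_one_of_one_le₀ (by nlinarith [sq_nonneg u])
      norm_num; linarith
    · have hlt : 2 ^ j < |u| := not_le.1 (Nat.find_min hex (m := j) (by omega))
      have h4 : (4 : ℝ) ^ j ≤ 1 + u ^ 2 := by
        have := pow_le_pow_left₀ (by positivity) hlt.le 2
        rw [sq_abs, ← pow_mul, mul_comm, pow_mul] at this
        norm_num at this; linarith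
      have h5 := inv_anti₀ (by positivity) h4
      rw [one_div, inv_pow, pow_succ (4 : ℝ), mul_inv]
      linarith
  calc Real.pi⁻¹ * (1 + u ^ 2)⁻¹ ≤ 1 * (4 * (1 / 4) ^ Nat.find hex) := by gcongr
    _ = _ := one_mul _

section
variable {E : Type*} [NormedAddCommGroup E]

/-- The mean oscillation of `h` over the interval of radius `r` centred at `x`. -/
noncomputable def meanOsc (h : ℝ → E) (x r : ℝ) : ℝ≥0∞ :=
  (∫⁻ s in Metric.closedBall x r, ‖h s - h x‖ₑ) / ENNReal.ofReal (2 * r)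

/-- Rescale each dyadic piece by y: the weight 4 · 4^(-k) times the length 2 · 2^k of the interval
gives 8 · 2^(-k), which is summable. -/
theorem lintegral_cauchyDist_le_tsum {h : ℝ → E} (hh : AEStronglyMeasurable h volume) (x : ℝ)
    {y : ℝ} (hy : 0 < y) :
    ∫⁻ u, ‖h (x + y * u) - h x‖ₑ ∂cauchyDist ≤
      ∑' k : ℕ, ENNReal.ofReal (8 * (1 / 2) ^ k) * meanOsc h x (2 ^ k * y) := by
  have hq : Measure.QuasiMeasurePreserving (fun u : ℝ => x + y * u) volume volume :=
    (measurePreserving_add_left volume x).quasiMeasurePreserving.comp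
      ⟨by fun_prop, by
        rw [Real.map_volume_mul_left hy.ne']
        exact Measure.smul_absolutelyContinuous⟩
  have hm : AEMeasurable (fun u : ℝ => ‖h (x + y * u) - h x‖ₑ) volume :=
    ((hh.comp_quasiMeasurePreserving hq).sub aestronglyMeasurable_const).enorm
  rw [cauchyDist, lintegral_withDensity_eq_lintegral_mul₀ measurable_cauchyDensity.aemeasurable hm]
  simp only [Pi.mul_apply]
  refine (lintegral_mono fun u => mul_le_mul' (cauchyDensity_le_tsum u) le_rfl).trans ?_
  simp_rw [← ENNReal.tsum_mul_right]
  have hmk : ∀ k : ℕ, AEMeasurable (fun u : ℝ => ENNReal.ofReal (4 * (1 / 4) ^ k) *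
      (Metric.closedBall (0 : ℝ) (2 ^ k)).indicator (fun _ => (1 : ℝ≥0∞)) u *
        ‖h (x + y * u) - h x‖ₑ) volume := fun k =>
    AEMeasurable.mul ((measurable_const.mul (measurable_const.indicator
      Metric.isClosed_closedBall.measurableSet)).aemeasurable) hm
  rw [lintegral_tsum hmk]
  refine ENNReal.tsum_le_tsum fun k => ?_
  have h2k : (0 : ℝ) < 2 ^ k * y := by positivity
  have h1 : ∀ u : ℝ, ENNReal.ofReal (4 * (1 / 4) ^ k) *
      (Metric.closedBall (0 : ℝ) (2 ^ k)).indicator (fun _ => (1 : ℝ≥0∞)) u *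
        ‖h (x + y * u) - h x‖ₑ = ENNReal.ofReal (4 * (1 / 4) ^ k) *
      (Metric.closedBall x (2 ^ k * y)).indicator (fun s => ‖h s - h x‖ₑ) (x + y * u) := by
    intro u
    have hiff : u ∈ Metric.closedBall (0 : ℝ) (2 ^ k) ↔
        x + y * u ∈ Metric.closedBall x (2 ^ k * y) := by
      simp [abs_of_pos hy, mul_comm y]
      exact (mul_le_mul_iff_left₀ hy).symm
    by_cases hu : u ∈ Metric.closedBall (0 : ℝ) (2 ^ k)
    · rw [indicator_of_mem hu, indicator_of_mem (hiff.1 hu), mul_one]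
    · rw [indicator_of_notMem hu, indicator_of_notMem (mt hiff.2 hu), mul_zero, zero_mul]
  simp_rw [h1]
  rw [lintegral_const_mul' _ _ ENNReal.ofReal_ne_top,
    lintegral_comp_mul_left hy (fun s => (Metric.closedBall x (2 ^ k * y)).indicator
      (fun s => ‖h s - h x‖ₑ) (x + s)),
    lintegral_add_left_eq_self (fun s => (Metric.closedBall x (2 ^ k * y)).indicator
      (fun s => ‖h s - h x‖ₑ) s) x,
    lintegral_indicator Metric.isClosed_closedBall.measurableSet, meanOsc, ENNReal.div_eq_inv_mul,
    ← mul_assoc, ← mul_assoc, ← ENNReal.ofReal_mul (by positivity),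
    ← ENNReal.ofReal_inv_of_pos (by positivity), ← ENNReal.ofReal_mul (by positivity)]
  refine le_of_eq ?_
  congr 2
  have : (1 / 4 : ℝ) ^ k = (1 / 2) ^ k * (1 / 2) ^ k := by rw [← mul_pow]; norm_num
  have h4 : (2 * (2 ^ k * y))⁻¹ = 1 / 2 * (1 / 2) ^ k * y⁻¹ := by
    rw [mul_inv, mul_inv, one_div, inv_pow]; ring
  rw [this, h4]
  ring

/-- Small radii are controlled by the limit, large ones by |h| ≤ 1 + |h|² and the finite L² norm.
The uniform bound dominates the dyadic series. -/
theorem exists_meanOsc_le {h : ℝ → E} (hh : MemLp h 2) {x : ℝ}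
    (hx : Tendsto (meanOsc h x) (𝓝[>] 0) (𝓝 0)) :
    ∃ B : ℝ≥0∞, B ≠ ∞ ∧ ∀ r : ℝ, 0 < r → meanOsc h x r ≤ B := by
  have h1 : ∀ᶠ r in 𝓝[>] (0 : ℝ), meanOsc h x r < 1 := hx.eventually (gt_mem_nhds zero_lt_one)
  obtain ⟨r₀, hr₀, hr₀'⟩ := mem_nhdsGT_iff_exists_Ioo_subset.1 h1
  have hr₀0 : (0 : ℝ) < r₀ := hr₀
  set A : ℝ≥0∞ := ∫⁻ s, ‖h s‖ₑ ^ (2 : ℝ) with hA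
  have hAfin : A ≠ ∞ := by
    have := lintegral_rpow_enorm_lt_top_of_eLpNorm_lt_top two_ne_zero ENNReal.ofNat_ne_top hh.2
    rw [ENNReal.toReal_ofNat] at this
    exact this.ne
  refine ⟨max 1 (1 + ‖h x‖ₑ + A / ENNReal.ofReal (2 * r₀)), ?_, fun r hr => ?_⟩
  · refine (max_lt ENNReal.one_lt_top ?_).ne
    refine ENNReal.add_lt_top.2 ⟨ENNReal.add_lt_top.2 ⟨ENNReal.one_lt_top, enorm_lt_top⟩, ?_⟩
    exact ENNReal.div_lt_top hAfin (ENNReal.ofReal_pos.2 (by positivity)).ne'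
  rcases lt_or_ge r r₀ with hlt | hge
  · exact (show meanOsc h x r < 1 from hr₀' ⟨hr, hlt⟩).le.trans (le_max_left _ _)
  · refine le_trans ?_ (le_max_right _ _)
    have hpt : ∀ s, ‖h s - h x‖ₑ ≤ (1 + ‖h x‖ₑ) + ‖h s‖ₑ ^ (2 : ℝ) := fun s => by
      have h2 : ‖h s‖ₑ ≤ 1 + ‖h s‖ₑ ^ (2 : ℝ) := by
        rcases le_total ‖h s‖ₑ 1 with hle | hle
        · exact hle.trans le_self_add
        · refine le_trans ?_ le_add_self
          simpa using ENNReal.rpow_le_rpow_of_exponent_le hle (show (1 : ℝ) ≤ 2 by norm_num)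
      calc ‖h s - h x‖ₑ ≤ ‖h s‖ₑ + ‖h x‖ₑ := enorm_sub_le
        _ ≤ (1 + ‖h s‖ₑ ^ (2 : ℝ)) + ‖h x‖ₑ := by gcongr
        _ = _ := by ring
    have h3 : ∫⁻ s in Metric.closedBall x r, ‖h s - h x‖ₑ ≤
        (1 + ‖h x‖ₑ) * ENNReal.ofReal (2 * r) + A := by
      refine (lintegral_mono hpt).trans ?_
      rw [lintegral_add_left measurable_const, setLIntegral_const, Real.volume_closedBall]
      gcongr
      exact setLIntegral_le_lintegral _ _
    have hne : ENNReal.ofReal (2 * r) ≠ 0 := (ENNReal.ofReal_pos.2 (by positivity)).ne'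
    calc meanOsc h x r ≤ ((1 + ‖h x‖ₑ) * ENNReal.ofReal (2 * r) + A) / ENNReal.ofReal (2 * r) := by
          rw [meanOsc]; gcongr
      _ = (1 + ‖h x‖ₑ) + A / ENNReal.ofReal (2 * r) := by
          rw [ENNReal.add_div, ENNReal.mul_div_cancel_right hne ENNReal.ofReal_ne_top]
      _ ≤ _ := by gcongr

theorem ae_tendsto_meanOsc {h : ℝ → E} (hh : LocallyIntegrable h volume) :
    ∀ᵐ x : ℝ, Tendsto (meanOsc h x) (𝓝[>] 0) (𝓝 0) := by
  filter_upwards [(Besicovitch.vitaliFamily (volume : Measure ℝ)).ae_tendsto_lintegral_enorm_sub_div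
    hh] with x hx
  refine (hx.comp (Besicovitch.tendsto_filterAt volume x)).congr fun r => ?_
  simp only [Function.comp_apply, Real.volume_closedBall, meanOsc]

theorem tendsto_lintegral_cauchyDist {h : ℝ → E} (hh : MemLp h 2) {x : ℝ}
    (hx : Tendsto (meanOsc h x) (𝓝[>] 0) (𝓝 0)) :
    Tendsto (fun y : ℝ => ∫⁻ u, ‖h (x + y * u) - h x‖ₑ ∂cauchyDist) (𝓝[>] 0) (𝓝 0) := by
  obtain ⟨B, hB, hBr⟩ := exists_meanOsc_le hh hx
  have hsum : Tendsto (fun y : ℝ => ∑' k : ℕ, ENNReal.ofReal (8 * (1 / 2) ^ k) *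
      meanOsc h x (2 ^ k * y)) (𝓝[>] 0) (𝓝 0) := by
    -- Dominated convergence for the series, read as an integral against counting measure.
    have := tendsto_lintegral_filter_of_dominated_convergence (μ := Measure.count)
      (l := 𝓝[>] (0 : ℝ))
      (F := fun y (k : ℕ) => ENNReal.ofReal (8 * (1 / 2) ^ k) * meanOsc h x (2 ^ k * y))
      (f := fun _ => 0) (fun k => ENNReal.ofReal (8 * (1 / 2) ^ k) * B)
      (Eventually.of_forall fun y => measurable_of_countable _) ?_ ?_ ?_
    · simpa [lintegral_count] using this
    · filter_upwards [self_mem_nhdsWithin] with y hy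
      have hy' : (0 : ℝ) < y := hy
      exact Eventually.of_forall fun k => by gcongr; exact hBr _ (by positivity)
    · rw [lintegral_count, ENNReal.tsum_mul_right, ← ENNReal.ofReal_tsum_of_nonneg
        (fun k => by positivity) ((summable_geometric_two).mul_left 8)]
      exact ENNReal.mul_ne_top ENNReal.ofReal_ne_top hB
    · refine Eventually.of_forall fun k => ?_
      have h1 : Tendsto (fun y : ℝ => 2 ^ k * y) (𝓝[>] 0) (𝓝[>] 0) := by
        refine tendsto_nhdsWithin_iff.2 ⟨?_, ?_⟩
        · have : Tendsto (fun y : ℝ => 2 ^ k * y) (𝓝 0) (𝓝 (2 ^ k * 0)) :=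
            tendsto_id.const_mul _
          rw [mul_zero] at this
          exact this.mono_left nhdsWithin_le_nhds
        · filter_upwards [self_mem_nhdsWithin] with y hy
          have hy' : (0 : ℝ) < y := hy
          exact mem_Ioi.2 (by positivity)
      simpa only [mul_zero] using! ENNReal.Tendsto.const_mul (a := ENNReal.ofReal (8 * (1 / 2) ^ k))
        (hx.comp h1) (Or.inr ENNReal.ofReal_ne_top)
  refine tendsto_of_tendsto_of_tendsto_of_le_of_le' tendsto_const_nhds hsum
    (Eventually.of_forall fun _ => zero_le) ?_
  filter_upwards [self_mem_nhdsWithin] with y hy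
  exact lintegral_cauchyDist_le_tsum hh.1 x hy

/-- Fatou's theorem: Poisson extensions of square integrable functions have the expected vertical
limits almost everywhere. -/
theorem ae_tendsto_poisson [NormedSpace ℝ E] [CompleteSpace E] {h : ℝ → E} (hh : MemLp h 2) :
    ∀ᵐ x : ℝ, Tendsto (fun y : ℝ => poisson h ((x : ℂ) + (y : ℂ) * Complex.I)) (𝓝[>] 0)
      (𝓝 (h x)) := by
  filter_upwards [ae_tendsto_meanOsc (hh.locallyIntegrable one_le_two)] with x hx
  have hlim := tendsto_lintegral_cauchyDist hh hx
  rw [tendsto_iff_edist_tendsto_0]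
  refine tendsto_of_tendsto_of_tendsto_of_le_of_le' tendsto_const_nhds hlim
    (Eventually.of_forall fun _ => zero_le) ?_
  have hfin := hlim.eventually (gt_mem_nhds ENNReal.zero_lt_top)
  filter_upwards [self_mem_nhdsWithin, hfin] with y hy hy2
  have hy' : (0 : ℝ) < y := hy
  have hq : Measure.QuasiMeasurePreserving (fun u : ℝ => x + y * u) cauchyDist volume :=
    ((measurePreserving_add_left volume x).quasiMeasurePreserving.comp
      (⟨by fun_prop, by
        rw [Real.map_volume_mul_left hy'.ne']
        exact Measure.smul_absolutelyContinuous⟩ :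
        Measure.QuasiMeasurePreserving (fun u : ℝ => y * u) volume volume)).mono_left
      (withDensity_absolutelyContinuous _ _)
  have hint : Integrable (fun u => h (x + y * u) - h x) cauchyDist :=
    ⟨(hh.1.comp_quasiMeasurePreserving hq).sub aestronglyMeasurable_const, hy2⟩
  have hint2 : Integrable (fun u => h (x + y * u)) cauchyDist := by
    refine (hint.add (integrable_const (h x))).congr (Eventually.of_forall fun u => ?_)
    simp
  have : poisson h ((x : ℂ) + (y : ℂ) * Complex.I) - h x =
      ∫ u, (h (x + y * u) - h x) ∂cauchyDist := by
    rw [integral_sub hint2 (integrable_const _), poisson_eq_integral_cauchyDist h x hy']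
    simp
  rw [edist_eq_enorm_sub, this]
  exact enorm_integral_le_lintegral_enorm _

end

/-- Poisson extensions of bounded uniformly continuous functions converge uniformly to their
boundary function. -/
theorem exists_forall_abs_poisson_sub_le {h : ℝ → ℝ} (hu : UniformContinuous h) {M : ℝ}
    (hM : ∀ x, |h x| ≤ M) {ε : ℝ} (hε : 0 < ε) :
    ∃ η > 0, ∀ x y : ℝ, 0 < y → y ≤ η →
      |poisson h ((x : ℂ) + (y : ℂ) * Complex.I) - h x| ≤ ε := by
  have hM0 : 0 ≤ M := (abs_nonneg _).trans (hM 0)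
  have hbi : ∀ x y : ℝ, Integrable (fun u => |h (x + y * u) - h x|) cauchyDist := fun x y =>
    Integrable.of_bound (C := 2 * M)
      ((hu.continuous.comp (by fun_prop)).sub continuous_const).abs.aestronglyMeasurable
      (Eventually.of_forall fun u => by
        rw [Real.norm_eq_abs, abs_abs]
        have h1 := abs_sub (h (x + y * u)) (h x)
        linarith [hM (x + y * u), hM x])
  have hbi' : ∀ x y : ℝ, Integrable (fun u => h (x + y * u)) cauchyDist := fun x y =>
    Integrable.of_bound (C := M) (hu.continuous.comp (by fun_prop)).aestronglyMeasurable
      (Eventually.of_forall fun u => hM _)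
  obtain ⟨δ, hδ, hδ'⟩ := Metric.uniformContinuous_iff.1 hu (ε / 2) (half_pos hε)
  have htail : Tendsto (fun n : ℕ => cauchyDist (Metric.ball (0 : ℝ) n)ᶜ) atTop (𝓝 0) := by
    have h1 := tendsto_measure_iInter_atTop (μ := cauchyDist)
      (s := fun n : ℕ => (Metric.ball (0 : ℝ) n)ᶜ)
      (fun n => Metric.isOpen_ball.measurableSet.compl.nullMeasurableSet)
      (fun m n hmn => compl_subset_compl.2 (Metric.ball_subset_ball (by exact_mod_cast hmn)))
      ⟨0, measure_ne_top _ _⟩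
    rwa [← compl_iUnion, Metric.iUnion_ball_nat, compl_univ, measure_empty] at h1
  -- The integrand is at most 2M on the tail, so this mass contributes at most ε / 2; M + 1 keeps
  -- the denominator positive when M = 0.
  have hpos : (0 : ℝ≥0∞) < ENNReal.ofReal (ε / (4 * (M + 1))) := ENNReal.ofReal_pos.2 (by positivity)
  obtain ⟨n, hn⟩ := (htail.eventually (gt_mem_nhds hpos)).exists
  have hn' : (cauchyDist.real (Metric.ball (0 : ℝ) n)ᶜ) ≤ ε / (4 * (M + 1)) :=
    ENNReal.toReal_le_of_le_ofReal (by positivity) hn.le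
  -- With this height, |u| < n forces y |u| < δ, so uniform continuity applies off the tail.
  refine ⟨δ / (n + 1), by positivity, fun x y hy hyη => ?_⟩
  have hsub : poisson h ((x : ℂ) + (y : ℂ) * Complex.I) - h x =
      ∫ u, (h (x + y * u) - h x) ∂cauchyDist := by
    rw [integral_sub (hbi' x y) (integrable_const _), poisson_eq_integral_cauchyDist h x hy]
    simp
  rw [hsub]
  refine (abs_integral_le_integral_abs).trans ?_
  have hpt : ∀ u, |h (x + y * u) - h x| ≤
      ε / 2 + (Metric.ball (0 : ℝ) n)ᶜ.indicator (fun _ => 2 * M) u := by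
    intro u
    by_cases hu' : u ∈ (Metric.ball (0 : ℝ) n)ᶜ
    · rw [indicator_of_mem hu']
      have h1 := abs_sub (h (x + y * u)) (h x)
      linarith [hM (x + y * u), hM x]
    · rw [indicator_of_notMem hu', add_zero]
      have hu2 : |u| < n := by simpa using hu'
      refine (hδ' (a := x + y * u) (b := x) ?_).le
      rw [Real.dist_eq, add_sub_cancel_left, abs_mul, abs_of_pos hy]
      calc y * |u| ≤ δ / (n + 1) * |u| := by gcongr
        _ < δ / (n + 1) * (n + 1) := by
            have : (0 : ℝ) < δ / (n + 1) := by positivity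
            gcongr; linarith
        _ = δ := by field_simp
  have hind : Integrable ((Metric.ball (0 : ℝ) n)ᶜ.indicator (fun _ => 2 * M)) cauchyDist :=
    (integrable_const _).indicator Metric.isOpen_ball.measurableSet.compl
  refine (integral_mono (hbi x y) ((integrable_const _).add hind) hpt).trans ?_
  rw [integral_add' (integrable_const _) hind, integral_const,
    integral_indicator_const _ Metric.isOpen_ball.measurableSet.compl]
  simp only [probReal_univ, smul_eq_mul, one_mul]
  have h5 : cauchyDist.real (Metric.ball (0 : ℝ) n)ᶜ * (2 * M) ≤
      ε / (4 * (M + 1)) * (2 * (M + 1)) := by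
    gcongr; linarith
  have h6 : ε / (4 * (M + 1)) * (2 * (M + 1)) = ε / 2 := by field_simp; norm_num
  linarith

/-! ### A maximum principle on the half-plane -/

theorem closedBall_subset_upperHalfPlaneSet {z : ℂ} {r : ℝ} (hr : r < z.im) :
    Metric.closedBall z r ⊆ UpperHalfPlane.upperHalfPlaneSet := fun w hw => by
  have h1 : |(w - z).im| ≤ r :=
    (Complex.abs_im_le_norm _).trans (by simpa [dist_eq_norm] using hw)
  rw [Complex.sub_im, abs_le] at h1
  exact mem_upperHalfPlaneSet.2 (by linarith)

theorem circleIntegrable_of_continuousOn {E : Type*} [NormedAddCommGroup E] {U : ℂ → E}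
    (hU : ContinuousOn U UpperHalfPlane.upperHalfPlaneSet) {z : ℂ} {r : ℝ} (hr0 : 0 < r)
    (hr : r < z.im) : CircleIntegrable U z r :=
  (hU.mono (Metric.sphere_subset_closedBall.trans
    (closedBall_subset_upperHalfPlaneSet hr))).circleIntegrable hr0.le

theorem circleAverage_re_eq {g : ℂ → ℂ}
    (hg : DifferentiableOn ℂ g UpperHalfPlane.upperHalfPlaneSet) {z : ℂ} {r : ℝ} (hr0 : 0 < r)
    (hr : r < z.im) : Real.circleAverage (fun w => (g w).re) z r = (g z).re := by
  have h1 : Real.circleAverage g z r = g z := by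
    apply DiffContOnCl.circleAverage
    rw [abs_of_pos hr0]
    exact (hg.mono (Metric.closure_ball_subset_closedBall.trans
      (closedBall_subset_upperHalfPlaneSet hr))).diffContOnCl
  have h2 := Complex.reCLM.circleAverage_comp_comm
    (circleIntegrable_of_continuousOn hg.continuousOn hr0 hr)
  rw [h1] at h2
  exact h2

/-- The circle average of a continuous function that is bounded by `m`, and smaller than `m`
somewhere on the circle, is smaller than `m`. -/
theorem circleAverage_lt {V : ℂ → ℝ} {z : ℂ} {r m : ℝ} (hr : 0 < r)
    (hV : ContinuousOn V (Metric.sphere z r)) (hm : ∀ w ∈ Metric.sphere z r, V w ≤ m)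
    {w₀ : ℂ} (hw₀ : w₀ ∈ Metric.sphere z r) (hlt : V w₀ < m) :
    Real.circleAverage V z r < m := by
  rw [← abs_of_pos hr, ← image_circleMap_Ioc z r] at hw₀
  obtain ⟨θ, hθ, rfl⟩ := hw₀
  rw [← Real.circleAverage_const m z r, Real.circleAverage, Real.circleAverage, smul_eq_mul,
    smul_eq_mul]
  refine mul_lt_mul_of_pos_left ?_ (by positivity)
  refine intervalIntegral.integral_lt_integral_of_continuousOn_of_le_of_exists_lt
    Real.two_pi_pos ?_ continuousOn_const (fun θ _ => hm _ (circleMap_mem_sphere _ hr.le _))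
    ⟨θ, Ioc_subset_Icc_self hθ, hlt⟩
  exact hV.comp (continuous_circleMap _ _).continuousOn fun θ _ => circleMap_mem_sphere _ hr.le _

/-- A bounded continuous function with the local sub-mean value property on the upper half-plane
which is asymptotically nonpositive at the real line is nonpositive. -/
theorem nonpos_of_subMean {v : ℂ → ℝ} (hc : ContinuousOn v UpperHalfPlane.upperHalfPlaneSet)
    (hsub : ∀ z : ℂ, 0 < z.im → ∀ᶠ r in 𝓝[>] (0 : ℝ), v z ≤ Real.circleAverage v z r)
    {M : ℝ} (hM : ∀ z : ℂ, 0 < z.im → v z ≤ M)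
    (hbd : ∀ ε > 0, ∃ η > 0, ∀ z : ℂ, 0 < z.im → z.im ≤ η → v z ≤ ε) {z₀ : ℂ} (hz₀ : 0 < z₀.im) :
    v z₀ ≤ 0 := by
  by_contra! hpos
  -- A harmonic function, positive on the half-plane and unbounded at infinity. Subtracting a small
  -- multiple makes up for the lack of compactness.
  set ℓ : ℂ → ℝ := fun z => Real.log ‖z + Complex.I‖ with hℓ
  have hn1 : ∀ z : ℂ, 0 < z.im → 1 < ‖z + Complex.I‖ := fun z hz => by
    have := (le_abs_self _).trans (Complex.abs_im_le_norm (z + Complex.I))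
    simp at this; linarith
  have hne : ∀ z : ℂ, 0 < z.im → z + Complex.I ≠ 0 := fun z hz =>
    norm_pos_iff.1 (zero_lt_one.trans (hn1 z hz))
  have hℓ0 : ∀ z : ℂ, 0 < z.im → 0 < ℓ z := fun z hz => Real.log_pos (hn1 z hz)
  have hℓc : ContinuousOn ℓ UpperHalfPlane.upperHalfPlaneSet := by
    refine ContinuousOn.log (by fun_prop) fun z hz => ?_
    exact norm_ne_zero_iff.2 (hne z hz)
  have hℓm : ∀ z : ℂ, ∀ r, 0 < r → r < z.im → Real.circleAverage ℓ z r = ℓ z := by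
    intro z r hr0 hr
    refine InnerProductSpace.HarmonicOnNhd.circleAverage_eq fun w hw => ?_
    rw [abs_of_pos hr0] at hw
    exact AnalyticAt.harmonicAt_log_norm (by fun_prop)
      (hne w (closedBall_subset_upperHalfPlaneSet hr hw))
  -- Chosen so that the perturbed function keeps the value (3/4) v z₀ at z₀, above the level v z₀ /
  -- 2 that bounds it off the compact set below.
  set δ : ℝ := v z₀ / (4 * ℓ z₀) with hδ
  have hℓz₀ := hℓ0 z₀ hz₀
  have hδ0 : 0 < δ := by positivity
  set V : ℂ → ℝ := fun z => v z - δ * ℓ z with hV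
  have hVc : ContinuousOn V UpperHalfPlane.upperHalfPlaneSet :=
    hc.sub (continuousOn_const.mul hℓc)
  have hVz₀ : V z₀ = 3 / 4 * v z₀ := by
    have : δ * ℓ z₀ = v z₀ / 4 := by rw [hδ]; field_simp
    simp only [hV, this]; ring
  have hVle : ∀ z : ℂ, 0 < z.im → V z ≤ v z := fun z hz => by
    have := mul_pos hδ0 (hℓ0 z hz)
    simp only [hV]; linarith
  obtain ⟨η, hη, hη'⟩ := hbd (v z₀ / 2) (half_pos hpos)
  -- Outside the disc of radius R about -i the term δ ℓ is at least M, so V ≤ 0 there.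
  set R : ℝ := Real.exp (M / δ) with hR
  set K : Set ℂ := {z | η ≤ z.im} ∩ Metric.closedBall (-Complex.I) R with hK
  have hKc : IsCompact K :=
    (isCompact_closedBall _ _).inter_left (isClosed_le continuous_const Complex.continuous_im)
  have hKsub : K ⊆ UpperHalfPlane.upperHalfPlaneSet := fun z hz => hη.trans_le hz.1
  have hoff : ∀ z : ℂ, 0 < z.im → z ∉ K → V z ≤ v z₀ / 2 := by
    intro z hz hzK
    by_cases h1 : η ≤ z.im
    · have h2 : R < ‖z + Complex.I‖ := by
        by_contra! h3
        exact hzK ⟨h1, by simpa [dist_eq_norm] using h3⟩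
      have h3 : M / δ ≤ ℓ z := by
        rw [hℓ, Real.le_log_iff_exp_le (zero_lt_one.trans (hn1 z hz))]
        exact h2.le
      rw [div_le_iff₀ hδ0] at h3
      have := hM z hz
      simp only [hV]; linarith
    · exact (hVle z hz).trans (hη' z hz (not_le.1 h1).le)
  have hz₀K : z₀ ∈ K := by
    by_contra h
    have := hoff z₀ hz₀ h
    rw [hVz₀] at this; linarith
  obtain ⟨zm, hzmK, hzm⟩ := hKc.exists_isMaxOn ⟨z₀, hz₀K⟩ (hVc.mono hKsub)
  set m : ℝ := V zm with hm
  have hm0 : v z₀ / 2 < m := by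
    have : V z₀ ≤ V zm := hzm hz₀K
    rw [hVz₀] at this; linarith
  have hle : ∀ z : ℂ, 0 < z.im → V z ≤ m := fun z hz => by
    by_cases h : z ∈ K
    · exact hzm h
    · exact (hoff z hz h).trans hm0.le
  set A : Set ℂ := K ∩ V ⁻¹' {m} with hA
  have hAc : IsCompact A := by
    refine hKc.of_isClosed_subset ?_ inter_subset_left
    exact (hVc.mono hKsub).preimage_isClosed_of_isClosed hKc.isClosed isClosed_singleton
  -- Take a maximum point of least imaginary part. The bottom of any small circle around it is not a
  -- maximum point, so the circle average is strictly below the maximum, against the sub-mean value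
  -- property.
  obtain ⟨z₁, hz₁A, hz₁⟩ := hAc.exists_isMinOn ⟨zm, hzmK, rfl⟩ Complex.continuous_im.continuousOn
  have hz₁p : 0 < z₁.im := hKsub hz₁A.1
  have hVz₁ : V z₁ = m := hz₁A.2
  obtain ⟨r, hr1, hr2, hr0⟩ := ((hsub z₁ hz₁p).and
    ((eventually_nhdsWithin_of_eventually_nhds (gt_mem_nhds hz₁p)).and
      self_mem_nhdsWithin)).exists
  have hr0' : 0 < r := hr0
  have hsph : Metric.sphere z₁ r ⊆ UpperHalfPlane.upperHalfPlaneSet :=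
    Metric.sphere_subset_closedBall.trans (closedBall_subset_upperHalfPlaneSet hr2)
  have havg : V z₁ ≤ Real.circleAverage V z₁ r := by
    have h1 : Real.circleAverage V z₁ r =
        Real.circleAverage v z₁ r - Real.circleAverage (fun z => δ * ℓ z) z₁ r :=
      Real.circleAverage_fun_sub (circleIntegrable_of_continuousOn hc hr0' hr2)
        (circleIntegrable_of_continuousOn (continuousOn_const.mul hℓc) hr0' hr2)
    have h2 : Real.circleAverage (fun z => δ * ℓ z) z₁ r = δ * ℓ z₁ := by
      rw [← hℓm z₁ r hr0' hr2]
      exact Real.circleAverage_fun_smul (a := δ) (f := ℓ)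
    rw [h1, h2]
    simp only [hV]; linarith
  have hw : z₁ - r * Complex.I ∈ Metric.sphere z₁ r := by
    simp [abs_of_pos hr0']
  have hwlt : V (z₁ - r * Complex.I) < m := by
    refine lt_of_le_of_ne (hle _ (hsph hw)) fun heq => ?_
    have hmem : z₁ - r * Complex.I ∈ A := by
      refine ⟨by_contra fun h => ?_, heq⟩
      have := hoff _ (hsph hw) h
      linarith
    have h1 : z₁.im ≤ (z₁ - r * Complex.I).im := hz₁ hmem
    simp at h1
    linarith
  have := circleAverage_lt hr0' (hVc.mono hsph) (fun w hw => hle w (hsph hw)) hw hwlt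
  linarith

theorem differentiableOn_re_poisson {h : ℝ → ℝ} (hh : MemLp h 2) :
    ∃ g : ℂ → ℂ, DifferentiableOn ℂ g UpperHalfPlane.upperHalfPlaneSet ∧
      ∀ z : ℂ, 0 < z.im → (g z).re = poisson h z :=
  ⟨_, differentiableOn_schwarz hh.ofReal, fun _ hz => re_schwarz hh hz⟩

/-- A bounded uniformly continuous function on the closed half-plane with the local sub-mean value
property is dominated by the Poisson extension of its boundary values. -/
theorem le_poisson_of_subMean {U : ℂ → ℝ} (hc : UniformContinuousOn U {z | 0 ≤ z.im})
    {M : ℝ} (hM : ∀ z : ℂ, 0 ≤ z.im → |U z| ≤ M)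
    (hsub : ∀ z : ℂ, 0 < z.im → ∀ᶠ r in 𝓝[>] (0 : ℝ), U z ≤ Real.circleAverage U z r)
    (hL : MemLp (fun x : ℝ => U x) 2) {z : ℂ} (hz : 0 < z.im) :
    U z ≤ poisson (fun x : ℝ => U x) z := by
  obtain ⟨g, hg, hgP⟩ := differentiableOn_re_poisson hL
  have hUc : ContinuousOn U UpperHalfPlane.upperHalfPlaneSet :=
    hc.continuousOn.mono fun z (hz : 0 < z.im) => hz.le
  have hgc : ContinuousOn (fun w => (g w).re) UpperHalfPlane.upperHalfPlaneSet :=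
    Complex.continuous_re.comp_continuousOn hg.continuousOn
  have hu : UniformContinuous fun x : ℝ => U x := by
    rw [Metric.uniformContinuous_iff]
    intro ε hε
    obtain ⟨δ, hδ, h⟩ := Metric.uniformContinuousOn_iff.1 hc ε hε
    refine ⟨δ, hδ, fun {x y} hxy => h x (by simp) y (by simp) ?_⟩
    simpa [Complex.dist_eq, Real.dist_eq, ← Complex.ofReal_sub] using hxy
  have hPM : ∀ z : ℂ, 0 < z.im → |poisson (fun x : ℝ => U x) z| ≤ M := by
    intro z hz
    rw [← Complex.re_add_im z, poisson_eq_integral_cauchyDist _ _ hz, ← Real.norm_eq_abs]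
    refine (norm_integral_le_of_norm_le_const (C := M) (Eventually.of_forall fun u => ?_)).trans
      (by simp)
    exact hM _ (by simp)
  -- Subtracting the harmonic function Re g = P[U] keeps the sub-mean value property. Near the real
  -- line both U and P[U] are uniformly close to the boundary values of U.
  have key := nonpos_of_subMean (v := fun w => U w - (g w).re) (hUc.sub hgc) (fun z hz => ?_)
    (M := M + M) (fun z hz => ?_) (fun ε hε => ?_) hz
  · rw [hgP z hz] at key
    linarith
  · filter_upwards [hsub z hz, eventually_nhdsWithin_of_eventually_nhds (gt_mem_nhds hz),
      self_mem_nhdsWithin] with r hr1 hr2 hr0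
    rw [Real.circleAverage_fun_sub (circleIntegrable_of_continuousOn hUc hr0 hr2)
      (circleIntegrable_of_continuousOn hgc hr0 hr2), circleAverage_re_eq hg hr0 hr2]
    linarith
  · have h1 := (abs_le.1 (hM z hz.le)).2
    have h2 := (abs_le.1 (hPM z hz)).1
    simp only [hgP z hz]; linarith
  · obtain ⟨η₁, hη₁, h1⟩ := exists_forall_abs_poisson_sub_le hu (M := M)
      (fun x => hM x (by simp)) (half_pos hε)
    obtain ⟨η₂, hη₂, h2⟩ := Metric.uniformContinuousOn_iff.1 hc (ε / 2) (half_pos hε)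
    refine ⟨min η₁ (η₂ / 2), by positivity, fun z hz hzη => ?_⟩
    have h3 := h1 z.re z.im hz (hzη.trans (min_le_left _ _))
    rw [Complex.re_add_im] at h3
    have h4 := h2 z hz.le (z.re : ℂ) (by simp) (by
      have : z - (z.re : ℂ) = z.im * Complex.I := by
        rw [sub_eq_iff_eq_add']
        exact (Complex.re_add_im z).symm
      rw [dist_eq_norm, this]
      simp only [norm_mul, Complex.norm_I, mul_one, Complex.norm_real, Real.norm_eq_abs,
        abs_of_pos hz]
      have := hzη.trans (min_le_right _ _)
      linarith)
    rw [Real.dist_eq] at h4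
    have h5 := (abs_lt.1 h4).2
    have h6 := (abs_le.1 h3).1
    simp only [hgP z hz]; linarith

/-! ### Powers of moduli of holomorphic functions -/

/-- At a zero of f the claim is trivial. Elsewhere f / f(z) stays in the slit plane near z, so its
q-th power is holomorphic there; apply the mean value property and the triangle inequality. This is
why only small radii are claimed. -/
theorem eventually_norm_rpow_le_circleAverage {f : ℂ → ℂ}
    (hf : DifferentiableOn ℂ f UpperHalfPlane.upperHalfPlaneSet) {q : ℝ} (hq : 0 < q) {z : ℂ}
    (hz : 0 < z.im) :
    ∀ᶠ r in 𝓝[>] (0 : ℝ), ‖f z‖ ^ q ≤ Real.circleAverage (fun w => ‖f w‖ ^ q) z r := by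
  by_cases h0 : f z = 0
  · refine Eventually.of_forall fun r => ?_
    rw [h0, norm_zero, Real.zero_rpow hq.ne']
    exact Real.circleAverage_nonneg_of_nonneg fun w _ => by positivity
  have hfz : ContinuousAt f z := hf.continuousOn.continuousAt
    (UpperHalfPlane.isOpen_upperHalfPlaneSet.mem_nhds hz)
  have hev : ∀ᶠ w in 𝓝 z, f w / f z ∈ Complex.slitPlane := by
    have h1 : ContinuousAt (fun w => f w / f z) z := hfz.div_const _
    refine h1.eventually_mem (Complex.isOpen_slitPlane.mem_nhds ?_)
    simp only [div_self h0]
    exact Complex.one_mem_slitPlane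
  obtain ⟨ρ, hρ, hρ'⟩ := Metric.eventually_nhds_iff_ball.1 hev
  filter_upwards [eventually_nhdsWithin_of_eventually_nhds (gt_mem_nhds hz),
    eventually_nhdsWithin_of_eventually_nhds (gt_mem_nhds hρ), self_mem_nhdsWithin] with r hr1 hr2 hr0
  have hr0' : 0 < r := hr0
  have hsub := closedBall_subset_upperHalfPlaneSet hr1
  set g : ℂ → ℂ := fun w => (f w / f z) ^ (q : ℂ) with hg
  have hgd : DifferentiableOn ℂ g (Metric.closedBall z r) := by
    refine DifferentiableOn.cpow ((hf.mono hsub).div_const _) (differentiableOn_const _) ?_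
    exact fun w hw => hρ' w (Metric.closedBall_subset_ball hr2 hw)
  have h1 : Real.circleAverage g z r = g z := by
    apply DiffContOnCl.circleAverage
    rw [abs_of_pos hr0']
    exact (hgd.mono Metric.closure_ball_subset_closedBall).diffContOnCl
  have hgz : g z = 1 := by simp [hg, div_self h0]
  have hgn : ∀ w, ‖g w‖ = (‖f z‖ ^ q)⁻¹ * ‖f w‖ ^ q := fun w => by
    rw [hg, Complex.norm_cpow_real, norm_div, Real.div_rpow (norm_nonneg _) (norm_nonneg _),
      div_eq_inv_mul]
  have hp : 0 < ‖f z‖ ^ q := by positivity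
  have h2 : ‖Real.circleAverage g z r‖ ≤ Real.circleAverage (fun w => ‖g w‖) z r := by
    rw [Real.circleAverage, Real.circleAverage, norm_smul, smul_eq_mul,
      Real.norm_of_nonneg (by positivity)]
    gcongr
    exact intervalIntegral.norm_integral_le_integral_norm Real.two_pi_pos.le
  have h3 : Real.circleAverage (fun w => ‖g w‖) z r =
      (‖f z‖ ^ q)⁻¹ * Real.circleAverage (fun w => ‖f w‖ ^ q) z r := by
    simp_rw [hgn]
    exact Real.circleAverage_fun_smul (a := (‖f z‖ ^ q)⁻¹) (f := fun w => ‖f w‖ ^ q)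
  rw [h1, hgz, norm_one, h3, ← div_eq_inv_mul, one_le_div hp] at h2
  exact h2

/-! ### Poisson majorants of vertical shifts -/

/-- The growth estimate bounds f on Im > ε / 2, and Cauchy's estimate on discs of radius ε / 2 makes
the shift Lipschitz. Shifts therefore satisfy the assumptions of the maximum principle. -/
theorem MemHardy.exists_shift_bound {p : ℝ≥0∞} (hp1 : 1 ≤ p) {f : ℂ → ℂ} (hf : MemHardy p f)
    {ε : ℝ} (hε : 0 < ε) :
    ∃ M : ℝ, (∀ z : ℂ, 0 ≤ z.im → ‖f (z + ε * Complex.I)‖ ≤ M) ∧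
      UniformContinuousOn (fun z : ℂ => f (z + ε * Complex.I)) {z | 0 ≤ z.im} := by
  obtain ⟨C, hC, hCb⟩ := hf.exists_norm_le hp1
  set M : ℝ := C * (ε / 2) ^ (-(p⁻¹).toReal) with hM
  have hb : ∀ w : ℂ, ε / 2 < w.im → ‖f w‖ ≤ M := fun w hw => by
    refine (hCb w (by linarith)).trans ?_
    have : w.im ^ (-(p⁻¹).toReal) ≤ (ε / 2) ^ (-(p⁻¹).toReal) :=
      Real.rpow_le_rpow_of_nonpos (by positivity) hw.le (neg_nonpos.2 ENNReal.toReal_nonneg)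
    rw [hM]; gcongr
  have him : ∀ z : ℂ, (z + ε * Complex.I).im = z.im + ε := fun z => by simp
  refine ⟨M, fun z hz => hb _ (by rw [him]; linarith), ?_⟩
  have hM0 : 0 ≤ M := by positivity
  have hsub : ∀ z : ℂ, 0 ≤ z.im → Metric.ball (z + ε * Complex.I) (ε / 2) ⊆ {w : ℂ | ε / 2 < w.im} := by
    intro z hz w hw
    have h1 : |(w - (z + ε * Complex.I)).im| < ε / 2 :=
      (Complex.abs_im_le_norm _).trans_lt (by simpa [dist_eq_norm] using hw)
    rw [Complex.sub_im, him, abs_lt] at h1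
    exact mem_ofPred_eq ▸ (by linarith : ε / 2 < w.im)
  have hd : ∀ z : ℂ, 0 ≤ z.im → HasDerivAt (fun z : ℂ => f (z + ε * Complex.I))
      (deriv f (z + ε * Complex.I)) z := by
    intro z hz
    have h1 : DifferentiableAt ℂ f (z + ε * Complex.I) :=
      hf.1.differentiableAt (UpperHalfPlane.isOpen_upperHalfPlaneSet.mem_nhds
        (mem_upperHalfPlaneSet.2 (by rw [him]; linarith)))
    simpa using h1.hasDerivAt.comp_add_const z (ε * Complex.I)
  have hconv : Convex ℝ {z : ℂ | 0 ≤ z.im} := convex_halfSpace_im_ge 0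
  have hlip : LipschitzOnWith (Real.toNNReal (M / (ε / 2))) (fun z : ℂ => f (z + ε * Complex.I))
      {z | 0 ≤ z.im} := by
    refine hconv.lipschitzOnWith_of_nnnorm_hasDerivWithin_le
      (fun z hz => (hd z hz).hasDerivWithinAt) fun z hz => ?_
    rw [← NNReal.coe_le_coe, coe_nnnorm, Real.coe_toNNReal _ (by positivity)]
    refine norm_deriv_le_of_forall_mem_ball (half_pos hε) (hf.1.mono fun w hw => ?_)
      fun w hw => hb w (hsub z hz hw)
    have := hsub z hz hw
    exact mem_upperHalfPlaneSet.2 (by have h2 : ε / 2 < w.im := this; linarith)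
  exact hlip.uniformContinuousOn

theorem differentiableOn_shift {f : ℂ → ℂ}
    (hf : DifferentiableOn ℂ f UpperHalfPlane.upperHalfPlaneSet) {ε : ℝ} (hε : 0 ≤ ε) :
    DifferentiableOn ℂ (fun z : ℂ => f (z + ε * Complex.I)) UpperHalfPlane.upperHalfPlaneSet := by
  refine hf.comp (by fun_prop) fun z hz => ?_
  have : 0 < z.im := hz
  exact mem_upperHalfPlaneSet.2 (by simp; linarith)

theorem MemHardy.memLp_line {p : ℝ≥0∞} (hp0 : p ≠ 0) {f : ℂ → ℂ} (hf : MemHardy p f) {y : ℝ}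
    (hy : 0 < y) : MemLp (line f y) p :=
  ⟨(continuous_line hf.1 hy).aestronglyMeasurable,
    (eLpNorm_line_le_hardyNorm hp0 f hy).trans_lt hf.2⟩

theorem eLpNorm_two_norm_rpow {p : ℝ≥0∞} (g : ℝ → ℂ) :
    eLpNorm (fun x => ‖g x‖ ^ (p.toReal / 2)) 2 volume =
      (∫⁻ x, ‖g x‖ₑ ^ p.toReal) ^ (1 / 2 : ℝ) := by
  rw [eLpNorm_eq_lintegral_rpow_enorm_toReal two_ne_zero ENNReal.ofNat_ne_top, ENNReal.toReal_ofNat]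
  congr 1
  refine lintegral_congr fun x => ?_
  rw [Real.enorm_rpow_of_nonneg (norm_nonneg _) (by positivity), ← ENNReal.rpow_mul,
    div_mul_cancel₀ _ two_ne_zero, enorm_norm]

theorem MemHardy.eLpNorm_two_norm_rpow_line_le {p : ℝ≥0∞} (hp0 : p ≠ 0) (hp : p ≠ ∞) {f : ℂ → ℂ}
    {y : ℝ} (hy : 0 < y) :
    eLpNorm (fun x => ‖line f y x‖ ^ (p.toReal / 2)) 2 volume ≤
      (hardyNorm p f ^ p.toReal) ^ (1 / 2 : ℝ) := by
  rw [eLpNorm_two_norm_rpow]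
  exact ENNReal.rpow_le_rpow (lintegral_line_rpow_le hp0 hp f hy) (by norm_num)

theorem MemHardy.memLp_norm_rpow_line {p : ℝ≥0∞} (hp0 : p ≠ 0) (hp : p ≠ ∞) {f : ℂ → ℂ}
    (hf : MemHardy p f) {y : ℝ} (hy : 0 < y) :
    MemLp (fun x => ‖line f y x‖ ^ (p.toReal / 2)) 2 := by
  refine ⟨((continuous_line hf.1 hy).norm.rpow_const fun x => Or.inr (by positivity)
    ).aestronglyMeasurable, (MemHardy.eLpNorm_two_norm_rpow_line_le hp0 hp hy).trans_lt ?_⟩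
  exact ENNReal.rpow_lt_top_of_nonneg (by norm_num)
    (ENNReal.rpow_lt_top_of_nonneg ENNReal.toReal_nonneg hf.2.ne).ne

/-- The exponent p / 2 turns L^p boundary data into L² data, so that one Hilbert space argument
covers all finite p, including p = 1. -/
theorem MemHardy.norm_rpow_shift_le_poisson {p : ℝ≥0∞} (hp1 : 1 ≤ p) (hp : p ≠ ∞) {f : ℂ → ℂ}
    (hf : MemHardy p f) {ε : ℝ} (hε : 0 < ε) {z : ℂ} (hz : 0 < z.im) :
    ‖f (z + ε * Complex.I)‖ ^ (p.toReal / 2) ≤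
      poisson (fun x => ‖line f ε x‖ ^ (p.toReal / 2)) z := by
  have hp0 : p ≠ 0 := (zero_lt_one.trans_le hp1).ne'
  have hpos := ENNReal.toReal_pos hp0 hp
  obtain ⟨M, hM, hu⟩ := hf.exists_shift_bound hp1 hε
  have hM0 : 0 ≤ M := (norm_nonneg _).trans (hM 0 (by simp))
  refine le_poisson_of_subMean (U := fun z => ‖f (z + ε * Complex.I)‖ ^ (p.toReal / 2))
    (M := M ^ (p.toReal / 2)) ?_ (fun z hz => ?_) (fun z hz => ?_)
    (hf.memLp_norm_rpow_line hp0 hp hε) hz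
  · have h1 : UniformContinuousOn (fun t : ℝ => t ^ (p.toReal / 2)) (Icc 0 M) :=
      isCompact_Icc.uniformContinuousOn_of_continuous
        (Real.continuous_rpow_const (by positivity)).continuousOn
    have h2 : UniformContinuousOn (fun z : ℂ => ‖f (z + ε * Complex.I)‖) {z | 0 ≤ z.im} :=
      uniformContinuous_norm.comp_uniformContinuousOn hu
    exact h1.comp h2 fun z hz => ⟨norm_nonneg _, hM z hz⟩
  · rw [abs_of_nonneg (by positivity)]
    exact Real.rpow_le_rpow (norm_nonneg _) (hM z hz) (by positivity)
  · exact eventually_norm_rpow_le_circleAverage (differentiableOn_shift hf.1 hε.le)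
      (by positivity) hz

theorem integrable_pkernel_smul {E : Type*} [NormedAddCommGroup E] [NormedSpace ℝ E] {h : ℝ → E}
    (hh : MemLp h 2) {z : ℂ} (hz : 0 < z.im) : Integrable fun s => pkernel z s • h s :=
  memLp_one_iff_integrable.1 (hh.smul (memLp_two_pkernel hz))

theorem re_mul_poisson {h : ℝ → ℂ} (hh : MemLp h 2) (c : ℂ) {z : ℂ} (hz : 0 < z.im) :
    (c * poisson h z).re = poisson (fun s => (c * h s).re) z := by
  rw [poisson, ← integral_const_mul]
  refine (integral_re ((integrable_pkernel_smul hh hz).const_mul c)).symm.trans ?_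
  refine integral_congr_ae (Eventually.of_forall fun s => ?_)
  simp
  ring

/-- Domination by the Poisson extension applies to Re (c f) for every complex c, since its mean
values are exact; all these inequalities together force equality. -/
theorem MemHardy.shift_eq_poisson {f : ℂ → ℂ} (hf : MemHardy 2 f) {ε : ℝ} (hε : 0 < ε) {z : ℂ}
    (hz : 0 < z.im) : f (z + ε * Complex.I) = poisson (line f ε) z := by
  have hline := hf.memLp_line two_ne_zero hε
  obtain ⟨M, hM, hu⟩ := hf.exists_shift_bound one_le_two hε
  have key : ∀ c : ℂ, (c * f (z + ε * Complex.I)).re ≤ (c * poisson (line f ε) z).re := by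
    intro c
    rw [re_mul_poisson hline c hz]
    refine le_poisson_of_subMean (U := fun z => (c * f (z + ε * Complex.I)).re)
      (M := ‖c‖ * M) ?_ (fun z hz => ?_) (fun z hz => ?_) ?_ hz
    · have h1 : UniformContinuous fun w : ℂ => (c * w).re :=
        (Complex.reCLM.comp (ContinuousLinearMap.mul ℝ ℂ c)).uniformContinuous
      exact h1.comp_uniformContinuousOn hu
    · refine (Complex.abs_re_le_norm _).trans ?_
      rw [norm_mul]
      exact mul_le_mul_of_nonneg_left (hM z hz) (norm_nonneg _)
    · filter_upwards [eventually_nhdsWithin_of_eventually_nhds (gt_mem_nhds hz),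
        self_mem_nhdsWithin] with r hr hr0
      exact (circleAverage_re_eq ((differentiableOn_shift hf.1 hε.le).const_mul c) hr0 hr).ge
    · exact (hline.const_mul c).re
  set d := f (z + ε * Complex.I) - poisson (line f ε) z with hd
  -- With c the conjugate of the difference d, the inequality reads |d|² ≤ 0.
  have h2 := key (starRingEnd ℂ d)
  have h3 : (starRingEnd ℂ d * d).re ≤ 0 := by
    rw [hd, mul_sub, Complex.sub_re, ← hd]; linarith
  rw [← Complex.normSq_eq_conj_mul_self, Complex.ofReal_re] at h3
  exact sub_eq_zero.1 (Complex.normSq_eq_zero.1 (le_antisymm h3 (Complex.normSq_nonneg d)))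

/-! ### Weak limits in `L²` -/

/-- Banach–Alaoglu along a free ultrafilter, which replaces the extraction of a subsequence; the
limit is represented by Riesz. -/
theorem exists_weak_limit {h : ℕ → ℝ → ℂ} (hh : ∀ n, MemLp (h n) 2) {C : ℝ≥0∞} (hC : C ≠ ∞)
    (hb : ∀ n, eLpNorm (h n) 2 volume ≤ C) :
    ∃ (l : Filter ℕ) (w : ℝ → ℂ), l.NeBot ∧ l ≤ atTop ∧ MemLp w 2 ∧
      ∀ k : ℝ → ℝ, MemLp k 2 → Tendsto (fun n => ∫ s, k s • h n s) l (𝓝 (∫ s, k s • w s)) := by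
  set v : ℕ → Lp ℂ 2 (volume : Measure ℝ) := fun n => (hh n).toLp (h n) with hv
  set Φ : ℕ → WeakDual ℂ (Lp ℂ 2 (volume : Measure ℝ)) := fun n =>
    StrongDual.toWeakDual (InnerProductSpace.toDual ℂ _ (v n)) with hΦ
  have hK := WeakDual.isCompact_closedBall (𝕜 := ℂ) (E := Lp ℂ 2 (volume : Measure ℝ)) 0 C.toReal
  set 𝒰 : Ultrafilter ℕ := hyperfilter ℕ with h𝒰
  obtain ⟨x, -, hx⟩ := hK.ultrafilter_le_nhds (𝒰.map Φ) (by
    rw [Ultrafilter.coe_map, Filter.le_principal_iff, Filter.mem_map]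
    refine Filter.univ_mem' fun n => ?_
    simp only [mem_preimage, hΦ, Metric.mem_closedBall, dist_zero_right]
    refine (LinearIsometryEquiv.norm_map (InnerProductSpace.toDual ℂ _) (v n)).le.trans ?_
    rw [hv, Lp.norm_toLp]
    exact ENNReal.toReal_mono hC (hb n))
  set w : Lp ℂ 2 (volume : Measure ℝ) :=
    (InnerProductSpace.toDual ℂ _).symm (WeakDual.toStrongDual x) with hw
  refine ⟨𝒰, w, inferInstance, ?_, Lp.memLp w, fun k hk => ?_⟩
  · rw [h𝒰, ← Nat.cofinite_eq_atTop]; exact hyperfilter_le_cofinite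
  have hk' : MemLp (fun s => (k s : ℂ)) 2 := hk.ofReal
  -- The inner product is conjugate-linear in u, hence the outer conjugation; k is real and is
  -- unaffected.
  have hform : ∀ (u : Lp ℂ 2 (volume : Measure ℝ)) (u' : ℝ → ℂ), u =ᵐ[volume] u' →
      starRingEnd ℂ (inner ℂ u (hk'.toLp _)) = ∫ s, k s • u' s := by
    intro u u' hu
    rw [L2.inner_def, ← integral_conj]
    refine integral_congr_ae ?_
    filter_upwards [hu, hk'.coeFn_toLp] with s h1 h2
    rw [h1, h2]
    simp
  have hev : Tendsto (fun n => Φ n (hk'.toLp _)) 𝒰 (𝓝 (x (hk'.toLp _))) :=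
    ((WeakDual.eval_continuous (hk'.toLp _)).tendsto x).comp hx
  have hconj := (Complex.continuous_conj.tendsto _).comp hev
  have e1 : starRingEnd ℂ (x (hk'.toLp _)) = ∫ s, k s • w s := by
    rw [← hform w w EventuallyEq.rfl]
    congr 1
    rw [hw, InnerProductSpace.toDual_symm_apply]
    rfl
  rw [e1] at hconj
  refine hconj.congr fun n => ?_
  rw [← hform (v n) (h n) ((hh n).coeFn_toLp)]
  rfl

theorem tendsto_shift {f : ℂ → ℂ} (hf : DifferentiableOn ℂ f UpperHalfPlane.upperHalfPlaneSet)
    {z : ℂ} (hz : 0 < z.im) {ι : Type*} {l : Filter ι} {ε : ι → ℝ} (hε : Tendsto ε l (𝓝 0)) :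
    Tendsto (fun n => f (z + ε n * Complex.I)) l (𝓝 (f z)) := by
  have h1 : ContinuousAt f z := hf.continuousOn.continuousAt
    (UpperHalfPlane.isOpen_upperHalfPlaneSet.mem_nhds hz)
  have h2 : Tendsto (fun n => z + ε n * Complex.I) l (𝓝 (z + (0 : ℝ) * Complex.I)) :=
    (((Complex.continuous_ofReal.tendsto 0).comp hε).mul_const _).const_add _
  rw [Complex.ofReal_zero, zero_mul, add_zero] at h2
  exact h1.tendsto.comp h2

/-- A function in `H²` is the Poisson extension of a square integrable function. -/
theorem MemHardy.exists_eq_poisson {f : ℂ → ℂ} (hf : MemHardy 2 f) :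
    ∃ g : ℝ → ℂ, MemLp g 2 ∧ ∀ z : ℂ, 0 < z.im → f z = poisson g z := by
  have hpos : ∀ n : ℕ, (0 : ℝ) < 1 / ((n : ℝ) + 1) := fun n => Nat.one_div_pos_of_nat
  obtain ⟨l, g, hl, hle, hg, hlim⟩ := exists_weak_limit
    (h := fun n : ℕ => line f (1 / ((n : ℝ) + 1)))
    (fun n => hf.memLp_line two_ne_zero (hpos n)) hf.2.ne
    (fun n => eLpNorm_line_le_hardyNorm two_ne_zero f (hpos n))
  refine ⟨g, hg, fun z hz => ?_⟩
  have h1 := tendsto_shift hf.1 hz (tendsto_one_div_add_atTop_nhds_zero_nat.mono_left hle)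
  have h2 := hlim _ (memLp_two_pkernel hz)
  exact tendsto_nhds_unique (h1.congr fun n => hf.shift_eq_poisson (hpos n) hz) h2

/-- The power `p / 2` of the modulus of a function in `H^p` has a square integrable Poisson
majorant. -/
theorem MemHardy.exists_norm_rpow_le_poisson {p : ℝ≥0∞} (hp1 : 1 ≤ p) (hp : p ≠ ∞) {f : ℂ → ℂ}
    (hf : MemHardy p f) :
    ∃ w : ℝ → ℝ, MemLp w 2 ∧ ∀ z : ℂ, 0 < z.im → ‖f z‖ ^ (p.toReal / 2) ≤ poisson w z := by
  have hp0 : p ≠ 0 := (zero_lt_one.trans_le hp1).ne'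
  have hpos : ∀ n : ℕ, (0 : ℝ) < 1 / ((n : ℝ) + 1) := fun n => Nat.one_div_pos_of_nat
  have hC : (hardyNorm p f ^ p.toReal) ^ (1 / 2 : ℝ) ≠ ∞ :=
    (ENNReal.rpow_lt_top_of_nonneg (by norm_num)
      (ENNReal.rpow_lt_top_of_nonneg ENNReal.toReal_nonneg hf.2.ne).ne).ne
  have hmem := fun n : ℕ => hf.memLp_norm_rpow_line hp0 hp (hpos n)
  obtain ⟨l, g, hl, hle, hg, hlim⟩ := exists_weak_limit
    (h := fun (n : ℕ) x => ((‖line f (1 / ((n : ℝ) + 1)) x‖ ^ (p.toReal / 2) : ℝ) : ℂ))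
    (fun n => (hmem n).ofReal) hC
    (fun n => (eLpNorm_congr_norm_ae (Eventually.of_forall fun x => by simp)).trans_le
      (MemHardy.eLpNorm_two_norm_rpow_line_le hp0 hp (f := f) (hpos n)))
  refine ⟨fun s => (g s).re, hg.re, fun z hz => ?_⟩
  have h1 := ((tendsto_shift hf.1 hz (tendsto_one_div_add_atTop_nhds_zero_nat.mono_left hle)).norm
    ).rpow_const (p := p.toReal / 2) (Or.inr (by positivity))
  have h2 := (Complex.continuous_re.tendsto _).comp (hlim _ (memLp_two_pkernel hz))
  have h3 : (∫ s, pkernel z s • g s).re = poisson (fun s => (g s).re) z := by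
    have := re_mul_poisson hg 1 hz
    simpa [poisson] using this
  rw [h3] at h2
  refine le_of_tendsto_of_tendsto' h1 h2 fun n => ?_
  refine (hf.norm_rpow_shift_le_poisson hp1 hp (hpos n) hz).trans (le_of_eq ?_)
  have := re_mul_poisson (hmem n).ofReal 1 hz
  simp only [one_mul] at this
  exact this.symm

/-! ### Existence of boundary values -/

/-- Since |x + iy + i| ≥ |x - i| for y > 0, every horizontal line is dominated by one fixed L²
function. -/
theorem memHardy_two_of_bounded {f : ℂ → ℂ}
    (hf : DifferentiableOn ℂ f UpperHalfPlane.upperHalfPlaneSet) {M : ℝ}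
    (hM : ∀ z : ℂ, 0 < z.im → ‖f z‖ ≤ M) : MemHardy 2 fun z => f z * (z + Complex.I)⁻¹ := by
  have hne : ∀ z : ℂ, 0 < z.im → z + Complex.I ≠ 0 := fun z hz h => by
    have := congrArg Complex.im h
    simp at this; linarith
  refine ⟨fun z hz => ?_, ?_⟩
  · refine (hf z hz).mul (DifferentiableAt.differentiableWithinAt ?_)
    have := hne z hz
    fun_prop (disch := assumption)
  have hI : MemLp (fun s : ℝ => ((s : ℂ) - Complex.I)⁻¹) 2 :=
    memLp_two_inv_ofReal_sub (by simp)
  refine lt_of_le_of_lt (hardyNorm_le two_ne_zero ENNReal.ofNat_ne_top fun y hy => ?_)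
    (hI.const_mul (M : ℂ)).2
  refine eLpNorm_mono fun x => ?_
  have hM0 : 0 ≤ M := (norm_nonneg _).trans (hM Complex.I (by simp))
  have h1 : 0 < ‖(x : ℂ) - Complex.I‖ := norm_pos_iff.2 fun h => by
    have := congrArg Complex.im h
    simp at this
  have h2 : ‖(x : ℂ) - Complex.I‖ ≤ ‖(x : ℂ) + y * Complex.I + Complex.I‖ := by
    refine le_of_sq_le_sq ?_ (norm_nonneg _)
    rw [← Complex.normSq_eq_norm_sq, ← Complex.normSq_eq_norm_sq, Complex.normSq_apply,
      Complex.normSq_apply]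
    simp
    nlinarith
  simp only [line, norm_mul, norm_inv, Complex.norm_real, Real.norm_of_nonneg hM0]
  gcongr
  exact hM _ (by rwa [add_mul_I_im])

theorem ae_exists_tendsto_of_bounded {f : ℂ → ℂ}
    (hf : DifferentiableOn ℂ f UpperHalfPlane.upperHalfPlaneSet) {M : ℝ}
    (hM : ∀ z : ℂ, 0 < z.im → ‖f z‖ ≤ M) :
    ∀ᵐ x : ℝ, ∃ l : ℂ, Tendsto (fun y : ℝ => f ((x : ℂ) + (y : ℂ) * Complex.I)) (𝓝[>] 0) (𝓝 l) := by
  obtain ⟨g, hg, hgf⟩ := (memHardy_two_of_bounded hf hM).exists_eq_poisson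
  filter_upwards [ae_tendsto_poisson hg] with x hx
  have h1 : Tendsto (fun y : ℝ => (x : ℂ) + (y : ℂ) * Complex.I + Complex.I) (𝓝[>] 0)
      (𝓝 ((x : ℂ) + ((0 : ℝ) : ℂ) * Complex.I + Complex.I)) :=
    (Continuous.tendsto (by fun_prop) 0).mono_left nhdsWithin_le_nhds
  refine ⟨_, (hx.mul h1).congr' ?_⟩
  filter_upwards [self_mem_nhdsWithin] with y hy
  have hy' : (0 : ℝ) < y := hy
  rw [← hgf _ (by rwa [add_mul_I_im]), mul_assoc, inv_mul_cancel₀, mul_one]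
  intro h
  have := congrArg Complex.im h
  simp at this; linarith

/-- Used with t = P[w](z) and s = 2 / p: from |f| ≤ P[w]^(2/p) it bounds f exp(-H) when Re H = P[w].
-/
theorem rpow_mul_exp_neg_le {t s : ℝ} (ht : 0 ≤ t) (hs0 : 0 ≤ s) (hs : s ≤ 2) :
    t ^ s * Real.exp (-t) ≤ 2 := by
  have h1 : t ^ s ≤ 1 + t ^ 2 := by
    rcases le_total t 1 with h | h
    · have := Real.rpow_le_one ht h hs0
      nlinarith [sq_nonneg t]
    · have := Real.rpow_le_rpow_of_exponent_le h hs
      rw [Real.rpow_ofNat] at this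
      linarith
  have h2 := Real.quadratic_le_exp_of_nonneg ht
  rw [Real.exp_neg, ← div_eq_mul_inv, div_le_iff₀ (Real.exp_pos t)]
  linarith

/-- For p < ∞, f is the quotient of the bounded functions f exp(-H) and exp(-H). The limit of the
denominator is nonzero because its modulus exp(-P[w]) tends to exp(-w(x)). -/
theorem MemHardy.ae_exists_tendsto {p : ℝ≥0∞} (hp1 : 1 ≤ p) {f : ℂ → ℂ} (hf : MemHardy p f) :
    ∀ᵐ x : ℝ, ∃ l : ℂ, Tendsto (fun y : ℝ => f ((x : ℂ) + (y : ℂ) * Complex.I)) (𝓝[>] 0) (𝓝 l) := by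
  by_cases hp : p = ∞
  · subst hp
    obtain ⟨C, -, hC⟩ := hf.exists_norm_le hp1
    exact ae_exists_tendsto_of_bounded hf.1 (M := C) fun z hz => by simpa using hC z hz
  have hp0 : p ≠ 0 := (zero_lt_one.trans_le hp1).ne'
  have hp1' : 1 ≤ p.toReal := by
    simpa using ENNReal.toReal_mono hp hp1
  obtain ⟨w, hw, hwf⟩ := hf.exists_norm_rpow_le_poisson hp1 hp
  set H : ℂ → ℂ := schwarz fun s => (w s : ℂ) with hH
  have hHd : DifferentiableOn ℂ H UpperHalfPlane.upperHalfPlaneSet :=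
    differentiableOn_schwarz hw.ofReal
  have hHn : ∀ z : ℂ, 0 < z.im → ‖Complex.exp (-H z)‖ = Real.exp (-poisson w z) := fun z hz => by
    rw [Complex.norm_exp, Complex.neg_re, hH, re_schwarz hw hz]
  have hP0 : ∀ z : ℂ, 0 < z.im → 0 ≤ poisson w z := fun z hz =>
    (by positivity : (0 : ℝ) ≤ ‖f z‖ ^ (p.toReal / 2)).trans (hwf z hz)
  have h1 := ae_exists_tendsto_of_bounded (f := fun z => Complex.exp (-H z)) hHd.neg.cexp (M := 1)
    fun z hz => by
      rw [hHn z hz, Real.exp_le_one_iff, neg_nonpos]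
      exact hP0 z hz
  have h2 := ae_exists_tendsto_of_bounded (f := fun z => f z * Complex.exp (-H z))
    (hf.1.mul hHd.neg.cexp) (M := 2) fun z hz => by
      rw [norm_mul, hHn z hz]
      refine le_trans ?_ (rpow_mul_exp_neg_le (hP0 z hz) (s := 2 / p.toReal) (by positivity) ?_)
      · gcongr
        have h3 := Real.rpow_le_rpow (by positivity) (hwf z hz)
          (show (0 : ℝ) ≤ 2 / p.toReal by positivity)
        rwa [← Real.rpow_mul (norm_nonneg _), div_mul_div_cancel₀ two_ne_zero,
          div_self (by positivity), Real.rpow_one] at h3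
      · rw [div_le_iff₀ (by linarith)]; linarith
  filter_upwards [h1, h2, ae_tendsto_poisson hw] with x hx1 hx2 hx3
  obtain ⟨l₁, hl₁⟩ := hx1
  obtain ⟨l₂, hl₂⟩ := hx2
  have hne : l₁ ≠ 0 := by
    have h4 : Tendsto (fun y : ℝ => Real.exp (-poisson w ((x : ℂ) + (y : ℂ) * Complex.I)))
        (𝓝[>] 0) (𝓝 (Real.exp (-w x))) := (Real.continuous_exp.tendsto _).comp hx3.neg
    have h5 : ‖l₁‖ = Real.exp (-w x) := by
      refine tendsto_nhds_unique (hl₁.norm.congr' ?_) h4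
      filter_upwards [self_mem_nhdsWithin] with y hy
      exact hHn _ (by rw [add_mul_I_im]; exact hy)
    exact norm_pos_iff.1 (h5 ▸ Real.exp_pos _)
  refine ⟨l₂ / l₁, (hl₂.div hl₁ hne).congr fun y => ?_⟩
  simp only [Pi.div_apply]
  exact mul_div_cancel_right₀ _ (Complex.exp_ne_zero _)

/-- Functions in the Hardy space have boundary values in `L^p`. -/
theorem MemHardy.exists_isBoundaryValue {p : ℝ≥0∞} (hp1 : 1 ≤ p) {f : ℂ → ℂ} (hf : MemHardy p f) :
    ∃ g : ℝ → ℂ, IsBoundaryValue p f g := by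
  have hp0 : p ≠ 0 := (zero_lt_one.trans_le hp1).ne'
  classical
  set g : ℝ → ℂ := fun x => limUnder (𝓝[>] (0 : ℝ))
    fun y : ℝ => f ((x : ℂ) + (y : ℂ) * Complex.I) with hg
  have hlim : ∀ᵐ x : ℝ, Tendsto (fun y : ℝ => f ((x : ℂ) + (y : ℂ) * Complex.I)) (𝓝[>] 0)
      (𝓝 (g x)) := by
    filter_upwards [hf.ae_exists_tendsto hp1] with x hx using tendsto_nhds_limUnder hx
  have hpos : ∀ n : ℕ, (0 : ℝ) < 1 / ((n : ℝ) + 1) := fun n => Nat.one_div_pos_of_nat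
  have hseq : Tendsto (fun n : ℕ => 1 / ((n : ℝ) + 1)) atTop (𝓝[>] 0) :=
    tendsto_nhdsWithin_iff.2 ⟨tendsto_one_div_add_atTop_nhds_zero_nat, Eventually.of_forall hpos⟩
  have hlim' : ∀ᵐ x : ℝ, Tendsto (fun n : ℕ => line f (1 / ((n : ℝ) + 1)) x) atTop (𝓝 (g x)) := by
    filter_upwards [hlim] with x hx using hx.comp hseq
  have hmeas := fun n : ℕ => (hf.memLp_line hp0 (hpos n)).1
  refine ⟨g, ⟨aestronglyMeasurable_of_tendsto_ae atTop hmeas hlim', ?_⟩, hlim⟩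
  -- Lower semicontinuity of the L^p norm under a.e. limits, applied along heights 1 / (n + 1).
  refine (Lp.eLpNorm_lim_le_liminf_eLpNorm hmeas g hlim').trans_lt (lt_of_le_of_lt ?_ hf.2)
  exact liminf_le_of_le (by isBoundedDefault) fun b hb => by
    obtain ⟨n, hn⟩ := hb.exists
    exact hn.trans (eLpNorm_line_le_hardyNorm hp0 f (hpos n))

/-! ### Convergence to the boundary values in mean -/

/-- Dominated convergence with varying majorants: apply Fatou's lemma to A n - B n. -/
theorem tendsto_lintegral_zero_of_le {α : Type*} [MeasurableSpace α] {μ : Measure α}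
    {A B : ℕ → α → ℝ≥0∞} {A' : α → ℝ≥0∞} (hA : ∀ n, AEMeasurable (A n) μ)
    (hB : ∀ n, AEMeasurable (B n) μ) (hBA : ∀ n, ∀ᵐ x ∂μ, B n x ≤ A n x)
    (hAlim : ∀ᵐ x ∂μ, Tendsto (fun n => A n x) atTop (𝓝 (A' x)))
    (hBlim : ∀ᵐ x ∂μ, Tendsto (fun n => B n x) atTop (𝓝 0))
    (hle : ∀ n, ∫⁻ x, A n x ∂μ ≤ ∫⁻ x, A' x ∂μ) (hfin : ∫⁻ x, A' x ∂μ ≠ ∞) :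
    Tendsto (fun n => ∫⁻ x, B n x ∂μ) atTop (𝓝 0) := by
  set J := ∫⁻ x, A' x ∂μ with hJ
  have hBJ : ∀ n, ∫⁻ x, B n x ∂μ ≤ J := fun n => (lintegral_mono_ae (hBA n)).trans (hle n)
  have h1 : J ≤ liminf (fun n => J - ∫⁻ x, B n x ∂μ) atTop := by
    calc J = ∫⁻ x, liminf (fun n => A n x - B n x) atTop ∂μ := by
          refine lintegral_congr_ae ?_
          filter_upwards [hAlim, hBlim] with x hx hx'
          have := ENNReal.Tendsto.sub hx hx' (Or.inr ENNReal.zero_ne_top)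
          rw [tsub_zero] at this
          exact this.liminf_eq.symm
      _ ≤ liminf (fun n => ∫⁻ x, (A n x - B n x) ∂μ) atTop :=
          lintegral_liminf_le' fun n => (hA n).sub (hB n)
      _ ≤ liminf (fun n => J - ∫⁻ x, B n x ∂μ) atTop := by
          refine liminf_le_liminf (Eventually.of_forall fun n => ?_)
          rw [lintegral_sub' (hB n) (ne_top_of_le_ne_top hfin (hBJ n)) (hBA n)]
          exact tsub_le_tsub_right (hle n) _
  have h2 : Tendsto (fun n => J - ∫⁻ x, B n x ∂μ) atTop (𝓝 J) :=
    tendsto_of_le_liminf_of_limsup_le h1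
      (limsup_le_of_le (by isBoundedDefault) (Eventually.of_forall fun n => tsub_le_self))
  have h3 := ENNReal.Tendsto.sub (tendsto_const_nhds (x := J)) h2 (Or.inl hfin)
  rw [tsub_self] at h3
  exact h3.congr fun n => ENNReal.sub_sub_cancel hfin (hBJ n)

/-- The integrand is at most 2^(p-1) (P[w]² + |g|^p). This majorant converges a.e. by Fatou's
theorem, and its integrals do not exceed that of the limit because the Poisson extension contracts
L². -/
theorem MemHardy.tendsto_lintegral_line_sub {p : ℝ≥0∞} (hp1 : 1 ≤ p) (hp : p ≠ ∞) {f : ℂ → ℂ}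
    (hf : MemHardy p f) {g : ℝ → ℂ} (hg : IsBoundaryValue p f g) {y : ℕ → ℝ} (hy0 : ∀ n, 0 < y n)
    (hy : Tendsto y atTop (𝓝 0)) :
    Tendsto (fun n => ∫⁻ x, ‖line f (y n) x - g x‖ₑ ^ p.toReal) atTop (𝓝 0) := by
  have hp0 : p ≠ 0 := (zero_lt_one.trans_le hp1).ne'
  have hpos := ENNReal.toReal_pos hp0 hp
  have hp1' : 1 ≤ p.toReal := by simpa using ENNReal.toReal_mono hp hp1
  obtain ⟨w, hw, hwf⟩ := hf.exists_norm_rpow_le_poisson hp1 hp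
  obtain ⟨φ, hφ, hφP⟩ := differentiableOn_re_poisson hw
  have hys : Tendsto y atTop (𝓝[>] 0) := tendsto_nhdsWithin_iff.2 ⟨hy, Eventually.of_forall hy0⟩
  have him : ∀ n (x : ℝ), 0 < ((x : ℂ) + (y n : ℂ) * Complex.I).im := fun n x => by
    rw [add_mul_I_im]; exact hy0 n
  have hPm : ∀ n, AEMeasurable
      (fun x : ℝ => ‖poisson w ((x : ℂ) + (y n : ℂ) * Complex.I)‖ₑ ^ (2 : ℝ)) volume := by
    intro n
    have h1 : Continuous fun x : ℝ => (line φ (y n) x).re :=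
      Complex.continuous_re.comp (continuous_line hφ (hy0 n))
    have h2 : (fun x : ℝ => poisson w ((x : ℂ) + (y n : ℂ) * Complex.I)) =
        fun x : ℝ => (line φ (y n) x).re := funext fun x => (hφP _ (him n x)).symm
    have h3 : Continuous fun x : ℝ => poisson w ((x : ℂ) + (y n : ℂ) * Complex.I) := h2 ▸ h1
    exact h3.aemeasurable.enorm.pow_const _
  set c : ℝ≥0∞ := 2 ^ (p.toReal - 1) with hc
  have hcfin : c ≠ ∞ := ENNReal.rpow_ne_top_of_nonneg (by linarith) ENNReal.ofNat_ne_top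
  have hgm : AEMeasurable (fun x => ‖g x‖ₑ ^ p.toReal) volume := hg.1.1.enorm.pow_const _
  have hsplit : ∀ u : ℝ → ℝ≥0∞, ∫⁻ x, c * (u x + ‖g x‖ₑ ^ p.toReal) =
      c * ((∫⁻ x, u x) + ∫⁻ x, ‖g x‖ₑ ^ p.toReal) := fun u => by
    rw [lintegral_const_mul' _ _ hcfin, lintegral_add_right' _ hgm]
  refine tendsto_lintegral_zero_of_le
    (A := fun n (x : ℝ) => c * (‖poisson w ((x : ℂ) + (y n : ℂ) * Complex.I)‖ₑ ^ (2 : ℝ) +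
      ‖g x‖ₑ ^ p.toReal)) (A' := fun x : ℝ => c * (‖w x‖ₑ ^ (2 : ℝ) + ‖g x‖ₑ ^ p.toReal))
    (fun n => ((hPm n).add hgm).const_mul c) (fun n => ?_) (fun n => ?_) ?_ ?_ (fun n => ?_) ?_
  · exact ((continuous_line hf.1 (hy0 n)).aestronglyMeasurable.sub hg.1.1).enorm.pow_const _
  · refine Eventually.of_forall fun x => ?_
    have h1 : ‖line f (y n) x‖ₑ ^ p.toReal ≤
        ‖poisson w ((x : ℂ) + (y n : ℂ) * Complex.I)‖ₑ ^ (2 : ℝ) := by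
      have h2 := hwf _ (him n x)
      have h3 : ‖line f (y n) x‖ₑ ^ (p.toReal / 2) ≤
          ‖poisson w ((x : ℂ) + (y n : ℂ) * Complex.I)‖ₑ := by
        rw [← enorm_norm (line f (y n) x), ← Real.enorm_rpow_of_nonneg (norm_nonneg _)
          (by positivity)]
        refine enorm_le_iff_norm_le.2 ?_
        rw [Real.norm_of_nonneg (by positivity)]
        exact h2.trans (le_abs_self _)
      have h4 := ENNReal.rpow_le_rpow h3 (show (0 : ℝ) ≤ 2 by norm_num)
      rwa [← ENNReal.rpow_mul, div_mul_cancel₀ _ two_ne_zero] at h4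
    calc ‖line f (y n) x - g x‖ₑ ^ p.toReal ≤ (‖line f (y n) x‖ₑ + ‖g x‖ₑ) ^ p.toReal :=
          ENNReal.rpow_le_rpow enorm_sub_le hpos.le
      _ ≤ c * (‖line f (y n) x‖ₑ ^ p.toReal + ‖g x‖ₑ ^ p.toReal) :=
          ENNReal.rpow_add_le_mul_rpow_add_rpow _ _ hp1'
      _ ≤ _ := by gcongr
  · filter_upwards [ae_tendsto_poisson hw] with x hx
    have h1 := ((hx.comp hys).enorm).ennrpow_const (2 : ℝ)
    exact ENNReal.Tendsto.const_mul (h1.add_const _) (Or.inr hcfin)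
  · filter_upwards [hg.2] with x hx
    have h1 : Tendsto (fun n => line f (y n) x - g x) atTop (𝓝 (g x - g x)) :=
      (hx.comp hys).sub_const _
    rw [sub_self] at h1
    have h2 := h1.enorm.ennrpow_const p.toReal
    rwa [enorm_zero, ENNReal.zero_rpow_of_pos hpos] at h2
  · rw [hsplit, hsplit]
    exact mul_le_mul' le_rfl (add_le_add (lintegral_poisson_sq_le hw (hy0 n)) le_rfl)
  · rw [hsplit]
    refine ENNReal.mul_ne_top hcfin (ENNReal.add_ne_top.2 ⟨?_, ?_⟩)
    · have := lintegral_rpow_enorm_lt_top_of_eLpNorm_lt_top two_ne_zero ENNReal.ofNat_ne_top hw.2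
      rw [ENNReal.toReal_ofNat] at this
      exact this.ne
    · exact (lintegral_rpow_enorm_lt_top_of_eLpNorm_lt_top hp0 hp hg.1.2).ne

/-! ### The operators as superpositions of normalised dilations -/

/-- The measure `t ^ (-1/p) a(t) dt` on `(0, ∞)`. -/
noncomputable def kernelMeasure (p : ℝ≥0∞) (a : ℝ → ℝ) : Measure ℝ :=
  (volume.restrict (Ioi 0)).withDensity fun t => ENNReal.ofReal (t ^ (-(p⁻¹).toReal) * a t)

theorem kernelMeasure_univ (p : ℝ≥0∞) (a : ℝ → ℝ) :
    kernelMeasure p a univ = kernelIntegral p a := by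
  rw [kernelMeasure, withDensity_apply _ MeasurableSet.univ, Measure.restrict_univ, kernelIntegral]

theorem kernelMeasure_absolutelyContinuous (p : ℝ≥0∞) (a : ℝ → ℝ) :
    kernelMeasure p a ≪ volume.restrict (Ioi 0) := withDensity_absolutelyContinuous _ _

theorem ae_kernelMeasure_pos (p : ℝ≥0∞) (a : ℝ → ℝ) : ∀ᵐ t ∂kernelMeasure p a, 0 < t :=
  (kernelMeasure_absolutelyContinuous p a).ae_le (ae_restrict_mem measurableSet_Ioi)

section
variable {p : ℝ≥0∞} {a : ℝ → ℝ}

theorem aemeasurable_kernelDensity (ha : AEMeasurable a (volume.restrict (Ioi (0 : ℝ)))) :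
    AEMeasurable (fun t => ENNReal.ofReal (t ^ (-(p⁻¹).toReal) * a t))
      (volume.restrict (Ioi (0 : ℝ))) :=
  ((measurable_id.pow_const _).aemeasurable.mul ha).ennreal_ofReal

theorem toReal_kernelDensity_smul (hn : ∀ t : ℝ, 0 < t → 0 ≤ a t) (Φ : ℝ → ℂ) {t : ℝ} (ht : 0 < t) :
    (ENNReal.ofReal (t ^ (-(p⁻¹).toReal) * a t)).toReal • (t ^ (p⁻¹).toReal • Φ t) =
      Φ t * (a t : ℂ) := by
  have h1 := hn t ht
  rw [ENNReal.toReal_ofReal (by positivity), smul_smul, mul_right_comm, ← Real.rpow_add ht,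
    neg_add_cancel, Real.rpow_zero, one_mul, Complex.real_smul, mul_comm]

/-- The factor t^(1/p) compensates the weight of the kernel measure. No integrability is needed, as
the two integrands against Lebesgue measure agree pointwise. -/
theorem integral_mul_eq_integral_kernelMeasure
    (ha : AEMeasurable a (volume.restrict (Ioi (0 : ℝ)))) (hn : ∀ t : ℝ, 0 < t → 0 ≤ a t)
    (Φ : ℝ → ℂ) :
    ∫ t in Ioi (0 : ℝ), Φ t * (a t : ℂ) = ∫ t, t ^ (p⁻¹).toReal • Φ t ∂kernelMeasure p a := by
  rw [kernelMeasure, integral_withDensity_eq_integral_toReal_smul₀ (aemeasurable_kernelDensity ha)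
    (Eventually.of_forall fun _ => ENNReal.ofReal_lt_top)]
  exact setIntegral_congr_fun measurableSet_Ioi fun t ht => (toReal_kernelDensity_smul hn Φ ht).symm

theorem integrableOn_mul_iff (ha : AEMeasurable a (volume.restrict (Ioi (0 : ℝ))))
    (hn : ∀ t : ℝ, 0 < t → 0 ≤ a t) (Φ : ℝ → ℂ) :
    IntegrableOn (fun t => Φ t * (a t : ℂ)) (Ioi 0) ↔
      Integrable (fun t => t ^ (p⁻¹).toReal • Φ t) (kernelMeasure p a) := by
  rw [kernelMeasure, integrable_withDensity_iff_integrable_smul₀' (aemeasurable_kernelDensity ha)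
    (Eventually.of_forall fun _ => ENNReal.ofReal_lt_top)]
  exact integrableOn_congr_fun (fun t ht => (toReal_kernelDensity_smul hn Φ ht).symm)
    measurableSet_Ioi

theorem lintegral_enorm_superposition_rpow_le {ν : Measure ℝ} [IsFiniteMeasure ν] {Φ : ℝ → ℝ → ℂ}
    (hΦ : AEStronglyMeasurable (Function.uncurry Φ) ((volume : Measure ℝ).prod ν)) {s : ℝ}
    (hs : 1 ≤ s) :
    ∫⁻ x, ‖∫ t, Φ x t ∂ν‖ₑ ^ s ≤ ν univ ^ (s - 1) * ∫⁻ t, (∫⁻ x, ‖Φ x t‖ₑ ^ s) ∂ν :=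
  (lintegral_mono fun x => ENNReal.rpow_le_rpow (enorm_integral_le_lintegral_enorm _)
    (by linarith)).trans (lintegral_lintegral_rpow_le (Φ := fun x t => ‖Φ x t‖ₑ) hΦ.enorm hs)

/-- The factor t^(1/p) exactly cancels the Jacobian: normalised dilations are isometries of L^p. -/
theorem lintegral_dilation_rpow (hp0 : p ≠ 0) (hp : p ≠ ∞) (h : ℝ → ℂ) {t : ℝ} (ht : 0 < t) :
    ∫⁻ x, ‖t ^ (p⁻¹).toReal • h (t * x)‖ₑ ^ p.toReal = ∫⁻ x, ‖h x‖ₑ ^ p.toReal := by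
  have hpos := ENNReal.toReal_pos hp0 hp
  have h1 : ‖t ^ (p⁻¹).toReal‖ₑ ^ p.toReal = ENNReal.ofReal t := by
    rw [Real.enorm_of_nonneg (by positivity), ENNReal.ofReal_rpow_of_nonneg (by positivity) hpos.le,
      ← Real.rpow_mul ht.le, ENNReal.toReal_inv, inv_mul_cancel₀ hpos.ne', Real.rpow_one]
  simp_rw [enorm_smul, ENNReal.mul_rpow_of_nonneg _ _ hpos.le, h1]
  rw [lintegral_const_mul' _ _ ENNReal.ofReal_ne_top,
    lintegral_comp_mul_left ht fun x => ‖h x‖ₑ ^ p.toReal, ← mul_assoc,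
    ← ENNReal.ofReal_mul ht.le, mul_inv_cancel₀ ht.ne', ENNReal.ofReal_one, one_mul]

/-- The weighted dilate of a function on the half-plane, restricted to a horizontal line. -/
theorem dilation_line_eq (f : ℂ → ℂ) (t x y : ℝ) :
    f ((t : ℂ) * ((x : ℂ) + (y : ℂ) * Complex.I)) = line f (t * y) (t * x) := by
  rw [line]; congr 1; push_cast; ring

theorem prod_kernelMeasure_absolutelyContinuous [SFinite (kernelMeasure p a)] :
    (volume : Measure ℝ).prod (kernelMeasure p a) ≪
      (volume : Measure (ℝ × ℝ)).restrict (univ ×ˢ Ioi 0) := by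
  rw [Measure.volume_eq_prod, ← Measure.prod_restrict, Measure.restrict_univ]
  exact Measure.AbsolutelyContinuous.rfl.prod (kernelMeasure_absolutelyContinuous p a)

theorem aestronglyMeasurable_dilation [SFinite (kernelMeasure p a)] {f : ℂ → ℂ}
    (hf : DifferentiableOn ℂ f UpperHalfPlane.upperHalfPlaneSet) {y : ℝ} (hy : 0 < y) (σ : ℝ) :
    AEStronglyMeasurable (Function.uncurry fun x t : ℝ =>
      t ^ σ • f ((t : ℂ) * ((x : ℂ) + (y : ℂ) * Complex.I)))
      ((volume : Measure ℝ).prod (kernelMeasure p a)) := by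
  refine AEStronglyMeasurable.mono_ac prod_kernelMeasure_absolutelyContinuous
    (ContinuousOn.aestronglyMeasurable ?_ (MeasurableSet.univ.prod measurableSet_Ioi))
  have hmem : ∀ q ∈ (univ : Set ℝ) ×ˢ Ioi (0 : ℝ), 0 < q.2 := fun q hq => hq.2
  refine ContinuousOn.smul (continuousOn_snd.rpow_const fun q hq => Or.inl (hmem q hq).ne')
    (hf.continuousOn.comp (by fun_prop) fun q hq => ?_)
  refine mem_upperHalfPlaneSet.2 ?_
  simpa using mul_pos (hmem q hq) hy

theorem aestronglyMeasurable_dilation_apply {f : ℂ → ℂ}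
    (hf : DifferentiableOn ℂ f UpperHalfPlane.upperHalfPlaneSet) {z : ℂ} (hz : 0 < z.im) (σ : ℝ) :
    AEStronglyMeasurable (fun t : ℝ => t ^ σ • f ((t : ℂ) * z)) (kernelMeasure p a) := by
  refine AEStronglyMeasurable.mono_ac (kernelMeasure_absolutelyContinuous p a)
    (ContinuousOn.aestronglyMeasurable ?_ measurableSet_Ioi)
  refine ContinuousOn.smul (continuousOn_id.rpow_const fun t ht => Or.inl (ne_of_gt ht))
    (hf.continuousOn.comp (by fun_prop) fun t ht => ?_)
  refine mem_upperHalfPlaneSet.2 ?_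
  simpa using mul_pos (mem_Ioi.1 ht) hz

/-- Transfers statements valid for a.e. real number to the points t x, for a.e. x and ν-a.e. t. -/
theorem quasiMeasurePreserving_dilation [SFinite (kernelMeasure p a)] :
    Measure.QuasiMeasurePreserving (fun q : ℝ × ℝ => q.2 * q.1)
      ((volume : Measure ℝ).prod (kernelMeasure p a)) volume := by
  have hm : Measurable fun q : ℝ × ℝ => q.2 * q.1 := by fun_prop
  refine ⟨hm, Measure.AbsolutelyContinuous.mk fun s hs hs0 => ?_⟩
  rw [Measure.map_apply hm hs, Measure.prod_apply_symm (hm hs)]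
  refine lintegral_eq_zero_of_ae_eq_zero ?_
  filter_upwards [ae_kernelMeasure_pos p a] with t ht
  have : (fun x : ℝ => (x, t)) ⁻¹' ((fun q : ℝ × ℝ => q.2 * q.1) ⁻¹' s) = (t * ·) ⁻¹' s := rfl
  rw [this, Pi.zero_apply, Real.volume_preimage_mul_left ht.ne', hs0, mul_zero]

theorem aestronglyMeasurable_real_dilation [SFinite (kernelMeasure p a)] {g : ℝ → ℂ}
    (hg : AEStronglyMeasurable g volume) (σ : ℝ) :
    AEStronglyMeasurable (Function.uncurry fun x t : ℝ => t ^ σ • g (t * x))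
      ((volume : Measure ℝ).prod (kernelMeasure p a)) := by
  have h1 : Measurable fun q : ℝ × ℝ => q.2 ^ σ := measurable_snd.pow_const σ
  exact h1.aestronglyMeasurable.smul
    (hg.comp_quasiMeasurePreserving quasiMeasurePreserving_dilation)

/-! ### Boundedness on the Hardy space -/

/-- The growth bound is invariant under normalised dilations, so for fixed z a constant in t
dominates, integrable for a finite kernel measure. -/
theorem norm_dilation_le {f : ℂ → ℂ} {C σ : ℝ} (hC : ∀ z : ℂ, 0 < z.im → ‖f z‖ ≤ C * z.im ^ (-σ))
    {t : ℝ} (ht : 0 < t) {z : ℂ} (hz : 0 < z.im) :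
    ‖t ^ σ • f ((t : ℂ) * z)‖ ≤ C * z.im ^ (-σ) := by
  have him : ((t : ℂ) * z).im = t * z.im := by simp
  have h1 := hC ((t : ℂ) * z) (by rw [him]; positivity)
  rw [him, Real.mul_rpow ht.le hz.le] at h1
  rw [norm_smul, Real.norm_of_nonneg (by positivity)]
  calc t ^ σ * ‖f ((t : ℂ) * z)‖ ≤ t ^ σ * (C * (t ^ (-σ) * z.im ^ (-σ))) := by gcongr
    _ = (t ^ σ * t ^ (-σ)) * (C * z.im ^ (-σ)) := by ring
    _ = _ := by rw [← Real.rpow_add ht, add_neg_cancel, Real.rpow_zero, one_mul]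

theorem MemHardy.integrable_dilation [IsFiniteMeasure (kernelMeasure p a)] (hp1 : 1 ≤ p)
    {f : ℂ → ℂ} (hf : MemHardy p f) {z : ℂ} (hz : 0 < z.im) :
    Integrable (fun t : ℝ => t ^ (p⁻¹).toReal • f ((t : ℂ) * z)) (kernelMeasure p a) := by
  obtain ⟨C, -, hC⟩ := hf.exists_norm_le hp1
  refine Integrable.of_bound (aestronglyMeasurable_dilation_apply hf.1 hz _)
    (C * z.im ^ (-(p⁻¹).toReal)) ?_
  filter_upwards [ae_kernelMeasure_pos p a] with t ht using norm_dilation_le hC ht hz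

theorem complexS_eq (ha : AEMeasurable a (volume.restrict (Ioi (0 : ℝ))))
    (hn : ∀ t : ℝ, 0 < t → 0 ≤ a t) (f : ℂ → ℂ) (z : ℂ) :
    complexS a f z = ∫ t, t ^ (p⁻¹).toReal • f ((t : ℂ) * z) ∂kernelMeasure p a :=
  integral_mul_eq_integral_kernelMeasure ha hn fun t => f ((t : ℂ) * z)

theorem realS_eq (ha : AEMeasurable a (volume.restrict (Ioi (0 : ℝ))))
    (hn : ∀ t : ℝ, 0 < t → 0 ≤ a t) (g : ℝ → ℂ) (x : ℝ) :
    realS a g x = ∫ t, t ^ (p⁻¹).toReal • g (t * x) ∂kernelMeasure p a :=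
  integral_mul_eq_integral_kernelMeasure ha hn fun t => g (t * x)

theorem MemHardy.differentiableOn_complexS [IsFiniteMeasure (kernelMeasure p a)] (hp1 : 1 ≤ p)
    (ha : AEMeasurable a (volume.restrict (Ioi (0 : ℝ)))) (hn : ∀ t : ℝ, 0 < t → 0 ≤ a t)
    {f : ℂ → ℂ} (hf : MemHardy p f) :
    DifferentiableOn ℂ (complexS a f) UpperHalfPlane.upperHalfPlaneSet := by
  obtain ⟨C, hC0, hC⟩ := hf.exists_norm_le hp1
  rw [funext (complexS_eq (p := p) ha hn f)]
  refine differentiableOn_integral_of_dominated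
    (f := fun z (t : ℝ) => t ^ (p⁻¹).toReal • f ((t : ℂ) * z))
    (fun z hz => aestronglyMeasurable_dilation_apply hf.1 hz _) ?_ fun z hz => ?_
  · filter_upwards [ae_kernelMeasure_pos p a] with t ht
    have h1 : DifferentiableOn ℂ (fun z : ℂ => f ((t : ℂ) * z)) UpperHalfPlane.upperHalfPlaneSet :=
      hf.1.comp (differentiable_id.const_mul (t : ℂ)).differentiableOn fun z hz =>
        mem_upperHalfPlaneSet.2 (by simpa using mul_pos ht (mem_upperHalfPlaneSet.1 hz))
    exact h1.const_smul (t ^ (p⁻¹).toReal)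
  · have hz' : 0 < z.im := hz
    have him : ∀ w ∈ Metric.ball z (z.im / 2), z.im / 2 < w.im := fun w hw => by
      have h1 : |(w - z).im| < z.im / 2 :=
        (Complex.abs_im_le_norm _).trans_lt (by simpa [dist_eq_norm] using hw)
      rw [Complex.sub_im, abs_lt] at h1
      linarith
    refine ⟨z.im / 2, by positivity, fun _ => C * (z.im / 2) ^ (-(p⁻¹).toReal),
      fun w hw => mem_upperHalfPlaneSet.2 (by linarith [him w hw]), integrable_const _, ?_⟩
    filter_upwards [ae_kernelMeasure_pos p a] with t ht w hw
    have hw' := him w hw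
    refine (norm_dilation_le hC ht (by linarith)).trans ?_
    have : w.im ^ (-(p⁻¹).toReal) ≤ (z.im / 2) ^ (-(p⁻¹).toReal) :=
      Real.rpow_le_rpow_of_nonpos (by positivity) hw'.le (neg_nonpos.2 ENNReal.toReal_nonneg)
    gcongr

theorem rpow_sub_one_mul_self {K : ℝ≥0∞} (hK : K ≠ ∞) {s : ℝ} (hs : 1 ≤ s) :
    K ^ (s - 1) * K = K ^ s := by
  rcases eq_or_ne K 0 with rfl | h0
  · rw [mul_zero, ENNReal.zero_rpow_of_pos (by linarith)]
  · conv_lhs => rw [← ENNReal.rpow_one K, ← ENNReal.rpow_mul, one_mul]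
    rw [← ENNReal.rpow_add _ _ h0 hK]
    congr 1; ring

/-- Dilation by t carries the line at height y to the one at height t y, where the norm is again at
most the Hardy norm of f. Jensen contributes K^(p-1) and the integration in t one more K. -/
theorem hardyNorm_complexS_le [IsFiniteMeasure (kernelMeasure p a)] (hp1 : 1 ≤ p)
    (ha : AEMeasurable a (volume.restrict (Ioi (0 : ℝ)))) (hn : ∀ t : ℝ, 0 < t → 0 ≤ a t)
    {f : ℂ → ℂ} (hf : DifferentiableOn ℂ f UpperHalfPlane.upperHalfPlaneSet) :
    hardyNorm p (complexS a f) ≤ kernelIntegral p a * hardyNorm p f := by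
  by_cases hp : p = ∞
  · subst hp
    refine hardyNorm_top_le fun z hz => ?_
    rw [complexS_eq (p := ∞) ha hn]
    refine (enorm_integral_le_lintegral_enorm _).trans ?_
    rw [← kernelMeasure_univ, mul_comm, ← lintegral_const]
    refine lintegral_mono_ae ?_
    filter_upwards [ae_kernelMeasure_pos ∞ a] with t ht
    simp only [ENNReal.inv_top, ENNReal.toReal_zero, Real.rpow_zero, one_smul]
    exact enorm_le_hardyNorm_top (by simpa using mul_pos ht hz)
  have hp0 : p ≠ 0 := (zero_lt_one.trans_le hp1).ne'
  have hpos := ENNReal.toReal_pos hp0 hp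
  have hp1' : 1 ≤ p.toReal := by simpa using ENNReal.toReal_mono hp hp1
  refine hardyNorm_le hp0 hp fun y hy => ?_
  rw [eLpNorm_eq_lintegral_rpow_enorm_toReal hp0 hp, one_div, ENNReal.rpow_inv_le_iff hpos,
    ENNReal.mul_rpow_of_nonneg _ _ hpos.le]
  simp_rw [line, complexS_eq (p := p) ha hn f]
  refine (lintegral_enorm_superposition_rpow_le (aestronglyMeasurable_dilation hf hy _) hp1').trans ?_
  have h1 : ∫⁻ t, (∫⁻ x : ℝ, ‖t ^ (p⁻¹).toReal •
      f ((t : ℂ) * ((x : ℂ) + (y : ℂ) * Complex.I))‖ₑ ^ p.toReal) ∂kernelMeasure p a ≤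
      ∫⁻ _, hardyNorm p f ^ p.toReal ∂kernelMeasure p a := by
    refine lintegral_mono_ae ?_
    filter_upwards [ae_kernelMeasure_pos p a] with t ht
    simp_rw [dilation_line_eq]
    rw [lintegral_dilation_rpow hp0 hp (line f (t * y)) ht]
    exact lintegral_line_rpow_le hp0 hp f (by positivity)
  rw [lintegral_const] at h1
  refine (mul_le_mul' le_rfl h1).trans (le_of_eq ?_)
  rw [mul_comm (hardyNorm p f ^ p.toReal), ← mul_assoc,
    rpow_sub_one_mul_self (measure_ne_top _ _) hp1', kernelMeasure_univ]

theorem MemHardy.complexS [IsFiniteMeasure (kernelMeasure p a)] (hp1 : 1 ≤ p)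
    (ha : AEMeasurable a (volume.restrict (Ioi (0 : ℝ)))) (hn : ∀ t : ℝ, 0 < t → 0 ≤ a t)
    {f : ℂ → ℂ} (hf : MemHardy p f) : MemHardy p (complexS a f) :=
  ⟨hf.differentiableOn_complexS hp1 ha hn, (hardyNorm_complexS_le hp1 ha hn hf.1).trans_lt
    (ENNReal.mul_lt_top (by rw [← kernelMeasure_univ]; exact measure_lt_top _ _) hf.2)⟩

/-! ### Boundary values of the superposition -/

theorem IsBoundaryValue.congr {f : ℂ → ℂ} {g h : ℝ → ℂ} (hg : IsBoundaryValue p f g)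
    (hgh : g =ᵐ[volume] h) : IsBoundaryValue p f h :=
  ⟨(memLp_congr_ae hgh).1 hg.1, by filter_upwards [hg.2, hgh] with x h1 h2 using h2 ▸ h1⟩

/-- For p < ∞, Jensen and Tonelli show that the p-th power of the absolute integral is integrable in
x, hence finite a.e.; for p = ∞ the integrand is essentially bounded. -/
theorem ae_integrable_real_dilation [IsFiniteMeasure (kernelMeasure p a)] (hp1 : 1 ≤ p)
    {g : ℝ → ℂ} (hg : MemLp g p) :
    ∀ᵐ x : ℝ, Integrable (fun t : ℝ => t ^ (p⁻¹).toReal • g (t * x)) (kernelMeasure p a) := by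
  have hp0 : p ≠ 0 := (zero_lt_one.trans_le hp1).ne'
  have hm := aestronglyMeasurable_real_dilation (p := p) (a := a) hg.1 (p⁻¹).toReal
  by_cases hp : p = ∞
  · subst hp
    have hb : ∀ᵐ x : ℝ, ‖g x‖ ≤ (eLpNorm g ∞ volume).toReal := by
      filter_upwards [enorm_ae_le_eLpNormEssSup g volume] with x hx
      have := ENNReal.toReal_mono hg.2.ne (hx.trans eLpNorm_exponent_top.ge)
      simpa using this
    have hb' := Measure.ae_ae_of_ae_prod
      ((quasiMeasurePreserving_dilation (p := ∞) (a := a)).ae hb)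
    filter_upwards [hm.prodMk_left, hb'] with x hx hxb
    refine Integrable.of_bound hx (eLpNorm g ∞ volume).toReal ?_
    filter_upwards [hxb] with t ht
    simpa using ht
  have hpos := ENNReal.toReal_pos hp0 hp
  have hp1' : 1 ≤ p.toReal := by simpa using ENNReal.toReal_mono hp hp1
  have h1 := lintegral_lintegral_rpow_le (Φ := fun x t : ℝ => ‖t ^ (p⁻¹).toReal • g (t * x)‖ₑ)
    hm.enorm hp1'
  have h2 : ∫⁻ t, (∫⁻ x : ℝ, ‖t ^ (p⁻¹).toReal • g (t * x)‖ₑ ^ p.toReal) ∂kernelMeasure p a =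
      ∫⁻ _, (∫⁻ x, ‖g x‖ₑ ^ p.toReal) ∂kernelMeasure p a := by
    refine lintegral_congr_ae ?_
    filter_upwards [ae_kernelMeasure_pos p a] with t ht
    exact lintegral_dilation_rpow hp0 hp g ht
  have hfin : ∫⁻ x, (∫⁻ t, ‖t ^ (p⁻¹).toReal • g (t * x)‖ₑ ∂kernelMeasure p a) ^ p.toReal ≠ ∞ := by
    refine ne_top_of_le_ne_top ?_ h1
    rw [h2, lintegral_const]
    exact ENNReal.mul_ne_top (ENNReal.rpow_ne_top_of_nonneg (by linarith) (measure_ne_top _ _))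
      (ENNReal.mul_ne_top (lintegral_rpow_enorm_lt_top_of_eLpNorm_lt_top hp0 hp hg.2).ne
        (measure_ne_top _ _))
  have hm2 : AEMeasurable (fun x => (∫⁻ t, ‖t ^ (p⁻¹).toReal • g (t * x)‖ₑ ∂kernelMeasure p a) ^
      p.toReal) volume := (hm.enorm.lintegral_prod_right').pow_const _
  filter_upwards [hm.prodMk_left, ae_lt_top' hm2 hfin] with x hx hx'
  exact ⟨hx, (ENNReal.rpow_lt_top_iff_of_pos hpos).1 hx'⟩

/-- For p = ∞ the dominating constant does not depend on the height, so dominated convergence works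
pointwise. For finite p the available bound y^(-1/p) blows up, and convergence in mean is used
instead. -/
theorem ae_tendsto_complexS_top [IsFiniteMeasure (kernelMeasure ∞ a)]
    (ha : AEMeasurable a (volume.restrict (Ioi (0 : ℝ)))) (hn : ∀ t : ℝ, 0 < t → 0 ≤ a t)
    {f : ℂ → ℂ} (hf : MemHardy ∞ f) {g : ℝ → ℂ} (hg : IsBoundaryValue ∞ f g) :
    ∀ᵐ x : ℝ, Tendsto (fun y : ℝ => complexS a f ((x : ℂ) + (y : ℂ) * Complex.I)) (𝓝[>] 0)
      (𝓝 (realS a g x)) := by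
  obtain ⟨C, -, hC⟩ := hf.exists_norm_le le_top
  filter_upwards [Measure.ae_ae_of_ae_prod
    ((quasiMeasurePreserving_dilation (p := ∞) (a := a)).ae hg.2)] with x hx
  rw [realS_eq (p := ∞) ha hn]
  simp_rw [complexS_eq (p := ∞) ha hn]
  have him : ∀ y : ℝ, y ∈ Ioi (0 : ℝ) → 0 < ((x : ℂ) + (y : ℂ) * Complex.I).im := fun y hy => by
    rw [add_mul_I_im]; exact hy
  refine tendsto_integral_filter_of_dominated_convergence (fun _ => C) ?_ ?_
    (integrable_const _) ?_
  · filter_upwards [self_mem_nhdsWithin] with y hy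
    exact aestronglyMeasurable_dilation_apply hf.1 (him y hy) _
  · filter_upwards [self_mem_nhdsWithin] with y hy
    filter_upwards [ae_kernelMeasure_pos ∞ a] with t ht
    simpa using norm_dilation_le hC ht (him y hy)
  · filter_upwards [hx, ae_kernelMeasure_pos ∞ a] with t h1 ht
    refine Tendsto.const_smul ?_ _
    have h2 : Tendsto (fun y : ℝ => t * y) (𝓝[>] 0) (𝓝[>] 0) := by
      refine tendsto_nhdsWithin_iff.2 ⟨?_, ?_⟩
      · have : Tendsto (fun y : ℝ => t * y) (𝓝 0) (𝓝 (t * 0)) := tendsto_id.const_mul _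
        rw [mul_zero] at this
        exact this.mono_left nhdsWithin_le_nhds
      · filter_upwards [self_mem_nhdsWithin] with y hy using mul_pos ht hy
    refine (h1.comp h2).congr fun y => ?_
    exact (dilation_line_eq f t x y).symm

/-- Jensen reduces the error to the ν-integral in t of the error of f itself at height t y. That
tends to 0 for each t and is bounded uniformly in t. -/
theorem tendsto_lintegral_line_complexS_sub [IsFiniteMeasure (kernelMeasure p a)] (hp1 : 1 ≤ p)
    (hp : p ≠ ∞) (ha : AEMeasurable a (volume.restrict (Ioi (0 : ℝ))))
    (hn : ∀ t : ℝ, 0 < t → 0 ≤ a t) {f : ℂ → ℂ} (hf : MemHardy p f) {g : ℝ → ℂ}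
    (hg : IsBoundaryValue p f g) {y : ℕ → ℝ} (hy0 : ∀ n, 0 < y n) (hy : Tendsto y atTop (𝓝 0)) :
    Tendsto (fun n => ∫⁻ x, ‖line (complexS a f) (y n) x - realS a g x‖ₑ ^ p.toReal) atTop
      (𝓝 0) := by
  have hp0 : p ≠ 0 := (zero_lt_one.trans_le hp1).ne'
  have hpos := ENNReal.toReal_pos hp0 hp
  have hp1' : 1 ≤ p.toReal := by simpa using ENNReal.toReal_mono hp hp1
  set σ := (p⁻¹).toReal with hσ
  set Φ : ℕ → ℝ → ℝ → ℂ := fun n x t =>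
    t ^ σ • f ((t : ℂ) * ((x : ℂ) + (y n : ℂ) * Complex.I)) - t ^ σ • g (t * x) with hΦ
  have hΦm : ∀ n, AEStronglyMeasurable (Function.uncurry (Φ n))
      ((volume : Measure ℝ).prod (kernelMeasure p a)) := fun n =>
    (aestronglyMeasurable_dilation hf.1 (hy0 n) σ).sub
      (aestronglyMeasurable_real_dilation hg.1.1 σ)
  have hE : ∀ n, ∀ t, 0 < t → ∫⁻ x, ‖Φ n x t‖ₑ ^ p.toReal =
      ∫⁻ x, ‖line f (t * y n) x - g x‖ₑ ^ p.toReal := fun n t ht => by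
    rw [← lintegral_dilation_rpow hp0 hp (fun x => line f (t * y n) x - g x) ht]
    simp only [hΦ, dilation_line_eq, ← smul_sub, hσ]
  have hbound : ∀ n, ∫⁻ x, ‖line (complexS a f) (y n) x - realS a g x‖ₑ ^ p.toReal ≤
      kernelMeasure p a univ ^ (p.toReal - 1) *
        ∫⁻ t, (∫⁻ x, ‖Φ n x t‖ₑ ^ p.toReal) ∂kernelMeasure p a := fun n => by
    refine le_trans (le_of_eq (lintegral_congr_ae ?_))
      (lintegral_enorm_superposition_rpow_le (hΦm n) hp1')
    filter_upwards [ae_integrable_real_dilation (a := a) hp1 hg.1] with x hx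
    simp only [hΦ]
    rw [integral_sub (hf.integrable_dilation hp1 (by rw [add_mul_I_im]; exact hy0 n)) hx, line,
      complexS_eq (p := p) ha hn, realS_eq (p := p) ha hn]
  have hlim : Tendsto (fun n => ∫⁻ t, (∫⁻ x, ‖Φ n x t‖ₑ ^ p.toReal) ∂kernelMeasure p a) atTop
      (𝓝 0) := by
    have hB : (2 : ℝ≥0∞) ^ (p.toReal - 1) *
        (hardyNorm p f ^ p.toReal + ∫⁻ x, ‖g x‖ₑ ^ p.toReal) ≠ ∞ := by
      refine ENNReal.mul_ne_top (ENNReal.rpow_ne_top_of_nonneg (by linarith) ENNReal.ofNat_ne_top)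
        (ENNReal.add_ne_top.2 ⟨ENNReal.rpow_ne_top_of_nonneg hpos.le hf.2.ne, ?_⟩)
      exact (lintegral_rpow_enorm_lt_top_of_eLpNorm_lt_top hp0 hp hg.1.2).ne
    have := tendsto_lintegral_of_dominated_convergence' (μ := kernelMeasure p a)
      (F := fun n t => ∫⁻ x, ‖Φ n x t‖ₑ ^ p.toReal) (f := fun _ => 0)
      (fun _ => (2 : ℝ≥0∞) ^ (p.toReal - 1) *
        (hardyNorm p f ^ p.toReal + ∫⁻ x, ‖g x‖ₑ ^ p.toReal))
      (fun n => ((hΦm n).enorm.pow_const _).lintegral_prod_left') (fun n => ?_) ?_ ?_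
    · simpa using this
    · filter_upwards [ae_kernelMeasure_pos p a] with t ht
      rw [hE n t ht]
      refine (lintegral_mono fun x => (ENNReal.rpow_le_rpow enorm_sub_le hpos.le).trans
        (ENNReal.rpow_add_le_mul_rpow_add_rpow _ _ hp1')).trans ?_
      rw [lintegral_const_mul' _ _ (ENNReal.rpow_ne_top_of_nonneg (by linarith)
        ENNReal.ofNat_ne_top), lintegral_add_right' _ (hg.1.1.enorm.pow_const _)]
      exact mul_le_mul' le_rfl (add_le_add
        (lintegral_line_rpow_le hp0 hp f (mul_pos ht (hy0 n))) le_rfl)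
    · rw [lintegral_const]
      exact ENNReal.mul_ne_top hB (measure_ne_top _ _)
    · filter_upwards [ae_kernelMeasure_pos p a] with t ht
      have h1 := hf.tendsto_lintegral_line_sub hp1 hp hg (y := fun n => t * y n)
        (fun n => mul_pos ht (hy0 n)) (by simpa using hy.const_mul t)
      exact h1.congr fun n => (hE n t ht).symm
  have h2 := ENNReal.Tendsto.const_mul (a := kernelMeasure p a univ ^ (p.toReal - 1)) hlim
    (Or.inr (ENNReal.rpow_ne_top_of_nonneg (by linarith) (measure_ne_top _ _)))
  rw [mul_zero] at h2
  exact tendsto_of_tendsto_of_tendsto_of_le_of_le tendsto_const_nhds h2 (fun _ => zero_le) hbound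

/-- The boundary value of the superposition is the superposition of the boundary values. -/
theorem IsBoundaryValue.realS [IsFiniteMeasure (kernelMeasure p a)] (hp1 : 1 ≤ p)
    (ha : AEMeasurable a (volume.restrict (Ioi (0 : ℝ)))) (hn : ∀ t : ℝ, 0 < t → 0 ≤ a t)
    {f : ℂ → ℂ} (hf : MemHardy p f) {g : ℝ → ℂ} (hg : IsBoundaryValue p f g) :
    IsBoundaryValue p (HardyHausdorff.complexS a f) (HardyHausdorff.realS a g) := by
  have hp0 : p ≠ 0 := (zero_lt_one.trans_le hp1).ne'
  have hS := hf.complexS hp1 ha hn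
  -- The superposition lies in the Hardy space, so it already has a boundary value h; it remains to
  -- identify h with the real superposition a.e.
  obtain ⟨h, hh⟩ := hS.exists_isBoundaryValue hp1
  refine hh.congr ?_
  by_cases hp : p = ∞
  · subst hp
    filter_upwards [hh.2, ae_tendsto_complexS_top ha hn hf hg] with x h1 h2
    exact tendsto_nhds_unique h1 h2
  have hpos := ENNReal.toReal_pos hp0 hp
  have hypos : ∀ n : ℕ, (0 : ℝ) < 1 / ((n : ℝ) + 1) := fun n => Nat.one_div_pos_of_nat
  have hseq : Tendsto (fun n : ℕ => 1 / ((n : ℝ) + 1)) atTop (𝓝[>] 0) :=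
    tendsto_nhdsWithin_iff.2 ⟨tendsto_one_div_add_atTop_nhds_zero_nat, Eventually.of_forall hypos⟩
  have hlim := tendsto_lintegral_line_complexS_sub hp1 hp ha hn hf hg hypos
    tendsto_one_div_add_atTop_nhds_zero_nat
  have hrm : AEStronglyMeasurable (HardyHausdorff.realS a g) volume := by
    rw [funext (realS_eq (p := p) ha hn g)]
    exact (aestronglyMeasurable_real_dilation hg.1.1 _).integral_prod_right'
  -- Fatou's lemma: the lines converge a.e. to h and in mean to the real superposition.
  have hzero : ∫⁻ x, ‖h x - HardyHausdorff.realS a g x‖ₑ ^ p.toReal = 0 := by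
    refine le_antisymm ?_ zero_le
    calc ∫⁻ x, ‖h x - HardyHausdorff.realS a g x‖ₑ ^ p.toReal
        = ∫⁻ x, liminf (fun n : ℕ => ‖line (HardyHausdorff.complexS a f) (1 / ((n : ℝ) + 1)) x -
            HardyHausdorff.realS a g x‖ₑ ^ p.toReal) atTop := by
          refine lintegral_congr_ae ?_
          filter_upwards [hh.2] with x hx
          have h1 : Tendsto (fun n : ℕ => line (HardyHausdorff.complexS a f) (1 / ((n : ℝ) + 1)) x -
            HardyHausdorff.realS a g x) atTop (𝓝 (h x - HardyHausdorff.realS a g x)) :=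
            (hx.comp hseq).sub_const _
          exact (h1.enorm.ennrpow_const p.toReal).liminf_eq.symm
      _ ≤ _ := lintegral_liminf_le' fun n =>
          ((continuous_line hS.1 (hypos n)).aestronglyMeasurable.sub hrm).enorm.pow_const _
      _ = 0 := hlim.liminf_eq
  have hm : AEMeasurable (fun x => ‖h x - HardyHausdorff.realS a g x‖ₑ ^ p.toReal) volume :=
    (hh.1.1.sub hrm).enorm.pow_const _
  rw [lintegral_eq_zero_iff' hm] at hzero
  filter_upwards [hzero] with x hx
  rw [Pi.zero_apply, ENNReal.rpow_eq_zero_iff_of_pos hpos, enorm_eq_zero, sub_eq_zero] at hx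
  exact hx

end

/-! ### Test functions -/

/-- The functions `(z + i) ^ (-s)` on the upper half-plane. -/
noncomputable def testFun (s : ℝ) (z : ℂ) : ℂ := (z + Complex.I) ^ (-(s : ℂ))

theorem add_mul_I_mem_slitPlane {z : ℂ} (hz : 0 < z.im) {τ : ℝ} (hτ : 0 ≤ τ) :
    z + τ * Complex.I ∈ Complex.slitPlane := by
  refine Complex.mem_slitPlane_iff.2 (Or.inr ?_)
  simp; linarith

theorem differentiableOn_testFun (s : ℝ) :
    DifferentiableOn ℂ (testFun s) UpperHalfPlane.upperHalfPlaneSet := by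
  refine DifferentiableOn.cpow (by fun_prop) (differentiableOn_const _) fun z hz => ?_
  simpa using add_mul_I_mem_slitPlane hz zero_le_one

theorem norm_cpow_neg (w : ℂ) (s : ℝ) : ‖w ^ (-(s : ℂ))‖ = (w.re ^ 2 + w.im ^ 2) ^ (-s / 2) := by
  have h1 : w.re ^ 2 + w.im ^ 2 = ‖w‖ ^ (2 : ℝ) := by
    rw [Real.rpow_two, ← Complex.normSq_eq_norm_sq, Complex.normSq_apply]; ring
  rw [← Complex.ofReal_neg, Complex.norm_cpow_real, h1, ← Real.rpow_mul (norm_nonneg _)]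
  congr 1; ring

theorem norm_testFun (s : ℝ) (z : ℂ) :
    ‖testFun s z‖ = (z.re ^ 2 + (z.im + 1) ^ 2) ^ (-s / 2) := by
  rw [testFun, norm_cpow_neg]; simp

theorem norm_line_testFun_le {s : ℝ} (hs : 0 ≤ s) {y : ℝ} (hy : 0 < y) (x : ℝ) :
    ‖line (testFun s) y x‖ ≤ (1 + x ^ 2) ^ (-s / 2) := by
  rw [line, norm_testFun, add_mul_I_im, add_mul_I_re]
  exact Real.rpow_le_rpow_of_nonpos (by positivity) (by nlinarith) (by linarith)

theorem ofReal_rpow_one_add_sq (s P x : ℝ) (hP : 0 ≤ P) :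
    ENNReal.ofReal ((1 + x ^ 2) ^ (-s / 2)) ^ P = ENNReal.ofReal ((1 + x ^ 2) ^ (-(s * P) / 2)) := by
  rw [ENNReal.ofReal_rpow_of_nonneg (by positivity) hP, ← Real.rpow_mul (by positivity)]
  congr 2; ring

theorem integrable_one_add_sq_rpow {r : ℝ} (hr : 1 < r) :
    Integrable fun x : ℝ => (1 + x ^ 2) ^ (-r / 2) := by
  simpa using integrable_rpow_neg_one_add_norm_sq (E := ℝ) (μ := volume) (r := r) (by simpa using hr)

section
variable {p : ℝ≥0∞}

theorem lintegral_line_testFun_le {s : ℝ} (hs : 0 ≤ s) {P : ℝ} (hP : 0 ≤ P) {y : ℝ} (hy : 0 < y) :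
    ∫⁻ x, ‖line (testFun s) y x‖ₑ ^ P ≤
      ∫⁻ x : ℝ, ENNReal.ofReal ((1 + x ^ 2) ^ (-(s * P) / 2)) := by
  refine lintegral_mono fun x => ?_
  rw [← ofReal_rpow_one_add_sq s P x hP, ← ofReal_norm]
  exact ENNReal.rpow_le_rpow (ENNReal.ofReal_le_ofReal (norm_line_testFun_le hs hy x)) hP

theorem hardyNorm_testFun_rpow_le (hp0 : p ≠ 0) (hp : p ≠ ∞) {s : ℝ} (hs : 0 ≤ s) :
    hardyNorm p (testFun s) ^ p.toReal ≤
      ∫⁻ x : ℝ, ENNReal.ofReal ((1 + x ^ 2) ^ (-(s * p.toReal) / 2)) := by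
  have hpos := ENNReal.toReal_pos hp0 hp
  rw [← ENNReal.le_rpow_inv_iff hpos]
  refine hardyNorm_le hp0 hp fun y hy => ?_
  rw [eLpNorm_eq_lintegral_rpow_enorm_toReal hp0 hp, one_div]
  exact ENNReal.rpow_le_rpow (lintegral_line_testFun_le hs hpos.le hy) (by positivity)

theorem memHardy_testFun (hp0 : p ≠ 0) (hp : p ≠ ∞) {s : ℝ} (hs : 1 < s * p.toReal) :
    MemHardy p (testFun s) := by
  have hpos := ENNReal.toReal_pos hp0 hp
  have hs0 : 0 ≤ s := by
    by_contra! h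
    nlinarith
  refine ⟨differentiableOn_testFun s, (ENNReal.rpow_lt_top_iff_of_pos hpos).1 ?_⟩
  exact (hardyNorm_testFun_rpow_le hp0 hp hs0).trans_lt
    (integrable_one_add_sq_rpow hs).lintegral_lt_top

/-! ### Asymptotic invariance of the test functions under dilations -/

/-- Apart from a scalar that tends to 1 as s → σ, dilation only moves the singularity from -i to
-i/t. -/
theorem dilation_testFun (σ s : ℝ) {t : ℝ} (ht : 0 < t) {z : ℂ} (hz : 0 < z.im) :
    t ^ σ • testFun s ((t : ℂ) * z) =
      t ^ (σ - s) • (z + ((t⁻¹ : ℝ) : ℂ) * Complex.I) ^ (-(s : ℂ)) := by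
  have hne : z + ((t⁻¹ : ℝ) : ℂ) * Complex.I ≠ 0 :=
    Complex.slitPlane_ne_zero (add_mul_I_mem_slitPlane hz (by positivity))
  have ht' : (t : ℂ) ≠ 0 := by exact_mod_cast ht.ne'
  have h1 : (t : ℂ) * z + Complex.I = (t : ℂ) * (z + ((t⁻¹ : ℝ) : ℂ) * Complex.I) := by
    push_cast
    field_simp
  rw [testFun, h1, Complex.cpow_def_of_ne_zero (mul_ne_zero ht' hne), Complex.log_ofReal_mul ht hne,
    add_mul, Complex.exp_add, ← Complex.cpow_def_of_ne_zero hne, Complex.ofReal_log ht.le,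
    ← Complex.cpow_def_of_ne_zero ht', ← Complex.ofReal_neg, ← Complex.ofReal_cpow ht.le,
    sub_eq_add_neg, Real.rpow_add ht, mul_smul, Complex.real_smul, Complex.real_smul,
    Complex.real_smul]

/-- Mean value inequality between z + i/t and z + i. The derivative decays by one extra power, so
the difference stays p-integrable as s decreases to 1/p. -/
theorem norm_cpow_shift_sub_le {s : ℝ} (hs0 : 0 ≤ s) (hs : s ≤ 2) {t : ℝ} (ht : 0 < t) {z : ℂ}
    (hz : 0 < z.im) :
    ‖(z + ((t⁻¹ : ℝ) : ℂ) * Complex.I) ^ (-(s : ℂ)) - testFun s z‖ ≤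
      2 * max 1 t ^ 3 * |t⁻¹ - 1| * (1 + z.re ^ 2) ^ (-(s + 1) / 2) := by
  -- The smaller of the two shifts 1 and 1/t: both points lie on the vertical ray S above height m.
  -- The constant comes from s ≤ 2 and m^(-(s+1)) ≤ (max 1 t)^3.
  set m : ℝ := (max 1 t)⁻¹ with hm
  have hM : 0 < max 1 t := by positivity
  have hm0 : 0 < m := inv_pos.2 hM
  have hm1 : m ≤ 1 := inv_le_one_of_one_le₀ (le_max_left _ _)
  have hmt : m ≤ t⁻¹ := inv_anti₀ ht (le_max_right _ _)
  set S : Set ℂ := {w | w.re ≤ z.re} ∩ {w | z.re ≤ w.re} ∩ {w | m ≤ w.im} with hS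
  have hconv : Convex ℝ S :=
    ((convex_halfSpace_re_le _).inter (convex_halfSpace_re_ge _)).inter (convex_halfSpace_im_ge _)
  have hder : ∀ w ∈ S, HasDerivWithinAt (fun w : ℂ => w ^ (-(s : ℂ)))
      (-(s : ℂ) * w ^ (-(s : ℂ) - 1) * 1) S w := fun w hw => by
    refine ((hasDerivAt_id w).cpow_const (Complex.mem_slitPlane_iff.2 (Or.inr ?_))).hasDerivWithinAt
    exact (hm0.trans_le hw.2).ne'
  have hbd : ∀ w ∈ S, ‖-(s : ℂ) * w ^ (-(s : ℂ) - 1) * 1‖ ≤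
      2 * max 1 t ^ 3 * (1 + z.re ^ 2) ^ (-(s + 1) / 2) := fun w hw => by
    have hre : w.re = z.re := le_antisymm hw.1.1 hw.1.2
    have him : m ≤ w.im := hw.2
    have h1 : -(s : ℂ) - 1 = -((s + 1 : ℝ) : ℂ) := by push_cast; ring
    rw [mul_one, norm_mul, norm_neg, Complex.norm_real, Real.norm_of_nonneg hs0, h1, norm_cpow_neg,
      hre, mul_assoc]
    refine mul_le_mul hs ?_ (by positivity) (by norm_num)
    have h2 : (z.re ^ 2 + w.im ^ 2) ^ (-(s + 1) / 2) ≤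
        (m ^ 2 * (1 + z.re ^ 2)) ^ (-(s + 1) / 2) := by
      refine Real.rpow_le_rpow_of_nonpos (by positivity) ?_ (by linarith)
      have h3 : m ^ 2 ≤ 1 := by nlinarith
      have h4 : m ^ 2 ≤ w.im ^ 2 := by nlinarith
      nlinarith [sq_nonneg z.re]
    refine h2.trans ?_
    rw [Real.mul_rpow (by positivity) (by positivity)]
    gcongr
    have h5 : (m ^ 2) ^ (-(s + 1) / 2) = max 1 t ^ (s + 1) := by
      rw [← Real.rpow_natCast m 2, ← Real.rpow_mul hm0.le, hm, Real.inv_rpow hM.le,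
        ← Real.rpow_neg hM.le]
      congr 1; push_cast; ring
    rw [h5, ← Real.rpow_natCast (max 1 t) 3]
    exact Real.rpow_le_rpow_of_exponent_le (le_max_left _ _) (by push_cast; linarith)
  have hmem : ∀ τ : ℝ, m ≤ τ → z + (τ : ℂ) * Complex.I ∈ S := fun τ hτ => by
    refine ⟨⟨?_, ?_⟩, ?_⟩ <;> simp
    linarith
  have key := hconv.norm_image_sub_le_of_norm_hasDerivWithin_le hder hbd
    (hmem 1 hm1) (hmem t⁻¹ hmt)
  have h6 : ‖z + ((t⁻¹ : ℝ) : ℂ) * Complex.I - (z + ((1 : ℝ) : ℂ) * Complex.I)‖ = |t⁻¹ - 1| := by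
    rw [add_sub_add_left_eq_sub, ← sub_mul, ← Complex.ofReal_sub, norm_mul, Complex.norm_I, mul_one,
      Complex.norm_real, Real.norm_eq_abs]
  rw [h6, Complex.ofReal_one, one_mul] at key
  rw [testFun]
  exact key.trans (le_of_eq (by ring))

/-- Splits the error into a scalar defect, small as s → σ, and a shift defect whose size is bounded
while the test function grows in norm. -/
theorem dilation_testFun_sub (σ s : ℝ) {t : ℝ} (ht : 0 < t) {z : ℂ} (hz : 0 < z.im) :
    t ^ σ • testFun s ((t : ℂ) * z) - testFun s z =
      (1 - t ^ (s - σ)) • (t ^ σ • testFun s ((t : ℂ) * z)) +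
        ((z + ((t⁻¹ : ℝ) : ℂ) * Complex.I) ^ (-(s : ℂ)) - testFun s z) := by
  have h1 : t ^ (s - σ) * t ^ (σ - s) = 1 := by
    rw [← Real.rpow_add ht, sub_add_sub_cancel, sub_self, Real.rpow_zero]
  rw [dilation_testFun σ s ht hz, sub_smul, one_smul, smul_smul, h1, one_smul]
  ring

theorem lintegral_dilation_testFun (hp0 : p ≠ 0) (hp : p ≠ ∞) (s : ℝ) {t y : ℝ} (ht : 0 < t)
    (hy : 0 < y) :
    ∫⁻ x : ℝ, ‖t ^ (p⁻¹).toReal • testFun s ((t : ℂ) * ((x : ℂ) + (y : ℂ) * Complex.I))‖ₑ ^ p.toReal ≤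
      hardyNorm p (testFun s) ^ p.toReal := by
  simp_rw [dilation_line_eq]
  rw [lintegral_dilation_rpow hp0 hp (line (testFun s) (t * y)) ht]
  exact lintegral_line_rpow_le hp0 hp _ (by positivity)

theorem lintegral_dilation_testFun_sub_le (hp1 : 1 ≤ p) (hp : p ≠ ∞) {s : ℝ} (hs : 1 < s * p.toReal)
    (hs2 : s ≤ 2) {t y : ℝ} (ht : 0 < t) (hy : 0 < y) :
    ∫⁻ x : ℝ, ‖t ^ (p⁻¹).toReal • testFun s ((t : ℂ) * ((x : ℂ) + (y : ℂ) * Complex.I)) -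
        testFun s ((x : ℂ) + (y : ℂ) * Complex.I)‖ₑ ^ p.toReal ≤
      2 ^ (p.toReal - 1) *
        (ENNReal.ofReal |1 - t ^ (s - (p⁻¹).toReal)| ^ p.toReal * hardyNorm p (testFun s) ^ p.toReal +
          ENNReal.ofReal (2 * max 1 t ^ 3 * |t⁻¹ - 1|) ^ p.toReal * ENNReal.ofReal Real.pi) := by
  have hp0 : p ≠ 0 := (zero_lt_one.trans_le hp1).ne'
  have hpos := ENNReal.toReal_pos hp0 hp
  have hp1' : 1 ≤ p.toReal := by simpa using ENNReal.toReal_mono hp hp1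
  have hs0 : 0 ≤ s := by
    by_contra! h
    nlinarith
  have him : ∀ x : ℝ, 0 < ((x : ℂ) + (y : ℂ) * Complex.I).im := fun x => by rwa [add_mul_I_im]
  have hπ : ∫⁻ x : ℝ, ENNReal.ofReal ((1 + x ^ 2)⁻¹) = ENNReal.ofReal Real.pi := by
    rw [← ofReal_integral_eq_lintegral_ofReal integrable_inv_one_add_sq
      (Eventually.of_forall fun x => by positivity), integral_univ_inv_one_add_sq]
  have h2 : (2 : ℝ≥0∞) ^ (p.toReal - 1) ≠ ∞ :=
    ENNReal.rpow_ne_top_of_nonneg (by linarith) ENNReal.ofNat_ne_top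
  have hc1 : ENNReal.ofReal |1 - t ^ (s - (p⁻¹).toReal)| ^ p.toReal ≠ ∞ :=
    ENNReal.rpow_ne_top_of_nonneg hpos.le ENNReal.ofReal_ne_top
  have hc2 : ENNReal.ofReal (2 * max 1 t ^ 3 * |t⁻¹ - 1|) ^ p.toReal ≠ ∞ :=
    ENNReal.rpow_ne_top_of_nonneg hpos.le ENNReal.ofReal_ne_top
  have hpt : ∀ x : ℝ, ‖t ^ (p⁻¹).toReal • testFun s ((t : ℂ) * ((x : ℂ) + (y : ℂ) * Complex.I)) -
        testFun s ((x : ℂ) + (y : ℂ) * Complex.I)‖ₑ ^ p.toReal ≤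
      2 ^ (p.toReal - 1) * (ENNReal.ofReal |1 - t ^ (s - (p⁻¹).toReal)| ^ p.toReal *
        ‖t ^ (p⁻¹).toReal • testFun s ((t : ℂ) * ((x : ℂ) + (y : ℂ) * Complex.I))‖ₑ ^ p.toReal +
      ENNReal.ofReal (2 * max 1 t ^ 3 * |t⁻¹ - 1|) ^ p.toReal *
        ENNReal.ofReal ((1 + x ^ 2)⁻¹)) := by
    intro x
    rw [dilation_testFun_sub _ s ht (him x)]
    refine (ENNReal.rpow_le_rpow (enorm_add_le _ _) hpos.le).trans
      ((ENNReal.rpow_add_le_mul_rpow_add_rpow _ _ hp1').trans ?_)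
    refine mul_le_mul' le_rfl (add_le_add (le_of_eq ?_) ?_)
    · rw [enorm_smul, ENNReal.mul_rpow_of_nonneg _ _ hpos.le, ← Real.enorm_eq_ofReal_abs]
    · have h3 := norm_cpow_shift_sub_le hs0 hs2 ht (him x)
      rw [add_mul_I_re] at h3
      rw [← ofReal_norm]
      refine (ENNReal.rpow_le_rpow (ENNReal.ofReal_le_ofReal h3) hpos.le).trans ?_
      rw [ENNReal.ofReal_mul (by positivity), ENNReal.mul_rpow_of_nonneg _ _ hpos.le,
        ofReal_rpow_one_add_sq _ _ _ hpos.le]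
      refine mul_le_mul' le_rfl (ENNReal.ofReal_le_ofReal ?_)
      rw [← Real.rpow_neg_one]
      -- Here (s + 1) p ≥ 2, because s p > 1 and p ≥ 1.
      exact Real.rpow_le_rpow_of_exponent_le (by nlinarith [sq_nonneg x]) (by nlinarith)
  refine (lintegral_mono hpt).trans (le_of_eq_of_le (lintegral_const_mul' _ _ h2)
    (mul_le_mul' le_rfl ?_))
  rw [lintegral_add_right' _ (by fun_prop), lintegral_const_mul' _ _ hc1,
    lintegral_const_mul' _ _ hc2, hπ]
  exact add_le_add (mul_le_mul' le_rfl (lintegral_dilation_testFun hp0 hp s ht hy)) le_rfl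

/-- The finer estimate grows with t and need not be ν-integrable; this crude bound supplies the
dominating constant. -/
theorem lintegral_dilation_testFun_sub_le_two (hp1 : 1 ≤ p) (hp : p ≠ ∞) (s : ℝ) {t y : ℝ}
    (ht : 0 < t) (hy : 0 < y) :
    ∫⁻ x : ℝ, ‖t ^ (p⁻¹).toReal • testFun s ((t : ℂ) * ((x : ℂ) + (y : ℂ) * Complex.I)) -
        testFun s ((x : ℂ) + (y : ℂ) * Complex.I)‖ₑ ^ p.toReal ≤
      2 ^ p.toReal * hardyNorm p (testFun s) ^ p.toReal := by
  have hp0 : p ≠ 0 := (zero_lt_one.trans_le hp1).ne'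
  have hpos := ENNReal.toReal_pos hp0 hp
  have hp1' : 1 ≤ p.toReal := by simpa using ENNReal.toReal_mono hp hp1
  have h2 : (2 : ℝ≥0∞) ^ (p.toReal - 1) ≠ ∞ :=
    ENNReal.rpow_ne_top_of_nonneg (by linarith) ENNReal.ofNat_ne_top
  have hm : AEMeasurable (fun x : ℝ => ‖testFun s ((x : ℂ) + (y : ℂ) * Complex.I)‖ₑ ^ p.toReal)
      volume :=
    (continuous_line (differentiableOn_testFun s) hy).aemeasurable.enorm.pow_const _
  refine (lintegral_mono fun x => (ENNReal.rpow_le_rpow enorm_sub_le hpos.le).trans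
    (ENNReal.rpow_add_le_mul_rpow_add_rpow _ _ hp1')).trans ?_
  rw [lintegral_const_mul' _ _ h2, lintegral_add_right' _ hm]
  refine (mul_le_mul' le_rfl (add_le_add (lintegral_dilation_testFun hp0 hp s ht hy)
    (lintegral_line_rpow_le hp0 hp (testFun s) hy))).trans (le_of_eq ?_)
  rw [← two_mul, ← mul_assoc]
  congr 1
  conv_lhs => rw [← ENNReal.rpow_one 2, ← ENNReal.rpow_mul, one_mul]
  rw [← ENNReal.rpow_add _ _ two_ne_zero ENNReal.ofNat_ne_top, sub_add_cancel]

/-- This is the p-th power integral of the critical test function (s = 1/p) on the line of height 1,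
where |z + i|² = x² + 4; it diverges like the integral of 1/|x|. -/
theorem lintegral_four_add_sq_rpow :
    ∫⁻ x : ℝ, ENNReal.ofReal ((x ^ 2 + 4) ^ (-1 / 2 : ℝ)) = ∞ := by
  by_contra hne
  have h1 : IntegrableOn (fun x : ℝ => (x ^ 2 + 4) ^ (-1 / 2 : ℝ)) (Ioi 2) := by
    refine Integrable.integrableOn ⟨?_, ?_⟩
    · refine (Continuous.rpow_const (by fun_prop) fun x => Or.inl ?_).aestronglyMeasurable
      positivity
    · rw [hasFiniteIntegral_iff_ofReal (Eventually.of_forall fun x => by positivity)]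
      exact lt_top_iff_ne_top.2 hne
  refine not_integrableOn_Ioi_inv (a := 2) ((h1.const_mul 2).mono' (by fun_prop) ?_)
  filter_upwards [ae_restrict_mem measurableSet_Ioi] with x hx
  have hx' : (2 : ℝ) < x := hx
  have hx0 : 0 < x := by linarith
  rw [Real.norm_of_nonneg (by positivity)]
  have h2 : ((2 * x) ^ 2) ^ (-1 / 2 : ℝ) ≤ (x ^ 2 + 4) ^ (-1 / 2 : ℝ) :=
    Real.rpow_le_rpow_of_nonpos (by positivity) (by nlinarith) (by norm_num)
  have h3 : ((2 * x) ^ 2) ^ (-1 / 2 : ℝ) = (2 * x)⁻¹ := by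
    rw [← Real.rpow_natCast, ← Real.rpow_mul (by positivity), ← Real.rpow_neg_one]
    norm_num
  rw [h3, mul_inv] at h2
  linarith

/-- Fatou's lemma in s on the line of height 1, with the divergent critical integral as limit. -/
theorem tendsto_hardyNorm_testFun (hp0 : p ≠ 0) (hp : p ≠ ∞) {s : ℕ → ℝ}
    (hs : Tendsto s atTop (𝓝 (p⁻¹).toReal)) :
    Tendsto (fun n => hardyNorm p (testFun (s n)) ^ p.toReal) atTop (𝓝 ∞) := by
  have hpos := ENNReal.toReal_pos hp0 hp
  have hle : ∀ n, ∫⁻ x : ℝ, ENNReal.ofReal ((x ^ 2 + 4) ^ (-(s n * p.toReal) / 2)) ≤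
      hardyNorm p (testFun (s n)) ^ p.toReal := fun n => by
    refine le_trans (le_of_eq (lintegral_congr fun x => ?_))
      (lintegral_line_rpow_le hp0 hp (testFun (s n)) one_pos)
    rw [line, ← ofReal_norm, norm_testFun, add_mul_I_im, add_mul_I_re,
      ENNReal.ofReal_rpow_of_nonneg (by positivity) hpos.le, ← Real.rpow_mul (by positivity)]
    norm_num
    congr 2; ring
  have hlim : ∀ x : ℝ, Tendsto (fun n => ENNReal.ofReal ((x ^ 2 + 4) ^ (-(s n * p.toReal) / 2)))
      atTop (𝓝 (ENNReal.ofReal ((x ^ 2 + 4) ^ (-1 / 2 : ℝ)))) := fun x => by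
    refine ENNReal.tendsto_ofReal (Tendsto.rpow tendsto_const_nhds ?_ (Or.inl (by positivity)))
    have h1 := ((hs.mul_const p.toReal).neg).div_const 2
    rwa [ENNReal.toReal_inv, inv_mul_cancel₀ hpos.ne'] at h1
  have h2 : (∞ : ℝ≥0∞) ≤ liminf (fun n => hardyNorm p (testFun (s n)) ^ p.toReal) atTop := by
    rw [← lintegral_four_add_sq_rpow]
    calc ∫⁻ x : ℝ, ENNReal.ofReal ((x ^ 2 + 4) ^ (-1 / 2 : ℝ))
        = ∫⁻ x : ℝ, liminf (fun n => ENNReal.ofReal ((x ^ 2 + 4) ^ (-(s n * p.toReal) / 2)))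
            atTop := lintegral_congr fun x => (hlim x).liminf_eq.symm
      _ ≤ liminf (fun n => ∫⁻ x : ℝ, ENNReal.ofReal ((x ^ 2 + 4) ^ (-(s n * p.toReal) / 2)))
            atTop := lintegral_liminf_le fun n => by fun_prop
      _ ≤ _ := liminf_le_liminf (Eventually.of_forall hle)
  exact tendsto_of_le_liminf_of_limsup_le h2 le_top

end

/-! ### The sharp lower bound for the operator norm -/

/-- A bound for the relative `p`-th power error made by a normalised dilation by `t` on
`testFun s`, where `M` stands for the `p`-th power of the norm of the test function. -/
noncomputable def dilationError (p : ℝ≥0∞) (s : ℝ) (M : ℝ≥0∞) (t : ℝ) : ℝ≥0∞ :=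
  min (2 ^ p.toReal) (2 ^ (p.toReal - 1) *
    (ENNReal.ofReal |1 - t ^ (s - (p⁻¹).toReal)| ^ p.toReal +
      ENNReal.ofReal (2 * max 1 t ^ 3 * |t⁻¹ - 1|) ^ p.toReal * ENNReal.ofReal Real.pi / M))

section
variable {p : ℝ≥0∞} {a : ℝ → ℝ}

theorem measurable_dilationError (s : ℝ) (M : ℝ≥0∞) : Measurable (dilationError p s M) := by
  unfold dilationError
  fun_prop

theorem lintegral_dilation_testFun_sub_le_dilationError (hp1 : 1 ≤ p) (hp : p ≠ ∞) {s : ℝ}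
    (hs : 1 < s * p.toReal) (hs2 : s ≤ 2) (h0 : hardyNorm p (testFun s) ^ p.toReal ≠ 0) {t y : ℝ}
    (ht : 0 < t) (hy : 0 < y) :
    ∫⁻ x : ℝ, ‖t ^ (p⁻¹).toReal • testFun s ((t : ℂ) * ((x : ℂ) + (y : ℂ) * Complex.I)) -
        testFun s ((x : ℂ) + (y : ℂ) * Complex.I)‖ₑ ^ p.toReal ≤
      dilationError p s (hardyNorm p (testFun s) ^ p.toReal) t *
        hardyNorm p (testFun s) ^ p.toReal := by
  have hp0 : p ≠ 0 := (zero_lt_one.trans_le hp1).ne'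
  have htop : hardyNorm p (testFun s) ^ p.toReal ≠ ∞ :=
    ENNReal.rpow_ne_top_of_nonneg ENNReal.toReal_nonneg (memHardy_testFun hp0 hp hs).2.ne
  rw [dilationError]
  rcases min_choice (2 ^ p.toReal) (2 ^ (p.toReal - 1) *
    (ENNReal.ofReal |1 - t ^ (s - (p⁻¹).toReal)| ^ p.toReal +
      ENNReal.ofReal (2 * max 1 t ^ 3 * |t⁻¹ - 1|) ^ p.toReal * ENNReal.ofReal Real.pi /
        hardyNorm p (testFun s) ^ p.toReal)) with h | h <;> rw [h]
  · exact lintegral_dilation_testFun_sub_le_two hp1 hp s ht hy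
  · rw [mul_assoc, add_mul, ENNReal.div_mul_cancel h0 htop]
    exact lintegral_dilation_testFun_sub_le hp1 hp hs hs2 ht hy

theorem complexS_sub_smul_eq [IsFiniteMeasure (kernelMeasure p a)] (hp1 : 1 ≤ p)
    (ha : AEMeasurable a (volume.restrict (Ioi (0 : ℝ)))) (hn : ∀ t : ℝ, 0 < t → 0 ≤ a t)
    {f : ℂ → ℂ} (hf : MemHardy p f) {z : ℂ} (hz : 0 < z.im) :
    complexS a f z - (kernelIntegral p a).toReal • f z =
      ∫ t, (t ^ (p⁻¹).toReal • f ((t : ℂ) * z) - f z) ∂kernelMeasure p a := by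
  rw [integral_sub (hf.integrable_dilation hp1 hz) (integrable_const _), integral_const,
    complexS_eq (p := p) ha hn, measureReal_def, kernelMeasure_univ]

theorem lintegral_complexS_testFun_sub_le [IsFiniteMeasure (kernelMeasure p a)] (hp1 : 1 ≤ p)
    (hp : p ≠ ∞) (ha : AEMeasurable a (volume.restrict (Ioi (0 : ℝ))))
    (hn : ∀ t : ℝ, 0 < t → 0 ≤ a t) {s : ℝ} (hs : 1 < s * p.toReal) (hs2 : s ≤ 2)
    (h0 : hardyNorm p (testFun s) ^ p.toReal ≠ 0) {y : ℝ} (hy : 0 < y) :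
    ∫⁻ x : ℝ, ‖complexS a (testFun s) ((x : ℂ) + (y : ℂ) * Complex.I) -
        (kernelIntegral p a).toReal • testFun s ((x : ℂ) + (y : ℂ) * Complex.I)‖ₑ ^ p.toReal ≤
      kernelIntegral p a ^ (p.toReal - 1) *
        (∫⁻ t, dilationError p s (hardyNorm p (testFun s) ^ p.toReal) t ∂kernelMeasure p a) *
        hardyNorm p (testFun s) ^ p.toReal := by
  have hp0 : p ≠ 0 := (zero_lt_one.trans_le hp1).ne'
  have hp1' : 1 ≤ p.toReal := by simpa using ENNReal.toReal_mono hp hp1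
  have hF := memHardy_testFun hp0 hp hs
  have him : ∀ x : ℝ, 0 < ((x : ℂ) + (y : ℂ) * Complex.I).im := fun x => by rwa [add_mul_I_im]
  simp_rw [fun x : ℝ => complexS_sub_smul_eq hp1 ha hn hF (him x)]
  have hm : AEStronglyMeasurable (Function.uncurry fun x t : ℝ =>
      t ^ (p⁻¹).toReal • testFun s ((t : ℂ) * ((x : ℂ) + (y : ℂ) * Complex.I)) -
        testFun s ((x : ℂ) + (y : ℂ) * Complex.I))
      ((volume : Measure ℝ).prod (kernelMeasure p a)) :=
    (aestronglyMeasurable_dilation hF.1 hy _).sub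
      ((continuous_line hF.1 hy).comp continuous_fst).aestronglyMeasurable
  refine (lintegral_enorm_superposition_rpow_le hm hp1').trans ?_
  rw [kernelMeasure_univ, mul_assoc, ← lintegral_mul_const _ (measurable_dilationError _ _)]
  refine mul_le_mul' le_rfl (lintegral_mono_ae ?_)
  filter_upwards [ae_kernelMeasure_pos p a] with t ht using
    lintegral_dilation_testFun_sub_le_dilationError hp1 hp hs hs2 h0 ht hy

/-- Write K F = S_a F - (S_a F - K F), apply Minkowski on each line, take the supremum over heights
and divide by the norm of F, which is positive and finite. -/
theorem kernelIntegral_le_add_error [IsFiniteMeasure (kernelMeasure p a)] (hp1 : 1 ≤ p)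
    (hp : p ≠ ∞) (ha : AEMeasurable a (volume.restrict (Ioi (0 : ℝ))))
    (hn : ∀ t : ℝ, 0 < t → 0 ≤ a t) {C : ℝ≥0∞}
    (hC : ∀ F : ℂ → ℂ, MemHardy p F → hardyNorm p (complexS a F) ≤ C * hardyNorm p F)
    {s : ℝ} (hs : 1 < s * p.toReal) (hs2 : s ≤ 2)
    (h0 : hardyNorm p (testFun s) ^ p.toReal ≠ 0) :
    kernelIntegral p a ≤ C + (kernelIntegral p a ^ (p.toReal - 1) *
      ∫⁻ t, dilationError p s (hardyNorm p (testFun s) ^ p.toReal) t ∂kernelMeasure p a) ^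
        p.toReal⁻¹ := by
  have hp0 : p ≠ 0 := (zero_lt_one.trans_le hp1).ne'
  have hpos := ENNReal.toReal_pos hp0 hp
  have hF := memHardy_testFun hp0 hp hs
  have hK : kernelIntegral p a ≠ ∞ := by rw [← kernelMeasure_univ]; exact measure_ne_top _ _
  have hN0 : hardyNorm p (testFun s) ≠ 0 := by
    rintro h
    rw [h, ENNReal.zero_rpow_of_pos hpos] at h0
    exact h0 rfl
  set B : ℝ≥0∞ := kernelIntegral p a ^ (p.toReal - 1) *
      ∫⁻ t, dilationError p s (hardyNorm p (testFun s) ^ p.toReal) t ∂kernelMeasure p a with hB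
  have hline : ∀ y : ℝ, 0 < y → kernelIntegral p a * eLpNorm (line (testFun s) y) p volume ≤
      (C + B ^ p.toReal⁻¹) * hardyNorm p (testFun s) := by
    intro y hy
    set k : ℝ := (kernelIntegral p a).toReal with hk
    have h1 : line (fun z => k • testFun s z) y = line (complexS a (testFun s)) y -
        line (fun z => complexS a (testFun s) z - k • testFun s z) y := by
      funext x
      simp [line]
    have h2 : eLpNorm (line (fun z => k • testFun s z) y) p volume =
        kernelIntegral p a * eLpNorm (line (testFun s) y) p volume := by
      have := eLpNorm_const_smul k (line (testFun s) y) p volume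
      rw [Real.enorm_of_nonneg ENNReal.toReal_nonneg, ENNReal.ofReal_toReal hK] at this
      exact this
    have hc1 := continuous_line (hF.complexS hp1 ha hn).1 hy
    have hc2 := continuous_line hF.1 hy
    rw [← h2, h1]
    have hc3 : AEStronglyMeasurable
        (line (fun z => complexS a (testFun s) z - k • testFun s z) y) volume :=
      (hc1.sub (hc2.const_smul k)).aestronglyMeasurable
    refine (eLpNorm_sub_le hc1.aestronglyMeasurable hc3 hp1).trans ?_
    rw [add_mul]
    refine add_le_add ((eLpNorm_line_le_hardyNorm hp0 _ hy).trans (hC _ hF)) ?_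
    rw [eLpNorm_eq_lintegral_rpow_enorm_toReal hp0 hp, one_div, ENNReal.rpow_inv_le_iff hpos,
      ENNReal.mul_rpow_of_nonneg _ _ hpos.le, ENNReal.rpow_inv_rpow hpos.ne']
    exact lintegral_complexS_testFun_sub_le hp1 hp ha hn hs hs2 h0 hy
  have hsup : kernelIntegral p a * hardyNorm p (testFun s) ≤
      (C + B ^ p.toReal⁻¹) * hardyNorm p (testFun s) := by
    conv_lhs => rw [hardyNorm_eq_iSup_eLpNorm hp0 hp]
    simp_rw [ENNReal.mul_iSup]
    exact iSup₂_le hline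
  exact (ENNReal.mul_le_mul_iff_left hN0 hF.2.ne).1 hsup

/-- Dominated convergence: for fixed t the scalar defect vanishes as s → 1/p and the shift defect is
divided by M → ∞; the minimum in the definition supplies the majorant 2^p. -/
theorem tendsto_lintegral_dilationError (hp1 : 1 ≤ p) (hp : p ≠ ∞) {ν : Measure ℝ}
    [IsFiniteMeasure ν] (hν : ∀ᵐ t ∂ν, 0 < t) {s : ℕ → ℝ} {M : ℕ → ℝ≥0∞}
    (hs : Tendsto s atTop (𝓝 (p⁻¹).toReal)) (hM : Tendsto M atTop (𝓝 ∞)) :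
    Tendsto (fun n => ∫⁻ t, dilationError p (s n) (M n) t ∂ν) atTop (𝓝 0) := by
  have hpos := ENNReal.toReal_pos (zero_lt_one.trans_le hp1).ne' hp
  have hp1' : 1 ≤ p.toReal := by simpa using ENNReal.toReal_mono hp hp1
  have h2 : (2 : ℝ≥0∞) ^ p.toReal ≠ ∞ :=
    ENNReal.rpow_ne_top_of_nonneg hpos.le ENNReal.ofNat_ne_top
  have h3 : (2 : ℝ≥0∞) ^ (p.toReal - 1) ≠ ∞ :=
    ENNReal.rpow_ne_top_of_nonneg (by linarith) ENNReal.ofNat_ne_top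
  rw [← lintegral_zero (μ := ν)]
  refine tendsto_lintegral_of_dominated_convergence (fun _ => 2 ^ p.toReal)
    (fun n => measurable_dilationError _ _)
    (fun n => Eventually.of_forall fun t => min_le_left _ _) ?_ ?_
  · rw [lintegral_const]
    exact ENNReal.mul_ne_top h2 (measure_ne_top _ _)
  filter_upwards [hν] with t ht
  have e1 : Tendsto (fun n => ENNReal.ofReal |1 - t ^ (s n - (p⁻¹).toReal)| ^ p.toReal) atTop
      (𝓝 0) := by
    have h4 : Tendsto (fun n => |1 - t ^ (s n - (p⁻¹).toReal)|) atTop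
        (𝓝 |1 - t ^ ((p⁻¹).toReal - (p⁻¹).toReal)|) :=
      (tendsto_const_nhds.sub (tendsto_const_nhds.rpow (hs.sub_const _) (Or.inl ht.ne'))).abs
    have h5 := (ENNReal.tendsto_ofReal h4).ennrpow_const p.toReal
    rwa [sub_self, Real.rpow_zero, sub_self, abs_zero, ENNReal.ofReal_zero,
      ENNReal.zero_rpow_of_pos hpos] at h5
  have e2 : Tendsto (fun n => ENNReal.ofReal (2 * max 1 t ^ 3 * |t⁻¹ - 1|) ^ p.toReal *
      ENNReal.ofReal Real.pi / M n) atTop (𝓝 0) := by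
    have hne : ENNReal.ofReal (2 * max 1 t ^ 3 * |t⁻¹ - 1|) ^ p.toReal *
        ENNReal.ofReal Real.pi ≠ ∞ := ENNReal.mul_ne_top
      (ENNReal.rpow_ne_top_of_nonneg hpos.le ENNReal.ofReal_ne_top) ENNReal.ofReal_ne_top
    have h4 := ENNReal.Tendsto.const_div hM (Or.inr hne)
    rwa [ENNReal.div_top] at h4
  have e3 := ENNReal.Tendsto.const_mul (e1.add e2) (Or.inr h3)
  rw [add_zero, mul_zero] at e3
  exact tendsto_of_tendsto_of_tendsto_of_le_of_le tendsto_const_nhds e3 (fun _ => bot_le)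
    fun _ => min_le_right _ _

theorem hardyNorm_top_one : hardyNorm ∞ (fun _ => 1) = 1 := by
  refine le_antisymm (hardyNorm_top_le fun z _ => by simp) ?_
  have h := enorm_le_hardyNorm_top (f := fun _ => (1 : ℂ)) (z := Complex.I) (by simp)
  simpa using h

theorem memHardy_top_one : MemHardy ∞ (fun _ => 1) :=
  ⟨differentiableOn_const _, by rw [hardyNorm_top_one]; exact ENNReal.one_lt_top⟩

theorem kernelIntegral_le_of_bound [IsFiniteMeasure (kernelMeasure p a)] (hp1 : 1 ≤ p)
    (ha : AEMeasurable a (volume.restrict (Ioi (0 : ℝ)))) (hn : ∀ t : ℝ, 0 < t → 0 ≤ a t)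
    {C : ℝ≥0∞}
    (hC : ∀ F : ℂ → ℂ, MemHardy p F → hardyNorm p (complexS a F) ≤ C * hardyNorm p F) :
    kernelIntegral p a ≤ C := by
  have hK : kernelIntegral p a ≠ ∞ := by rw [← kernelMeasure_univ]; exact measure_ne_top _ _
  by_cases hp : p = ∞
  · subst hp
    have h1 := hC _ memHardy_top_one
    rw [hardyNorm_top_one, mul_one] at h1
    refine le_trans ?_ ((enorm_le_hardyNorm_top (z := Complex.I) (by simp)).trans h1)
    rw [complexS_eq (p := ∞) ha hn]
    simp only [ENNReal.inv_top, ENNReal.toReal_zero, Real.rpow_zero, one_smul, integral_const,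
      measureReal_def, kernelMeasure_univ]
    rw [enorm_smul, enorm_one, mul_one, Real.enorm_of_nonneg ENNReal.toReal_nonneg,
      ENNReal.ofReal_toReal hK]
  have hp0 : p ≠ 0 := (zero_lt_one.trans_le hp1).ne'
  have hpos := ENNReal.toReal_pos hp0 hp
  have hp1' : 1 ≤ p.toReal := by simpa using ENNReal.toReal_mono hp hp1
  -- Strictly above 1/p, so that the test functions have finite norm, and at most 2, as the shift
  -- estimate requires.
  set s : ℕ → ℝ := fun n => (p⁻¹).toReal + 1 / ((n : ℝ) + 1) with hsdef
  have hs : Tendsto s atTop (𝓝 (p⁻¹).toReal) := by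
    have h1 := (tendsto_one_div_add_atTop_nhds_zero_nat (𝕜 := ℝ)).const_add (p⁻¹).toReal
    rwa [add_zero] at h1
  have hσ : (p⁻¹).toReal * p.toReal = 1 := by
    rw [ENNReal.toReal_inv, inv_mul_cancel₀ hpos.ne']
  have hs1 : ∀ n, 1 < s n * p.toReal := fun n => by
    have h1 : 0 < 1 / ((n : ℝ) + 1) * p.toReal := by positivity
    rw [hsdef]; dsimp only
    rw [add_mul, hσ]
    linarith
  have hs2 : ∀ n, s n ≤ 2 := fun n => by
    have h1 : 1 / ((n : ℝ) + 1) ≤ 1 := by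
      rw [div_le_one (by positivity)]
      have := Nat.cast_nonneg (α := ℝ) n
      linarith
    have h2 : (p⁻¹).toReal ≤ 1 := by
      rw [ENNReal.toReal_inv]
      exact inv_le_one_of_one_le₀ hp1'
    rw [hsdef]; dsimp only
    linarith
  have hN := tendsto_hardyNorm_testFun hp0 hp hs
  have hev : ∀ᶠ n in atTop, hardyNorm p (testFun (s n)) ^ p.toReal ≠ 0 :=
    (hN.eventually_ne ENNReal.top_ne_zero)
  have hE := tendsto_lintegral_dilationError hp1 hp (ae_kernelMeasure_pos p a) hs hN
  have hKp : kernelIntegral p a ^ (p.toReal - 1) ≠ ∞ :=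
    ENNReal.rpow_ne_top_of_nonneg (by linarith) hK
  have hE2 := ((ENNReal.Tendsto.const_mul hE (Or.inr hKp)).ennrpow_const p.toReal⁻¹).const_add C
  rw [mul_zero, ENNReal.zero_rpow_of_pos (by positivity), add_zero] at hE2
  refine ge_of_tendsto hE2 ?_
  filter_upwards [hev] with n h0
  exact kernelIntegral_le_add_error hp1 hp ha hn hC (hs1 n) (hs2 n) h0

end

/-! ### Boundedness forces the kernel to be integrable -/

/-- For w in the closed first quadrant the rotation centres the argument of w^(-s) in [-sπ/4, sπ/4].
As s ≤ 4/3 this lies in [-π/3, π/3], where the cosine is at least 1/2. -/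
theorem half_norm_rpow_neg_le_re {w : ℂ} (hw : w ≠ 0) (hre : 0 ≤ w.re) (him : 0 ≤ w.im) {s : ℝ}
    (hs0 : 0 ≤ s) (hs : s ≤ 4 / 3) :
    1 / 2 * ‖w‖ ^ (-s) ≤
      (Complex.exp ((s * (Real.pi / 4) : ℝ) * Complex.I) * w ^ (-(s : ℂ))).re := by
  have hn : 0 < ‖w‖ := norm_pos_iff.2 hw
  have h1 : Complex.exp ((s * (Real.pi / 4) : ℝ) * Complex.I) * w ^ (-(s : ℂ)) =
      ((Real.log ‖w‖ * (-s)).exp : ℂ) *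
        Complex.exp ((s * (Real.pi / 4 - w.arg) : ℝ) * Complex.I) := by
    rw [Complex.cpow_def_of_ne_zero hw, Complex.ofReal_exp, ← Complex.exp_add, ← Complex.exp_add,
      Complex.log]
    congr 1
    push_cast
    ring
  rw [h1, Complex.re_ofReal_mul, Complex.exp_ofReal_mul_I_re, Real.rpow_def_of_pos hn,
    mul_comm]
  refine mul_le_mul_of_nonneg_left ?_ (Real.exp_pos _).le
  have h2 : 0 ≤ w.arg := Complex.arg_nonneg_iff.2 him
  have h3 : w.arg ≤ Real.pi / 2 := (abs_le.1 (Complex.abs_arg_le_pi_div_two_iff.2 hre)).2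
  have h4 : |Real.pi / 4 - w.arg| ≤ Real.pi / 4 := abs_le.2 ⟨by linarith, by linarith⟩
  have h5 : |s * (Real.pi / 4 - w.arg)| ≤ Real.pi / 3 := by
    rw [abs_mul, abs_of_nonneg hs0]
    nlinarith [abs_nonneg (Real.pi / 4 - w.arg), Real.pi_pos]
  rw [← Real.cos_abs (s * _), ← Real.cos_pi_div_three]
  exact Real.cos_le_cos_of_nonneg_of_le_pi (abs_nonneg _) (by linarith [Real.pi_pos]) h5

theorem integral_Ioi_rpow_neg_one_sub {d : ℝ} (hd : 0 < d) {c : ℝ} (hc : 0 < c) :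
    ∫ x in Ioi c, x ^ (-(1 + d)) = c ^ (-d) / d := by
  rw [integral_Ioi_rpow_of_lt (by linarith) hc]
  rw [show -(1 + d) + 1 = -d by ring, neg_div_neg_eq]

/-- Bounds the p-th power of the test function's norm by order 1/d: on each half-line use 1 up to x
= 1 and x^(-(1+d)) beyond. -/
theorem lintegral_one_add_sq_rpow_le {d : ℝ} (hd : 0 < d) :
    ∫⁻ x : ℝ, ENNReal.ofReal ((1 + x ^ 2) ^ (-(1 + d) / 2)) ≤ ENNReal.ofReal (2 + 2 / d) := by
  have hint := integrable_one_add_sq_rpow (r := 1 + d) (by linarith)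
  rw [← ofReal_integral_eq_lintegral_ofReal hint (Eventually.of_forall fun x => by positivity)]
  refine ENNReal.ofReal_le_ofReal ?_
  have h1 : ∫ x : ℝ, (1 + x ^ 2) ^ (-(1 + d) / 2) =
      2 * ∫ x in Ioi (0 : ℝ), (1 + x ^ 2) ^ (-(1 + d) / 2) := by
    rw [← integral_comp_abs (f := fun x : ℝ => (1 + x ^ 2) ^ (-(1 + d) / 2))]
    simp_rw [sq_abs]
  have h2 : ∫ x in Ioc (0 : ℝ) 1, (1 + x ^ 2) ^ (-(1 + d) / 2) ≤ 1 := by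
    have h := setIntegral_mono_on (s := Ioc (0 : ℝ) 1) (μ := volume) hint.integrableOn
      (integrableOn_const (C := (1 : ℝ)) (by simp)) measurableSet_Ioc fun x _ =>
        Real.rpow_le_one_of_one_le_of_nonpos (by nlinarith [sq_nonneg x]) (by linarith)
    simpa using h
  have h3 : ∫ x in Ioi (1 : ℝ), (1 + x ^ 2) ^ (-(1 + d) / 2) ≤ 1 / d := by
    have h := setIntegral_mono_on (s := Ioi (1 : ℝ)) (μ := volume) hint.integrableOn
      (integrableOn_Ioi_rpow_of_lt (a := -(1 + d)) (by linarith) one_pos) measurableSet_Ioi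
      fun x hx => by
        have hx0 : 0 < x := one_pos.trans hx
        have h4 : (x ^ 2) ^ (-(1 + d) / 2) = x ^ (-(1 + d)) := by
          rw [← Real.rpow_natCast x 2, ← Real.rpow_mul hx0.le]
          congr 1; push_cast; ring
        rw [← h4]
        exact Real.rpow_le_rpow_of_nonpos (by positivity) (by linarith) (by linarith)
    rwa [integral_Ioi_rpow_neg_one_sub hd one_pos, Real.one_rpow] at h
  rw [h1, ← Ioc_union_Ioi_eq_Ioi zero_le_one, setIntegral_union (Ioc_disjoint_Ioi le_rfl)
    measurableSet_Ioi hint.integrableOn hint.integrableOn]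
  have h5 : 2 / d = 2 * (1 / d) := by ring
  linarith

/-- The exponent 1 / (3N) works because N ≤ 2^N. It keeps t^(d/p) at most 2 on [1/N, N], so the
subcritical weight t^(-s) is comparable there to t^(-1/p). -/
theorem exists_exponent_rpow_le_two {N : ℕ} (hN : 1 ≤ N) :
    ∃ d : ℝ, 0 < d ∧ d ≤ 1 / 3 ∧ (N : ℝ) ^ d ≤ 2 := by
  have hN' : (1 : ℝ) ≤ N := by exact_mod_cast hN
  refine ⟨1 / (3 * N), by positivity, ?_, ?_⟩
  · exact one_div_le_one_div_of_le (by norm_num) (by linarith)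
  · have h1 : (N : ℝ) ≤ 2 ^ (N : ℝ) := by
      rw [Real.rpow_natCast]
      exact_mod_cast Nat.lt_two_pow_self.le
    calc (N : ℝ) ^ (1 / (3 * N) : ℝ) ≤ ((2 : ℝ) ^ (N : ℝ)) ^ (1 / (3 * N) : ℝ) := by gcongr
      _ = (2 : ℝ) ^ (1 / 3 : ℝ) := by
        rw [← Real.rpow_mul (by norm_num)]
        congr 1
        field_simp
      _ ≤ (2 : ℝ) ^ (1 : ℝ) := Real.rpow_le_rpow_of_exponent_le (by norm_num) (by norm_num)
      _ = 2 := Real.rpow_one 2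

section
variable {p : ℝ≥0∞} {a : ℝ → ℝ}

/-- For z in the first quadrant all points t z + i lie there too, so after one rotation, independent
of t, the integrand has real part at least half its modulus. As a ≥ 0, nothing cancels. -/
theorem lintegral_norm_rpow_neg_le_enorm_complexS (hn : ∀ t : ℝ, 0 < t → 0 ≤ a t) {s : ℝ}
    (hs0 : 0 ≤ s) (hs : s ≤ 4 / 3) {z : ℂ} (hre : 0 ≤ z.re) (him : 0 < z.im)
    (hint : IntegrableOn (fun t : ℝ => testFun s ((t : ℂ) * z) * (a t : ℂ)) (Ioi 0)) :
    ∫⁻ t in Ioi (0 : ℝ), ENNReal.ofReal (1 / 2 * ‖(t : ℂ) * z + Complex.I‖ ^ (-s) * a t) ≤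
      ‖complexS a (testFun s) z‖ₑ := by
  set c : ℂ := Complex.exp ((s * (Real.pi / 4) : ℝ) * Complex.I) with hc
  have hcn : ‖c‖ = 1 := Complex.norm_exp_ofReal_mul_I _
  have hle : ∀ t ∈ Ioi (0 : ℝ), 1 / 2 * ‖(t : ℂ) * z + Complex.I‖ ^ (-s) * a t ≤
      (c * (testFun s ((t : ℂ) * z) * (a t : ℂ))).re := fun t ht => by
    have ht0 : 0 < t := ht
    have hne : (t : ℂ) * z + Complex.I ≠ 0 := by
      intro h
      have := congrArg Complex.im h
      simp at this
      nlinarith [mul_pos ht0 him]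
    have h1 := half_norm_rpow_neg_le_re hne (by simpa using mul_nonneg ht0.le hre)
      (by simp; nlinarith [mul_pos ht0 him]) hs0 hs
    rw [← mul_assoc, Complex.re_mul_ofReal]
    exact mul_le_mul_of_nonneg_right h1 (hn t ht0)
  have hint' : IntegrableOn (fun t : ℝ => (c * (testFun s ((t : ℂ) * z) * (a t : ℂ))).re) (Ioi 0) :=
    (hint.const_mul c).re
  refine (setLIntegral_mono' measurableSet_Ioi fun t ht => ENNReal.ofReal_le_ofReal (hle t ht)).trans ?_
  rw [← ofReal_integral_eq_lintegral_ofReal hint' ((ae_restrict_iff' measurableSet_Ioi).2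
    (Eventually.of_forall fun t ht => ?_)), ← ofReal_norm]
  · refine ENNReal.ofReal_le_ofReal ?_
    have h2 : ∫ t in Ioi (0 : ℝ), (c * (testFun s ((t : ℂ) * z) * (a t : ℂ))).re =
        (c * complexS a (testFun s) z).re := by
      rw [complexS, ← integral_const_mul]
      exact integral_re (𝕜 := ℂ) (hint.const_mul c)
    rw [h2]
    refine (Complex.re_le_norm _).trans ?_
    rw [norm_mul, hcn, one_mul]
  · have h3 := hn t ht
    exact le_trans (by positivity) (hle t ht)

theorem kernelMeasure_Icc_mul_le (hp1 : 1 ≤ p) (hp : p ≠ ∞)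
    (hn : ∀ t : ℝ, 0 < t → 0 ≤ a t) {N : ℕ} (hN : 1 ≤ N) {d : ℝ} (hd : 0 < d)
    (hd3 : d ≤ 1 / 3) (hNd : (N : ℝ) ^ d ≤ 2) {x : ℝ} (hx : N ≤ x)
    (hint : IntegrableOn (fun t : ℝ => testFun ((1 + d) * p.toReal⁻¹)
      ((t : ℂ) * ((x : ℂ) + ((1 : ℝ) : ℂ) * Complex.I)) * (a t : ℂ)) (Ioi 0)) :
    ENNReal.ofReal (1 / 4 * (3 * x) ^ (-((1 + d) * p.toReal⁻¹))) *
        kernelMeasure p a (Icc (1 / N : ℝ) N) ≤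
      ‖complexS a (testFun ((1 + d) * p.toReal⁻¹)) ((x : ℂ) + ((1 : ℝ) : ℂ) * Complex.I)‖ₑ := by
  have hp0 : p ≠ 0 := (zero_lt_one.trans_le hp1).ne'
  have hpos := ENNReal.toReal_pos hp0 hp
  have hp1' : 1 ≤ p.toReal := by simpa using ENNReal.toReal_mono hp hp1
  have hN' : (1 : ℝ) ≤ N := by exact_mod_cast hN
  have hx0 : 0 < x := by linarith
  have hinv : p.toReal⁻¹ ≤ 1 := inv_le_one_of_one_le₀ hp1'
  have hinv0 : 0 < p.toReal⁻¹ := inv_pos.2 hpos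
  set s : ℝ := (1 + d) * p.toReal⁻¹ with hs
  have hs0 : 0 ≤ s := by positivity
  have hs1 : s ≤ 4 / 3 := by nlinarith
  refine le_trans ?_ (lintegral_norm_rpow_neg_le_enorm_complexS hn hs0 hs1
    (by rw [add_mul_I_re]; exact hx0.le) (by rw [add_mul_I_im]; exact one_pos) hint)
  have hsub : Icc (1 / N : ℝ) N ⊆ Ioi 0 := fun t ht =>
    lt_of_lt_of_le (by positivity) ht.1
  rw [kernelMeasure, withDensity_apply _ measurableSet_Icc, Measure.restrict_restrict
    measurableSet_Icc, inter_eq_self_of_subset_left hsub,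
    ← lintegral_const_mul' _ _ ENNReal.ofReal_ne_top]
  refine le_trans (setLIntegral_mono' measurableSet_Icc fun t ht => ?_)
    (lintegral_mono_set hsub)
  have ht0 : 0 < t := hsub ht
  have hat := hn t ht0
  have htN : 1 ≤ t * N := by
    have := ht.1
    rwa [div_le_iff₀ (by positivity)] at this
  rw [← ENNReal.ofReal_mul (by positivity), ← mul_assoc]
  refine ENNReal.ofReal_le_ofReal (mul_le_mul_of_nonneg_right ?_ hat)
  -- The modulus is at most t x + t + 1, and both t and 1 are at most t x because x ≥ N ≥ 1 and t ≥
  -- 1/N.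
  have h1 : ‖(t : ℂ) * ((x : ℂ) + ((1 : ℝ) : ℂ) * Complex.I) + Complex.I‖ ≤ 3 * x * t := by
    refine (norm_add_le _ _).trans ?_
    rw [norm_mul, Complex.norm_I, Complex.norm_real, Real.norm_of_nonneg ht0.le]
    have h2 : ‖(x : ℂ) + ((1 : ℝ) : ℂ) * Complex.I‖ ≤ x + 1 := by
      refine (norm_add_le _ _).trans ?_
      simp [abs_of_pos hx0]
    nlinarith
  have hne : 0 < ‖(t : ℂ) * ((x : ℂ) + ((1 : ℝ) : ℂ) * Complex.I) + Complex.I‖ := by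
    refine norm_pos_iff.2 fun h => ?_
    have := congrArg Complex.im h
    simp at this
    linarith
  have h3 := Real.rpow_le_rpow_of_nonpos hne h1 (neg_nonpos.2 hs0)
  rw [Real.mul_rpow (by positivity) ht0.le] at h3
  have h4 : t ^ (-(p⁻¹).toReal) ≤ 2 * t ^ (-s) := by
    have h5 : -(p⁻¹).toReal = -s + d * p.toReal⁻¹ := by
      rw [ENNReal.toReal_inv, hs]; ring
    rw [h5, Real.rpow_add ht0, mul_comm]
    refine mul_le_mul_of_nonneg_right ?_ (by positivity)
    calc t ^ (d * p.toReal⁻¹) ≤ (N : ℝ) ^ (d * p.toReal⁻¹) :=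
          Real.rpow_le_rpow ht0.le ht.2 (by positivity)
      _ ≤ (N : ℝ) ^ d := Real.rpow_le_rpow_of_exponent_le hN' (by nlinarith)
      _ ≤ 2 := hNd
  calc 1 / 4 * (3 * x) ^ (-s) * t ^ (-(p⁻¹).toReal)
      ≤ 1 / 4 * (3 * x) ^ (-s) * (2 * t ^ (-s)) := by gcongr
    _ = 1 / 2 * ((3 * x) ^ (-s) * t ^ (-s)) := by ring
    _ ≤ _ := by gcongr

/-- On the line of height 1 the image of the test function is bounded below for x > N. Its p-th
power integral is at least a constant times ν([1/N, N])^p / d and at most C^p (2 + 2/d), so d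
cancels and the bound is independent of N. -/
theorem kernelMeasure_Icc_rpow_le (hp1 : 1 ≤ p) (hp : p ≠ ∞)
    (hn : ∀ t : ℝ, 0 < t → 0 ≤ a t)
    (hint : ∀ F : ℂ → ℂ, MemHardy p F → ∀ z ∈ UpperHalfPlane.upperHalfPlaneSet,
      IntegrableOn (fun t : ℝ => F ((t : ℂ) * z) * (a t : ℂ)) (Ioi 0))
    {C : ℝ≥0∞}
    (hC : ∀ F : ℂ → ℂ, MemHardy p F → hardyNorm p (complexS a F) ≤ C * hardyNorm p F)
    {N : ℕ} (hN : 1 ≤ N) :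
    kernelMeasure p a (Icc (1 / N : ℝ) N) ^ p.toReal ≤
      C ^ p.toReal * ENNReal.ofReal (4 ^ p.toReal * 48) := by
  have hp0 : p ≠ 0 := (zero_lt_one.trans_le hp1).ne'
  have hpos := ENNReal.toReal_pos hp0 hp
  obtain ⟨d, hd, hd3, hNd⟩ := exists_exponent_rpow_le_two hN
  have hN' : (1 : ℝ) ≤ N := by exact_mod_cast hN
  have hN0 : (0 : ℝ) < N := by linarith
  set P := p.toReal with hP
  set s : ℝ := (1 + d) * P⁻¹ with hs
  have hsP : s * P = 1 + d := by rw [hs, inv_mul_cancel_right₀ hpos.ne']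
  have hF : MemHardy p (testFun s) := memHardy_testFun hp0 hp (by rw [← hP, hsP]; linarith)
  set m := kernelMeasure p a (Icc (1 / N : ℝ) N) with hm
  have hupper : ∫⁻ x, ‖line (complexS a (testFun s)) 1 x‖ₑ ^ P ≤
      C ^ P * ENNReal.ofReal (2 + 2 / d) := by
    refine (lintegral_line_rpow_le hp0 hp _ one_pos).trans
      ((ENNReal.rpow_le_rpow (hC _ hF) hpos.le).trans ?_)
    rw [ENNReal.mul_rpow_of_nonneg _ _ hpos.le]
    refine mul_le_mul' le_rfl ((hardyNorm_testFun_rpow_le hp0 hp (by positivity)).trans ?_)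
    rw [← hP, hsP]
    exact lintegral_one_add_sq_rpow_le hd
  have hlower : ENNReal.ofReal ((4 ^ P * (18 * d))⁻¹) * m ^ P ≤
      ∫⁻ x, ‖line (complexS a (testFun s)) 1 x‖ₑ ^ P := by
    have h1 : ∀ x ∈ Ioi (N : ℝ), ENNReal.ofReal ((4 ^ P)⁻¹ * (3 ^ (-(1 + d)) * x ^ (-(1 + d)))) *
        m ^ P ≤ ‖line (complexS a (testFun s)) 1 x‖ₑ ^ P := fun x hx => by
      have hx0 : 0 < x := hN0.trans hx
      have h2 := ENNReal.rpow_le_rpow (kernelMeasure_Icc_mul_le hp1 hp hn hN hd hd3 hNd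
        (le_of_lt hx) (hint _ hF _ (mem_upperHalfPlaneSet.2 (by rw [add_mul_I_im]; exact one_pos))))
        hpos.le
      rw [ENNReal.mul_rpow_of_nonneg _ _ hpos.le, ENNReal.ofReal_rpow_of_nonneg (by positivity)
        hpos.le, Real.mul_rpow (by norm_num) (by positivity), ← Real.rpow_mul (by positivity),
        neg_mul, ← hP, ← hs, hsP, Real.mul_rpow (by norm_num) hx0.le, one_div,
        Real.inv_rpow (by norm_num)] at h2
      exact h2
    have hi : IntegrableOn (fun x : ℝ => (4 ^ P)⁻¹ * (3 ^ (-(1 + d)) * x ^ (-(1 + d)))) (Ioi N) :=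
      ((integrableOn_Ioi_rpow_of_lt (by linarith) hN0).const_mul _).const_mul _
    refine le_trans ?_ ((setLIntegral_mono' measurableSet_Ioi h1).trans (setLIntegral_le_lintegral _ _))
    rw [lintegral_mul_const'' _ hi.aemeasurable.ennreal_ofReal,
      ← ofReal_integral_eq_lintegral_ofReal hi ((ae_restrict_iff' measurableSet_Ioi).2
        (Eventually.of_forall fun x hx => by
          have : 0 < x := hN0.trans hx
          positivity)), integral_const_mul, integral_const_mul,
      integral_Ioi_rpow_neg_one_sub hd hN0]
    refine mul_le_mul' (ENNReal.ofReal_le_ofReal ?_) le_rfl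
    rw [mul_inv]
    refine mul_le_mul_of_nonneg_left ?_ (by positivity)
    have h3 : (9 : ℝ)⁻¹ ≤ 3 ^ (-(1 + d)) := by
      calc (9 : ℝ)⁻¹ = 3 ^ (-2 : ℝ) := by norm_num
        _ ≤ _ := Real.rpow_le_rpow_of_exponent_le (by norm_num) (by linarith)
    have h4 : (2 : ℝ)⁻¹ ≤ (N : ℝ) ^ (-d) := by
      rw [Real.rpow_neg hN0.le]
      exact inv_anti₀ (by positivity) hNd
    -- The 18 is 9 · 2: 3^(-(1+d)) ≥ 1/9 and N^(-d) ≥ 1/2.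
    calc (18 * d)⁻¹ = 9⁻¹ * (2⁻¹ / d) := by field_simp; norm_num
      _ ≤ _ := by gcongr
  have h5 := mul_le_mul' (le_refl (ENNReal.ofReal (4 ^ P * (18 * d)))) (hlower.trans hupper)
  rw [← mul_assoc, ← ENNReal.ofReal_mul (by positivity), mul_inv_cancel₀ (by positivity),
    ENNReal.ofReal_one, one_mul, mul_left_comm, ← ENNReal.ofReal_mul (by positivity)] at h5
  refine h5.trans (mul_le_mul' le_rfl (ENNReal.ofReal_le_ofReal ?_))
  -- With d ≤ 1/3 this is at most 4^P · 48.
  have h6 : 4 ^ P * (18 * d) * (2 + 2 / d) = 4 ^ P * (36 * d + 36) := by field_simp; ring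
  rw [h6]
  gcongr
  linarith

theorem kernelMeasure_univ_eq_iSup (p : ℝ≥0∞) (a : ℝ → ℝ) :
    kernelMeasure p a univ =
      ⨆ n : ℕ, kernelMeasure p a (Icc (1 / ((n + 1 : ℕ) : ℝ)) ((n + 1 : ℕ) : ℝ)) := by
  have hmono : Monotone fun n : ℕ => Icc (1 / ((n + 1 : ℕ) : ℝ)) ((n + 1 : ℕ) : ℝ) :=
    fun n k hnk => Icc_subset_Icc (by gcongr) (by gcongr)
  rw [← hmono.measure_iUnion]
  refine measure_congr ?_
  filter_upwards [ae_kernelMeasure_pos p a] with t ht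
  refine propext ⟨fun _ => ?_, fun _ => trivial⟩
  obtain ⟨n, hn⟩ := exists_nat_ge (max t t⁻¹)
  refine mem_iUnion.2 ⟨n, ?_, ?_⟩
  · rw [one_div]
    refine inv_le_of_inv_le₀ ht (((le_max_right _ _).trans hn).trans ?_)
    push_cast; linarith
  · refine ((le_max_left _ _).trans hn).trans ?_
    push_cast; linarith

theorem IsBoundedOnHardy.kernelIntegral_lt_top (hp1 : 1 ≤ p)
    (ha : AEMeasurable a (volume.restrict (Ioi (0 : ℝ)))) (hn : ∀ t : ℝ, 0 < t → 0 ≤ a t)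
    (h : IsBoundedOnHardy p a) : kernelIntegral p a < ∞ := by
  obtain ⟨hint, C, hC⟩ := h
  rw [← kernelMeasure_univ]
  by_cases hp : p = ∞
  · subst hp
    -- For p = ∞, absolute convergence of the integral for the constant function 1 is already the
    -- integrability of a.
    have h1 := (hint _ memHardy_top_one).1 Complex.I (by simp)
    rw [integrableOn_mul_iff (p := ∞) ha hn (fun _ => 1)] at h1
    simp only [ENNReal.inv_top, ENNReal.toReal_zero, Real.rpow_zero, one_smul] at h1
    simpa [integrable_const_iff, isFiniteMeasure_iff] using h1
  have hpos := ENNReal.toReal_pos (zero_lt_one.trans_le hp1).ne' hp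
  rw [kernelMeasure_univ_eq_iSup]
  -- The intervals [1/N, N] exhaust (0, ∞), so the bound uniform in N passes to the total mass.
  refine lt_of_le_of_lt (iSup_le fun n => (ENNReal.le_rpow_inv_iff hpos).2
    (kernelMeasure_Icc_rpow_le hp1 hp hn (fun F hF => (hint F hF).1) hC n.succ_pos)) ?_
  exact ENNReal.rpow_lt_top_of_nonneg (by positivity) (ENNReal.mul_ne_top
    (ENNReal.rpow_ne_top_of_nonneg hpos.le ENNReal.coe_ne_top) ENNReal.ofReal_ne_top)

theorem isFiniteMeasure_kernelMeasure (h : kernelIntegral p a < ∞) :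
    IsFiniteMeasure (kernelMeasure p a) :=
  ⟨by rwa [kernelMeasure_univ]⟩

theorem isBoundedOnHardy_of_kernelIntegral_lt_top (hp1 : 1 ≤ p)
    (ha : AEMeasurable a (volume.restrict (Ioi (0 : ℝ)))) (hn : ∀ t : ℝ, 0 < t → 0 ≤ a t)
    (h : kernelIntegral p a < ∞) : IsBoundedOnHardy p a := by
  have := isFiniteMeasure_kernelMeasure h
  refine ⟨fun F hF => ⟨fun z hz => ?_, hF.complexS hp1 ha hn⟩, (kernelIntegral p a).toNNReal,
    fun F hF => ?_⟩
  · exact (integrableOn_mul_iff (p := p) ha hn fun t : ℝ => F ((t : ℂ) * z)).2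
      (hF.integrable_dilation hp1 hz)
  · rw [ENNReal.coe_toNNReal h.ne]
    exact hardyNorm_complexS_le hp1 ha hn hF.1

theorem hardyOpNorm_complexS (hp1 : 1 ≤ p)
    (ha : AEMeasurable a (volume.restrict (Ioi (0 : ℝ)))) (hn : ∀ t : ℝ, 0 < t → 0 ≤ a t)
    (h : kernelIntegral p a < ∞) : hardyOpNorm p (complexS a) = kernelIntegral p a := by
  have := isFiniteMeasure_kernelMeasure h
  exact le_antisymm (sInf_le fun F hF => hardyNorm_complexS_le hp1 ha hn hF.1)
    (le_sInf fun C hC => kernelIntegral_le_of_bound hp1 ha hn hC)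

end

end HardyHausdorff

theorem theorem3p5 (p : ℝ≥0∞) (hp : 1 ≤ p) (a : ℝ → ℝ)
    (ha_meas : AEMeasurable a (volume.restrict (Ioi (0 : ℝ))))
    (ha_nonneg : ∀ t : ℝ, 0 < t → 0 ≤ a t) :
    (HardyHausdorff.IsBoundedOnHardy p a ↔ HardyHausdorff.kernelIntegral p a < ∞) ∧
    (HardyHausdorff.kernelIntegral p a < ∞ →
      HardyHausdorff.hardyOpNorm p (HardyHausdorff.complexS a) =
          HardyHausdorff.kernelIntegral p a ∧
      ∀ f : ℂ → ℂ, HardyHausdorff.MemHardy p f →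
        (∃ g : ℝ → ℂ, HardyHausdorff.IsBoundaryValue p f g) ∧
        ∀ g : ℝ → ℂ, HardyHausdorff.IsBoundaryValue p f g →
          (∀ᵐ x : ℝ, IntegrableOn (fun t : ℝ => g (t * x) * (a t : ℂ)) (Ioi 0)) ∧
          HardyHausdorff.IsBoundaryValue p (HardyHausdorff.complexS a f)
            (HardyHausdorff.realS a g)) := by
  refine ⟨⟨fun h => h.kernelIntegral_lt_top hp ha_meas ha_nonneg,
    HardyHausdorff.isBoundedOnHardy_of_kernelIntegral_lt_top hp ha_meas ha_nonneg⟩, fun h =>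
    ⟨HardyHausdorff.hardyOpNorm_complexS hp ha_meas ha_nonneg h, fun f hf =>
      ⟨hf.exists_isBoundaryValue hp, fun g hg => ?_⟩⟩⟩
  have := HardyHausdorff.isFiniteMeasure_kernelMeasure h
  refine ⟨?_, hg.realS hp ha_meas ha_nonneg hf⟩
  filter_upwards [HardyHausdorff.ae_integrable_real_dilation (a := a) hp hg.1] with x hx
  exact (HardyHausdorff.integrableOn_mul_iff (p := p) ha_meas ha_nonneg fun t => g (t * x)).2 hx
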